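/- Let $W$ be a random variable with $\mathbf P[W>0]=1$, $\mathbf E[W]=1$, $\mathbf E[|W\log_2 W|]<\infty$ and $\mathbf E[W\log_2 W]<1$. For $n\ge 0$ let $\mathcal I_n$ be the set of dyadic intervals $[k2^{-n},(k+1)2^{-n}]$, $0\le k<2^n$, put $\mathcal I=\bigcup_{n\ge0}\mathcal I_n$, and let $(W_I)_{I\in\mathcal I}$ be independent random variables, each with the law of $W$. For $x\in[0,1]$ let $I_j(x)$ be the interval of $\mathcal I_j$ that contains $x$ (the one whose maximum is $x$, if there are two). Let $\mu_n$ be the random measure on $[0,1]$ with Lebesgue density $w_n(x)=\prod_{j=0}^{n-1}W_{I_j(x)}$, and let $\mu$ be the weak limit of $\mu_n$ as $n\to\infty$, which exists almost surely. On $[0,1]$ let $\rho$ be the random distance $\rho(x,y)=\mu([x,y])$ for $x\le y$, $\rho(y,x)=\rho(x,y)$ (almost surely a metric). For $s\in(0,1)$ put $\phi(s)=s-\log_2\mathbf E[W^s]$. **Theorem.** Let $K\subseteq[0,1]$ be a deterministic Borel set or, more generally, an analytic (Suslin) set. Let $\zeta_0$ be the Hausdorff dimension of $K$ with respect to the Euclidean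 metric, and $\zeta$ its Hausdorff dimension with respect to $\rho$. Then almost surely $$\zeta\ \ge\ \sup\bigl\{s\in(0,1)\ :\ \phi(s)<\zeta_0,\ \mathbf E[W^{-s}]<\infty\bigr\},$$ where the supremum of the empty set is $0$. -/

import Mathlib

open MeasureTheory ProbabilityTheory Filter Topology
open scoped ENNReal NNReal

noncomputable section

namespace Cascade

/-! ### Hausdorff dimension with respect to a distance function -/

section Dimension

variable {X : Type*}

/-- The diameter of `A` with respect to the distance function `d`. -/
def diamOf (d : X → X → ℝ≥0∞) (A : Set X) : ℝ≥0∞ :=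
  ⨆ x ∈ A, ⨆ y ∈ A, d x y

/-- The `s`-dimensional Hausdorff (outer) measure of `A` with respect to `d`: the limit as
`r ↓ 0` of the infimum of `∑ (diam tₙ) ^ s` over countable covers of `A` by sets of
diameter at most `r`. -/
def hausdorffMeasureOf (d : X → X → ℝ≥0∞) (s : ℝ) (A : Set X) : ℝ≥0∞ :=
  ⨆ (r : ℝ≥0∞) (_ : 0 < r),
    ⨅ (t : ℕ → Set X) (_ : A ⊆ ⋃ n, t n) (_ : ∀ n, diamOf d (t n) ≤ r),
      ∑' n, ⨆ _ : (t n).Nonempty, diamOf d (t n) ^ s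

/-- The Hausdorff dimension of `A` with respect to `d`. -/
def dimHOf (d : X → X → ℝ≥0∞) (A : Set X) : ℝ≥0∞ :=
  ⨆ (s : ℝ≥0) (_ : hausdorffMeasureOf d s A = ∞), (s : ℝ≥0∞)

/-- For the distance of a metric space, `dimHOf` is Mathlib's Hausdorff dimension. -/
theorem dimHOf_edist [EMetricSpace X] (A : Set X) :
    dimHOf (fun x y : X => edist x y) A = dimH A := by
  borelize X
  rw [dimH_def]
  simp only [dimHOf]
  have h : ∀ s : ℝ≥0, hausdorffMeasureOf (fun x y : X => edist x y) s A = μH[s] A := by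
    intro s
    rw [Measure.hausdorffMeasure_apply]
    rfl
  simp only [h]

end Dimension

/-! ### The multiplicative cascade -/

/-- The pair `⟨n, k⟩` with `k < 2 ^ n` stands for the dyadic interval
`[k 2⁻ⁿ, (k + 1) 2⁻ⁿ] ⊆ [0, 1]`. -/
abbrev Dyadic : Type := Σ n : ℕ, Fin (2 ^ n)

/-- For `x ∈ [0, 1]`, the dyadic interval `I_n(x)` of length `2⁻ⁿ` that contains `x`; if there are
two of them, the one whose maximum is `x`. Thus its number `k` is `⌈2ⁿ x⌉ - 1` if `0 < x ≤ 1` and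
is `0` if `x = 0`. (The minimum with `2 ^ n - 1` matters only for `x > 1`.) -/
def dyadicAt (n : ℕ) (x : ℝ) : Dyadic :=
  ⟨n, ⟨min (⌈x * 2 ^ n⌉₊ - 1) (2 ^ n - 1),
    lt_of_le_of_lt (min_le_right _ _) (Nat.sub_lt (by positivity) one_pos)⟩⟩

/-- The density `w_n(x) = ∏_{j < n} v (I_j(x))` for the family of weights `v`. -/
def density (v : Dyadic → ℝ) (n : ℕ) (x : ℝ) : ℝ :=
  ∏ j ∈ Finset.range n, v (dyadicAt j x)

theorem density_le (v : Dyadic → ℝ) (n : ℕ) (x : ℝ) :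
    density v n x ≤ ∏ j ∈ Finset.range n, ∑ k : Fin (2 ^ j), |v ⟨j, k⟩| := by
  refine (le_abs_self _).trans ?_
  rw [density, Finset.abs_prod]
  refine Finset.prod_le_prod (fun _ _ => abs_nonneg _) fun j _ => ?_
  exact Finset.single_le_sum (f := fun k : Fin (2 ^ j) => |v ⟨j, k⟩|)
    (fun _ _ => abs_nonneg _) (Finset.mem_univ (dyadicAt j x).2)

/-- The measure `μ_n = w_n μ_0`, where `μ_0` is Lebesgue measure on `[0, 1]`. -/
def approxMeasure (v : Dyadic → ℝ) (n : ℕ) : FiniteMeasure ℝ :=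
  ⟨(volume.restrict (Set.Icc (0 : ℝ) 1)).withDensity fun x => ENNReal.ofReal (density v n x), by
    refine isFiniteMeasure_withDensity (ne_of_lt ?_)
    refine (lintegral_mono fun x => ENNReal.ofReal_le_ofReal (density_le v n x)).trans_lt ?_
    rw [lintegral_const]
    exact ENNReal.mul_lt_top ENNReal.ofReal_lt_top (measure_lt_top _ _)⟩

/-- The cascade measure `μ`, the weak limit of the measures `μ_n`. -/
def cascadeMeasure (v : Dyadic → ℝ) : FiniteMeasure ℝ :=
  limUnder atTop (approxMeasure v)

/-- The distance `ρ(x, y) = μ[x, y]` for `x ≤ y`, and symmetrically for `y ≤ x`. -/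
def rho (v : Dyadic → ℝ) (x y : ℝ) : ℝ≥0∞ :=
  (cascadeMeasure v : Measure ℝ) (Set.Icc (min x y) (max x y))

/-- The function `φ(s) = s - log₂ E[W ^ s]`. -/
def phi {Ω : Type*} [MeasurableSpace Ω] (P : Measure Ω) (W : Ω → ℝ) (s : ℝ) : ℝ :=
  s - Real.logb 2 (∫ ω, W ω ^ s ∂P)

end Cascade

end

/-! Fix an admissible s, put m = E[W^s], and choose t with φ(s) < t < ζ₀. A Frostman argument
(`exists_isCompact_isFlow`), which reaches analytic sets through capacitability of a dyadic content,
gives a flow θ carried by cells that meet a compact C ⊆ K, with mass at most 2^(-tn) on cells of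
level n. Multiply θ by a second cascade with the normalised weights W^s / m. The resulting masses on
the cells of level n, with total N, should behave like an s-dimensional mass distribution for ρ.
This is tested by a discrete energy: the sum over pairs of cells x, y of the product of their masses
times the (-s)-th power of the cascade mass of `sep x y`, a dyadic cell inside the convex hull of x
and y.

The choice of a dyadic separating cell makes the mean of each term computable. Each weight above
`sep x y` enters the kernel with power -s, cancels one factor W^s of the two path products, and
leaves 2^s where there would have been m. So (`lintegral_pathProd_mul_pathProd_mul_mass`) a pair
contributes θ(x) θ(y) (2^s / m)^|sep x y| E[Y^(-s)], with Y the total mass of the cascade. These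
terms have bounded sums (`IsFlow.exists_sum_sep_le`) because (2^s / m) 2^(-t) < 1, which is the
inequality φ(s) < t. The moment E[Y^(-s)] is finite by a recursive inequality, given E[W^(-s)] < ∞
and Y > 0 almost surely; the latter is where E[W log₂ W] < 1 enters, through a decreasing entropy.

Since no separating cell has more mass than Y, N² is at most the energy times Y^s. Hölder's
inequality then shows that the variables N are uniformly integrable, so with positive probability
the energy is at most k N² for some k and infinitely many levels (`measure_goodSet_pos`). A zero-one
law upgrades this to almost surely.

On that event take any countable cover of C, enlarge its sets to open intervals, and go to a level
so fine that each relevant cell lies in one of them. Two cells in the same interval have their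
separating cell there too, so Cauchy–Schwarz gives N² ≤ k N² ∑ diam^s up to an arbitrarily small
error (`one_le_mul_tsum_diamOf`). Hence ∑ diam^s is bounded below, and the ρ-dimension is at least
s. No limit of the tilted masses is taken, and of the measure μ only a lower bound on closed cells
is used (`mass_le_cascadeMeasure`). -/

noncomputable section

namespace Cascade

/-! ### Weights indexed by binary words -/

/-- A family of nonnegative weights indexed by the nodes of the binary tree. -/
abbrev Weights : Type := List Bool → ℝ≥0

namespace Weights

/-- The family of weights on the subtree below the child `b` of the root. -/
def child (b : Bool) (v : Weights) : Weights := fun x => v (b :: x)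

/-- The family of weights on the subtree below the node `x`. -/
def subtree : List Bool → Weights → Weights
  | [], v => v
  | b :: x, v => subtree x (child b v)

/-- The tree with root weight `a` and subtrees `u`, `w`. -/
def node (p : ℝ≥0 × Weights × Weights) : Weights
  | [] => p.1
  | false :: x => p.2.1 x
  | true :: x => p.2.2 x

@[simp] theorem node_nil (p : ℝ≥0 × Weights × Weights) : node p [] = p.1 := rfl

@[simp] theorem child_false_node (p : ℝ≥0 × Weights × Weights) : child false (node p) = p.2.1 := rfl

@[simp] theorem child_true_node (p : ℝ≥0 × Weights × Weights) : child true (node p) = p.2.2 := rfl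

/-- The product of the weights over the proper prefixes of a word. -/
def pathProd : Weights → List Bool → ℝ≥0
  | _, [] => 1
  | v, b :: x => v [] * pathProd (child b v) x

/-- The total mass of the `n`-th approximation. -/
def total : ℕ → Weights → ℝ≥0
  | 0, _ => 1
  | n + 1, v => 2⁻¹ * v [] * (total n (child false v) + total n (child true v))

/-- The lower limit of the total masses. -/
def limTotal (v : Weights) : ℝ≥0∞ := liminf (fun n => (total n v : ℝ≥0∞)) atTop

/-- The mass of the node `x`. -/
def mass : Weights → List Bool → ℝ≥0∞
  | v, [] => limTotal v
  | v, b :: x => (2⁻¹ * v [] : ℝ≥0) * mass (child b v) x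

@[fun_prop]
theorem measurable_child (b : Bool) : Measurable (child b) :=
  measurable_pi_lambda _ fun _ => measurable_pi_apply _

theorem measurable_node : Measurable node := by
  refine measurable_pi_lambda _ fun x => ?_
  rcases x with - | ⟨_ | _, x⟩ <;> simp only [node] <;> fun_prop

@[fun_prop]
theorem measurable_pathProd (x : List Bool) : Measurable fun v => pathProd v x := by
  induction x with
  | nil => exact measurable_const
  | cons b x ih => exact (measurable_pi_apply _).mul (ih.comp (measurable_child b))

@[fun_prop]
theorem measurable_total (n : ℕ) : Measurable (total n) := by
  induction n with
  | zero => exact measurable_const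
  | succ n ih =>
    have h0 : Measurable fun v : Weights => 2⁻¹ * v [] := by fun_prop
    exact h0.mul ((ih.comp (measurable_child _)).add (ih.comp (measurable_child _)))

@[fun_prop]
theorem measurable_limTotal : Measurable limTotal :=
  Measurable.liminf fun n => (measurable_total n).coe_nnreal_ennreal

@[fun_prop]
theorem measurable_mass (x : List Bool) : Measurable fun v => mass v x := by
  induction x with
  | nil => exact measurable_limTotal
  | cons b x ih =>
    have h0 : Measurable fun v : Weights => 2⁻¹ * v [] := by fun_prop
    exact h0.coe_nnreal_ennreal.mul (ih.comp (measurable_child b))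

/-! ### The law of the weights -/

variable (lam : Measure ℝ≥0) [IsProbabilityMeasure lam]

/-- The law of independent weights with common law `lam`. -/
def law : Measure Weights := Measure.infinitePi fun _ => lam

instance : IsProbabilityMeasure (law lam) := by unfold law; infer_instance

/-- The root weight and the two subtrees are independent. -/
theorem measurePreserving_node :
    MeasurePreserving node (lam.prod ((law lam).prod (law lam))) (law lam) := by
  refine ⟨measurable_node, ?_⟩
  unfold law
  classical
  refine Measure.eq_infinitePi _ fun s t ht => ?_
  have hinj (b : Bool) : Function.Injective (List.cons b) := List.cons_injective
  have hpre : node ⁻¹' Set.pi s t = {a : ℝ≥0 | [] ∈ s → a ∈ t []} ×ˢ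
      (Set.pi (s.preimage (List.cons false) (hinj _).injOn) (fun x => t (false :: x)) ×ˢ
        Set.pi (s.preimage (List.cons true) (hinj _).injOn) (fun x => t (true :: x))) := by
    ext p
    simp only [Set.mem_preimage, Set.mem_pi, Finset.mem_coe, Set.mem_prod, Set.mem_ofPred_eq,
      Finset.mem_preimage]
    refine ⟨fun h => ⟨h [], fun x => h (false :: x), fun x => h (true :: x)⟩, fun h x => ?_⟩
    rcases x with - | ⟨_ | _, x⟩
    exacts [h.1, h.2.1 x, h.2.2 x]
  rw [Measure.map_apply measurable_node (.pi (Finset.countable_toSet s) fun i _ => ht i), hpre,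
    Measure.prod_prod, Measure.prod_prod, Measure.infinitePi_pi _ fun _ _ => ht _,
    Measure.infinitePi_pi _ fun _ _ => ht _,
    Finset.prod_preimage' (List.cons false) s (hinj _).injOn fun x => lam (t x),
    Finset.prod_preimage' (List.cons true) s (hinj _).injOn fun x => lam (t x)]
  have h0 : lam {a : ℝ≥0 | [] ∈ s → a ∈ t []} = ∏ x ∈ s with x = [], lam (t x) := by
    by_cases h : [] ∈ s <;> simp [h, Finset.prod_filter]
  rw [h0, ← Finset.prod_union, ← Finset.prod_union]
  · refine Finset.prod_congr ?_ fun _ _ => rfl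
    ext x
    rcases x with - | ⟨_ | _, x⟩ <;> simp
  · rw [Finset.disjoint_left]
    rintro (- | ⟨_ | _, x⟩) <;> simp
  · rw [Finset.disjoint_left]
    rintro (- | ⟨_ | _, x⟩) <;> simp

variable {lam}

theorem lintegral_law {F : Weights → ℝ≥0∞} (hF : Measurable F) :
    ∫⁻ v, F v ∂law lam =
      ∫⁻ a, ∫⁻ u, ∫⁻ w, F (node (a, u, w)) ∂law lam ∂law lam ∂lam := by
  have hG : Measurable fun p => F (node p) := hF.comp measurable_node
  rw [← (measurePreserving_node lam).lintegral_comp hF, lintegral_prod _ hG.aemeasurable]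
  refine lintegral_congr fun a => ?_
  exact lintegral_prod _ (hG.comp measurable_prodMk_left).aemeasurable

variable (lam)

theorem measurePreserving_child (b : Bool) :
    MeasurePreserving (child b) (law lam) (law lam) := by
  refine ⟨measurable_child b, ?_⟩
  unfold law
  exact Measure.map_infinitePi_infinitePi_of_inj (P := fun _ : List Bool => lam)
    (List.cons_injective (a := b))

theorem measurePreserving_subtree (x : List Bool) :
    MeasurePreserving (subtree x) (law lam) (law lam) := by
  induction x with
  | nil => exact .id _
  | cons b x ih => exact ih.comp (measurePreserving_child lam b)

theorem ae_apply {p : ℝ≥0 → Prop} (hp : ∀ᵐ a ∂lam, p a) : ∀ᵐ v ∂law lam, ∀ x, p (v x) :=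
  ae_all_iff.2 fun x =>
    (measurePreserving_eval_infinitePi (fun _ : List Bool => lam) x).quasiMeasurePreserving.ae hp

theorem ae_subtree {p : Weights → Prop} (hp : ∀ᵐ v ∂law lam, p v) :
    ∀ᵐ v ∂law lam, ∀ x, p (subtree x v) :=
  ae_all_iff.2 fun x => (measurePreserving_subtree lam x).quasiMeasurePreserving.ae hp

/-! ### Elementary inequalities -/

theorem _root_.ENNReal.liminf_add_liminf_le (f g : ℕ → ℝ≥0∞) :
    liminf f atTop + liminf g atTop ≤ liminf (fun n => f n + g n) atTop := by
  simp only [liminf_eq_iSup_iInf_of_nat]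
  rw [ENNReal.iSup_add_iSup_of_monotone]
  · exact iSup_mono fun n => le_iInf₂ fun i hi => add_le_add (iInf₂_le i hi) (iInf₂_le i hi)
  all_goals exact fun m n h => le_iInf₂ fun i hi => iInf₂_le i (h.trans hi)

/-- Lower limits are superadditive. Defining `limTotal` as a lower limit makes this direction valid
for every family of weights, convergent or not, and it is the direction needed for positivity, for
negative moments and for comparing nodes with the root. -/
theorem mul_limTotal_child_le (v : Weights) :
    ((2⁻¹ * v [] : ℝ≥0) : ℝ≥0∞) * (limTotal (child false v) + limTotal (child true v))
      ≤ limTotal v := by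
  calc _ ≤ ((2⁻¹ * v [] : ℝ≥0) : ℝ≥0∞) * liminf (fun n => (total n (child false v) : ℝ≥0∞) +
          total n (child true v)) atTop := by
        gcongr
        exact ENNReal.liminf_add_liminf_le _ _
    _ ≤ liminf (fun n => (total (n + 1) v : ℝ≥0∞)) atTop := by
        simp only [total, ENNReal.coe_mul, ENNReal.coe_add]
        refine le_trans ?_ ENNReal.le_liminf_mul
        rw [liminf_const]
    _ = limTotal v := liminf_nat_add (fun n => (total n v : ℝ≥0∞)) 1

theorem mass_le_limTotal (v : Weights) (x : List Bool) : mass v x ≤ limTotal v := by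
  induction x generalizing v with
  | nil => exact le_rfl
  | cons b x ih =>
    refine le_trans ?_ (mul_limTotal_child_le v)
    rw [mass]
    gcongr
    refine (ih _).trans ?_
    cases b
    exacts [le_self_add, le_add_self]

end Weights

end Cascade

namespace Cascade

namespace Weights

/-! ### Almost sure convergence of the total masses -/

/-- Keep the weights at the levels below `n` and replace the others by `1`. -/
def trunc (n : ℕ) (v : Weights) : Weights := fun x => if x.length < n then v x else 1

theorem measurable_trunc (n : ℕ) : Measurable (trunc n) :=
  measurable_pi_lambda _ fun x => by unfold trunc; split_ifs <;> fun_prop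

theorem trunc_trunc_of_le {m n : ℕ} (h : m ≤ n) (v : Weights) : trunc m (trunc n v) = trunc m v := by
  ext x
  simp only [trunc]
  split_ifs <;> first | rfl | omega

theorem child_trunc (n : ℕ) (b : Bool) (v : Weights) :
    child b (trunc (n + 1) v) = trunc n (child b v) := by
  ext x
  simp [child, trunc]

theorem total_trunc (n : ℕ) (v : Weights) : total n (trunc n v) = total n v := by
  induction n generalizing v with
  | zero => rfl
  | succ n ih => simp only [total, child_trunc, ih]; simp [trunc]

theorem trunc_node (n : ℕ) (a : ℝ≥0) (u w : Weights) :
    trunc (n + 1) (node (a, u, w)) = node (a, trunc n u, trunc n w) := by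
  ext x
  rcases x with - | ⟨_ | _, x⟩ <;> simp [trunc, node]

variable (lam : Measure ℝ≥0) [IsProbabilityMeasure lam]

/-- This is the martingale property tested against functions `g` of the levels below `n`. In the
induction the root weight and one subtree are frozen, which turns `g` into a test function of one
level less on the other subtree. -/
theorem lintegral_total_succ_mul (hmean : ∫⁻ a, (a : ℝ≥0∞) ∂lam = 1) (n : ℕ)
    {g : Weights → ℝ≥0∞} (hg : Measurable g) (hgn : ∀ v, g (trunc n v) = g v) :
    ∫⁻ v, g v * total (n + 1) v ∂law lam = ∫⁻ v, g v * total n v ∂law lam := by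
  induction n generalizing g with
  | zero =>
    have hconst (v : Weights) : g v = g (fun _ => 1) := by
      rw [← hgn v]; rfl
    have h1 (a : ℝ≥0) : ((2⁻¹ * a * (1 + 1) : ℝ≥0) : ℝ≥0∞) = a := by
      congr 1
      rw [one_add_one_eq_two, mul_comm, ← mul_assoc, mul_inv_cancel₀ two_ne_zero, one_mul]
    simp only [hconst]
    rw [lintegral_const_mul _ (by fun_prop), lintegral_const_mul _ (by fun_prop),
      lintegral_law (by fun_prop)]
    simp [total, node_nil, h1, hmean]
  | succ n ih =>
    have key (a : ℝ≥0) (u w : Weights) (k : ℕ) :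
        g (node (a, u, w)) * (total (k + 1) (node (a, u, w)) : ℝ≥0∞) =
          (2⁻¹ * a : ℝ≥0) * (g (node (a, u, w)) * total k u) +
          (2⁻¹ * a : ℝ≥0) * (g (node (a, u, w)) * total k w) := by
      simp only [total, node_nil, child_false_node, child_true_node, ENNReal.coe_mul,
        ENNReal.coe_add]
      ring
    have hgm : Measurable fun p => g (node p) := hg.comp measurable_node
    have hm1 (a : ℝ≥0) (k : ℕ) : Measurable fun p : Weights × Weights =>
        g (node (a, p.1, p.2)) * (total k p.1 : ℝ≥0∞) :=
      (hgm.comp measurable_prodMk_left).mul (by fun_prop)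
    have hm2 (a : ℝ≥0) (k : ℕ) : Measurable fun p : Weights × Weights =>
        g (node (a, p.1, p.2)) * (total k p.2 : ℝ≥0∞) :=
      (hgm.comp measurable_prodMk_left).mul (by fun_prop)
    -- The two terms are integrated in opposite orders, so that the subtree whose total mass appears
    -- is always innermost, ready for the induction hypothesis.
    have hexp (k : ℕ) : ∫⁻ v, g v * total (k + 1) v ∂law lam = ∫⁻ a,
        ((2⁻¹ * a : ℝ≥0) * ∫⁻ w, ∫⁻ u, g (node (a, u, w)) * total k u ∂law lam ∂law lam +
         (2⁻¹ * a : ℝ≥0) * ∫⁻ u, ∫⁻ w, g (node (a, u, w)) * total k w ∂law lam ∂law lam) ∂lam := by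
      rw [lintegral_law (by fun_prop)]
      refine lintegral_congr fun a => ?_
      simp only [key]
      have e1 := lintegral_prod (μ := law lam) (ν := law lam) _ (hm1 a k).aemeasurable
      have e2 := lintegral_prod (μ := law lam) (ν := law lam) _ (hm2 a k).aemeasurable
      have e1' := lintegral_prod_symm (μ := law lam) (ν := law lam) _ (hm1 a k).aemeasurable
      rw [← e1', ← e2, ← lintegral_const_mul _ (hm1 a k), ← lintegral_const_mul _ (hm2 a k),
        ← lintegral_add_left ((hm1 a k).const_mul _)]
      exact (lintegral_prod _
        (((hm1 a k).const_mul _).add ((hm2 a k).const_mul _)).aemeasurable).symm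
    rw [hexp (n + 1), hexp n]
    refine lintegral_congr fun a => ?_
    congr 2
    · refine lintegral_congr fun w => ih (g := fun u => g (node (a, u, w))) ?_ fun u => ?_
      · exact hgm.comp (by fun_prop)
      · rw [← hgn, ← hgn (node (a, u, w)), trunc_node, trunc_node, trunc_trunc_of_le le_rfl]
    · refine lintegral_congr fun u => ih (g := fun w => g (node (a, u, w))) ?_ fun w => ?_
      · exact hgm.comp (by fun_prop)
      · rw [← hgn, ← hgn (node (a, u, w)), trunc_node, trunc_node, trunc_trunc_of_le le_rfl]

theorem lintegral_total (hmean : ∫⁻ a, (a : ℝ≥0∞) ∂lam = 1) (n : ℕ) :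
    ∫⁻ v, total n v ∂law lam = 1 := by
  induction n with
  | zero => simp [total]
  | succ n ih =>
    have := lintegral_total_succ_mul lam hmean n (g := fun _ => 1) measurable_const fun _ => rfl
    simpa [ih] using this

theorem lintegral_limTotal_le (hmean : ∫⁻ a, (a : ℝ≥0∞) ∂lam = 1) :
    ∫⁻ v, limTotal v ∂law lam ≤ 1 := by
  refine (lintegral_liminf_le fun n => (measurable_total n).coe_nnreal_ennreal).trans ?_
  simp [lintegral_total lam hmean]

/-- The filtration of the levels of the tree. -/
def levelFiltration : Filtration ℕ (MeasurableSpace.pi : MeasurableSpace Weights) where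
  seq n := MeasurableSpace.comap (trunc n) inferInstance
  mono' m n h := by
    rintro s ⟨t, ht, rfl⟩
    refine ⟨trunc m ⁻¹' t, measurable_trunc m ht, ?_⟩
    ext v
    simp [trunc_trunc_of_le h]
  le' n := (measurable_trunc n).comap_le

theorem integrable_total (hmean : ∫⁻ a, (a : ℝ≥0∞) ∂lam = 1) (n : ℕ) :
    Integrable (fun v => (total n v : ℝ)) (law lam) := by
  refine ⟨by fun_prop, ?_⟩
  simp [HasFiniteIntegral, lintegral_total lam hmean]

theorem martingale_total (hmean : ∫⁻ a, (a : ℝ≥0∞) ∂lam = 1) :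
    Martingale (fun n v => (total n v : ℝ)) levelFiltration (law lam) := by
  refine martingale_of_setIntegral_eq_succ (fun n => ?_) (integrable_total lam hmean) fun n s hs => ?_
  · have h : (fun v => (total n v : ℝ)) = (fun v => (total n v : ℝ)) ∘ trunc n := by
      ext v; simp [total_trunc]
    rw [h]
    refine (Measurable.comp ?_ (comap_measurable (trunc n))).stronglyMeasurable
    fun_prop
  · have hs' : MeasurableSet s := levelFiltration.le n s hs
    obtain ⟨t, ht, rfl⟩ := hs
    have hconv (k : ℕ) : ∫ v in trunc n ⁻¹' t, (total k v : ℝ) ∂law lam =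
        (∫⁻ v, (trunc n ⁻¹' t).indicator 1 v * total k v ∂law lam).toReal := by
      rw [integral_eq_lintegral_of_nonneg_ae (ae_of_all _ fun _ => NNReal.coe_nonneg _)
        (by fun_prop), ← lintegral_indicator hs']
      congr 1
      refine lintegral_congr fun v => ?_
      by_cases hv : v ∈ trunc n ⁻¹' t <;> simp [hv]
    rw [hconv, hconv, lintegral_total_succ_mul lam hmean n (measurable_one.indicator hs')]
    intro v
    have h : trunc n v ∈ trunc n ⁻¹' t ↔ v ∈ trunc n ⁻¹' t := by simp [trunc_trunc_of_le le_rfl]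
    by_cases hv : v ∈ trunc n ⁻¹' t
    · rw [Set.indicator_of_mem hv, Set.indicator_of_mem (h.2 hv)]; rfl
    · rw [Set.indicator_of_notMem hv, Set.indicator_of_notMem (h.not.2 hv)]

theorem ae_tendsto_total (hmean : ∫⁻ a, (a : ℝ≥0∞) ∂lam = 1) :
    ∀ᵐ v ∂law lam, ∃ c : ℝ≥0, Tendsto (fun n => total n v) atTop (𝓝 c) := by
  have h := (martingale_total lam hmean).submartingale.exists_ae_tendsto_of_bdd (R := 1)
    fun n => by simp [eLpNorm_one_eq_lintegral_enorm, lintegral_total lam hmean]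
  filter_upwards [h] with v ⟨c, hc⟩
  have hc0 : 0 ≤ c := ge_of_tendsto' hc fun n => NNReal.coe_nonneg _
  lift c to ℝ≥0 using hc0
  exact ⟨c, NNReal.tendsto_coe.1 hc⟩

theorem limTotal_eq_of_tendsto {v : Weights} {c : ℝ≥0}
    (h : Tendsto (fun n => total n v) atTop (𝓝 c)) : limTotal v = c :=
  (ENNReal.tendsto_coe.2 h).liminf_eq

end Weights

end Cascade

namespace Cascade

/-! ### The limit of the total masses does not vanish -/

theorem mul_log_mul (c x : ℝ) :
    (c * x) * Real.log (c * x) = c * (x * Real.log x) + x * (c * Real.log c) := by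
  rcases eq_or_ne c 0 with rfl | hc
  · simp
  rcases eq_or_ne x 0 with rfl | hx
  · simp
  rw [Real.log_mul hc hx]
  ring

/-- From y + z ≤ (√y + √z)² and log(1 + u) ≤ u one gets y log(y + z) ≤ y log y + 2√(yz); then
symmetrise. The error is a product of square roots so that for two independent subtrees its mean
factors into (E√Y)². -/
theorem mul_log_add_le {y z : ℝ} (hy : 0 ≤ y) (hz : 0 ≤ z) :
    (y + z) * Real.log (y + z) ≤
      y * Real.log y + z * Real.log z + 4 * (Real.sqrt y * Real.sqrt z) := by
  have key {y z : ℝ} (hy : 0 < y) (hz : 0 ≤ z) :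
      y * Real.log (y + z) ≤ y * Real.log y + 2 * (Real.sqrt y * Real.sqrt z) := by
    have h1 : y + z ≤ (Real.sqrt y + Real.sqrt z) ^ 2 := by
      nlinarith [Real.sq_sqrt hy.le, Real.sq_sqrt hz, Real.sqrt_nonneg y, Real.sqrt_nonneg z,
        mul_nonneg (Real.sqrt_nonneg y) (Real.sqrt_nonneg z)]
    have hsy : 0 < Real.sqrt y := Real.sqrt_pos.2 hy
    have h2 : Real.log (y + z) ≤ Real.log y + 2 * (Real.sqrt z / Real.sqrt y) := by
      calc Real.log (y + z) ≤ Real.log ((Real.sqrt y + Real.sqrt z) ^ 2) :=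
            Real.log_le_log (by positivity) h1
        _ = 2 * Real.log (Real.sqrt y * (Real.sqrt z / Real.sqrt y + 1)) := by
            rw [Real.log_pow]; congr 2; field_simp; ring
        _ = Real.log y + 2 * Real.log (Real.sqrt z / Real.sqrt y + 1) := by
            rw [Real.log_mul hsy.ne' (by positivity), Real.log_sqrt hy.le]; ring
        _ ≤ _ := by
            have := Real.log_le_sub_one_of_pos (x := Real.sqrt z / Real.sqrt y + 1) (by positivity)
            linarith
    calc y * Real.log (y + z) ≤ y * (Real.log y + 2 * (Real.sqrt z / Real.sqrt y)) := by gcongr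
      _ = y * Real.log y + 2 * (y / Real.sqrt y * Real.sqrt z) := by ring
      _ = _ := by rw [Real.div_sqrt]
  rcases hy.eq_or_lt with rfl | hy
  · simp
  rcases hz.eq_or_lt with rfl | hz
  · simp
  have h1 := key hy hz.le
  have h2 := key hz hy.le
  rw [add_comm z y] at h2
  linarith [mul_comm (Real.sqrt y) (Real.sqrt z), add_mul y z (Real.log (y + z))]

namespace Weights

theorem integral_coe_eq_one {lam : Measure ℝ≥0} (hmean : ∫⁻ a, (a : ℝ≥0∞) ∂lam = 1) :
    ∫ a, (a : ℝ) ∂lam = 1 := by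
  rw [integral_eq_lintegral_of_nonneg_ae (ae_of_all _ fun _ => NNReal.coe_nonneg _) (by fun_prop)]
  simp [hmean]

variable (lam : Measure ℝ≥0) [IsProbabilityMeasure lam]

/-- The entropy of the total mass. -/
def entropy (n : ℕ) : ℝ := ∫ v, (total n v : ℝ) * Real.log (total n v) ∂law lam

/-- The mean of the square root of the total mass. -/
def meanSqrt (n : ℕ) : ℝ := ∫ v, Real.sqrt (total n v) ∂law lam

variable {lam}

theorem integral_total (hmean : ∫⁻ a, (a : ℝ≥0∞) ∂lam = 1) (n : ℕ) :
    ∫ v, (total n v : ℝ) ∂law lam = 1 := by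
  rw [integral_eq_lintegral_of_nonneg_ae (ae_of_all _ fun _ => NNReal.coe_nonneg _) (by fun_prop)]
  simp [lintegral_total lam hmean]

theorem integrable_sqrt_total (hmean : ∫⁻ a, (a : ℝ≥0∞) ∂lam = 1) (n : ℕ) :
    Integrable (fun v => Real.sqrt (total n v)) (law lam) := by
  refine Integrable.mono' ((integrable_total lam hmean n).add (integrable_const 1)) (by fun_prop)
    (ae_of_all _ fun v => ?_)
  rw [Real.norm_of_nonneg (Real.sqrt_nonneg _), Pi.add_apply]
  nlinarith [Real.sq_sqrt (NNReal.coe_nonneg (total n v)), sq_nonneg (Real.sqrt (total n v) - 1)]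

theorem entropy_nonneg (hmean : ∫⁻ a, (a : ℝ≥0∞) ∂lam = 1) {n : ℕ}
    (hint : Integrable (fun v => (total n v : ℝ) * Real.log (total n v)) (law lam)) :
    0 ≤ entropy lam n := by
  have hi : Integrable (fun v => (total n v : ℝ) - 1) (law lam) :=
    (integrable_total lam hmean n).sub (integrable_const 1)
  have h := integral_mono hi hint
    fun v => Real.self_sub_one_le_mul_log (NNReal.coe_nonneg (total n v))
  rw [integral_sub (integrable_total lam hmean n) (integrable_const 1), integral_total hmean] at h
  simpa [entropy] using h

/-- Write the next total mass as (a/2)(Y' + Y'') and expand x log x by `mul_log_mul` and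
`mul_log_add_le`. The factor E[a/2] = 1/2 halves the two entropies and the square root error, while
the mean of (a/2) log(a/2) times E[Y' + Y''] = 2 gives the drift E[a log a] - log 2. -/
theorem entropy_succ_le (hmean : ∫⁻ a, (a : ℝ≥0∞) ∂lam = 1)
    (hent : Integrable (fun a : ℝ≥0 => (a : ℝ) * Real.log a) lam) {n : ℕ}
    (hint : Integrable (fun v => (total n v : ℝ) * Real.log (total n v)) (law lam)) :
    Integrable (fun v => (total (n + 1) v : ℝ) * Real.log (total (n + 1) v)) (law lam) ∧
    entropy lam (n + 1) ≤ entropy lam n + 2 * meanSqrt lam n ^ 2 -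
      (Real.log 2 - ∫ a : ℝ≥0, (a : ℝ) * Real.log a ∂lam) := by
  set f : Weights → ℝ := fun v => (total n v : ℝ) * Real.log (total n v) with hf
  set g : Weights → ℝ := fun v => Real.sqrt (total n v) with hg
  set ψ : ℝ≥0 → ℝ := fun a => (2⁻¹ * a : ℝ) * Real.log (2⁻¹ * a) with hψ
  have hcoe : Integrable (fun a : ℝ≥0 => (a : ℝ)) lam := by
    refine ⟨by fun_prop, ?_⟩
    simp [HasFiniteIntegral, hmean]
  have hψe : ψ = fun a : ℝ≥0 => 2⁻¹ * ((a : ℝ) * Real.log a) + a * (2⁻¹ * Real.log 2⁻¹) := by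
    ext a; exact mul_log_mul _ _
  have hψi : Integrable ψ lam := by
    rw [hψe]; exact (hent.const_mul _).add (hcoe.mul_const _)
  have hψint : ∫ a, ψ a ∂lam =
      -(2⁻¹ * (Real.log 2 - ∫ a : ℝ≥0, (a : ℝ) * Real.log a ∂lam)) := by
    rw [hψe, integral_add (hent.const_mul _) (hcoe.mul_const _), integral_const_mul,
      integral_mul_const, integral_coe_eq_one hmean, Real.log_inv]
    ring
  have ht := integrable_total lam hmean n
  have hgi : Integrable g (law lam) := integrable_sqrt_total hmean n
  have hA' : Integrable (fun q : Weights × Weights => f q.1 + f q.2)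
      ((law lam).prod (law lam)) := (hint.comp_fst _).add (hint.comp_snd _)
  have hA : Integrable (fun q : Weights × Weights => f q.1 + f q.2 + 4 * (g q.1 * g q.2))
      ((law lam).prod (law lam)) :=
    hA'.add ((hgi.mul_prod hgi).const_mul 4)
  have hB : Integrable (fun q : Weights × Weights => (total n q.1 + total n q.2 : ℝ))
      ((law lam).prod (law lam)) := (ht.comp_fst _).add (ht.comp_snd _)
  have hAint : ∫ q, f q.1 + f q.2 + 4 * (g q.1 * g q.2) ∂(law lam).prod (law lam) =
      2 * entropy lam n + 4 * meanSqrt lam n ^ 2 := by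
    rw [integral_add hA' ((hgi.mul_prod hgi).const_mul 4),
      integral_add (hint.comp_fst _) (hint.comp_snd _), integral_fun_fst, integral_fun_snd,
      integral_const_mul, integral_prod_mul]
    simp only [probReal_univ, one_smul, entropy, meanSqrt, f, g]
    ring
  have hBint : ∫ q : Weights × Weights, (total n q.1 + total n q.2 : ℝ)
      ∂(law lam).prod (law lam) = 2 := by
    rw [integral_add (ht.comp_fst _) (ht.comp_snd _),
      integral_fun_fst (fun v : Weights => (total n v : ℝ)),
      integral_fun_snd (fun v : Weights => (total n v : ℝ)), integral_total hmean]
    simp only [probReal_univ, one_smul]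
    norm_num
  set R : ℝ≥0 × Weights × Weights → ℝ := fun p =>
    (2⁻¹ * p.1 : ℝ) * (f p.2.1 + f p.2.2 + 4 * (g p.2.1 * g p.2.2)) +
      ψ p.1 * (total n p.2.1 + total n p.2.2 : ℝ) with hR
  have hRi : Integrable R (lam.prod ((law lam).prod (law lam))) :=
    ((hcoe.const_mul _).mul_prod hA).add (hψi.mul_prod hB)
  have hRint : ∫ p, R p ∂(lam.prod ((law lam).prod (law lam))) =
      entropy lam n + 2 * meanSqrt lam n ^ 2 -
        (Real.log 2 - ∫ a : ℝ≥0, (a : ℝ) * Real.log a ∂lam) := by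
    rw [hR, integral_add ((hcoe.const_mul _).mul_prod hA) (hψi.mul_prod hB),
      integral_prod_mul (fun a : ℝ≥0 => (2⁻¹ * a : ℝ))
        (fun q : Weights × Weights => f q.1 + f q.2 + 4 * (g q.1 * g q.2)),
      integral_prod_mul ψ (fun q : Weights × Weights => (total n q.1 + total n q.2 : ℝ)),
      hAint, hBint, hψint, integral_const_mul, integral_coe_eq_one hmean]
    ring
  have hle (p : ℝ≥0 × Weights × Weights) :
      (total (n + 1) (node p) : ℝ) * Real.log (total (n + 1) (node p)) ≤ R p := by
    have h1 : (total (n + 1) (node p) : ℝ) = (2⁻¹ * p.1) * (total n p.2.1 + total n p.2.2) := by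
      simp [total]
    rw [h1, mul_log_mul, hR]
    have h2 := mul_log_add_le (NNReal.coe_nonneg (total n p.2.1)) (NNReal.coe_nonneg (total n p.2.2))
    have h3 : (0 : ℝ) ≤ 2⁻¹ * p.1 := by positivity
    have h4 := mul_le_mul_of_nonneg_left h2 h3
    simp only [hf, hg, hψ]
    linarith [mul_comm ((2⁻¹ * p.1 : ℝ) * Real.log (2⁻¹ * p.1))
      (total n p.2.1 + total n p.2.2 : ℝ)]
  have hmp := measurePreserving_node lam
  have hFm : Measurable fun v : Weights =>
      (total (n + 1) v : ℝ) * Real.log (total (n + 1) v) := by fun_prop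
  -- Bounded above by the integrable `R` and below by x log x ≥ x - 1 ≥ -1.
  have hFi : Integrable (fun p => (total (n + 1) (node p) : ℝ) * Real.log (total (n + 1) (node p)))
      (lam.prod ((law lam).prod (law lam))) := by
    refine Integrable.mono' (hRi.abs.add (integrable_const 1))
      (hFm.comp measurable_node).aestronglyMeasurable (ae_of_all _ fun p => ?_)
    rw [Real.norm_eq_abs, Pi.add_apply, abs_le]
    have h1 := Real.self_sub_one_le_mul_log (NNReal.coe_nonneg (total (n + 1) (node p)))
    have h2 := NNReal.coe_nonneg (total (n + 1) (node p))
    constructor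
    · linarith [abs_nonneg (R p)]
    · linarith [hle p, le_abs_self (R p)]
  refine ⟨(hmp.integrable_comp hFm.aestronglyMeasurable).1 hFi, ?_⟩
  have hFint : entropy lam (n + 1) = ∫ p, (total (n + 1) (node p) : ℝ) *
      Real.log (total (n + 1) (node p)) ∂(lam.prod ((law lam).prod (law lam))) := by
    rw [← integral_map hmp.aemeasurable hFm.aestronglyMeasurable, hmp.map_eq, entropy]
  rw [← hRint, hFint]
  exact integral_mono hFi hRi hle

theorem integrable_total_mul_log (hmean : ∫⁻ a, (a : ℝ≥0∞) ∂lam = 1)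
    (hent : Integrable (fun a : ℝ≥0 => (a : ℝ) * Real.log a) lam) (n : ℕ) :
    Integrable (fun v => (total n v : ℝ) * Real.log (total n v)) (law lam) := by
  induction n with
  | zero => simp [total]
  | succ n ih => exact (entropy_succ_le hmean hent ih).1

/-- Use √y ≤ εy + min(√y, 1/ε): the first part has mean ε because the total mass has mean one, and
the second tends to 0 by dominated convergence. -/
theorem tendsto_meanSqrt_zero (hmean : ∫⁻ a, (a : ℝ≥0∞) ∂lam = 1)
    (h0 : ∀ᵐ v ∂law lam, Tendsto (fun n => total n v) atTop (𝓝 0)) :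
    Tendsto (meanSqrt lam) atTop (𝓝 0) := by
  have hnn (n : ℕ) : 0 ≤ meanSqrt lam n := integral_nonneg fun _ => Real.sqrt_nonneg _
  refine tendsto_order.2 ⟨fun c hc => .of_forall fun n => hc.trans_le (hnn n), fun c hc => ?_⟩
  set ε := c / 2 with hε
  have hεp : 0 < ε := by positivity
  have hlim : Tendsto (fun n => ∫ v, min (Real.sqrt (total n v)) ε⁻¹ ∂law lam) atTop (𝓝 0) := by
    have := tendsto_integral_of_dominated_convergence (μ := law lam)
      (F := fun n v => min (Real.sqrt (total n v)) ε⁻¹) (f := fun _ => 0) (fun _ => ε⁻¹)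
      (fun n => by fun_prop) (integrable_const _)
      (fun n => ae_of_all _ fun v => by
        rw [Real.norm_of_nonneg (by positivity)]; exact min_le_right _ _) ?_
    · simpa using this
    · filter_upwards [h0] with v hv
      have h1 : Tendsto (fun n => Real.sqrt (total n v)) atTop (𝓝 0) := by
        have := (Real.continuous_sqrt.tendsto _).comp (NNReal.tendsto_coe.2 hv)
        simpa [Function.comp_def] using this
      have h2 := h1.min (tendsto_const_nhds (x := ε⁻¹))
      rwa [min_eq_left (by positivity)] at h2
  filter_upwards [(tendsto_order.1 hlim).2 ε hεp] with n hn
  have hmin : Integrable (fun v => min (Real.sqrt (total n v)) ε⁻¹) (law lam) :=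
    (integrable_sqrt_total hmean n).inf (integrable_const _)
  have hle : meanSqrt lam n ≤ ∫ v, (ε * total n v + min (Real.sqrt (total n v)) ε⁻¹) ∂law lam := by
    refine integral_mono (integrable_sqrt_total hmean n)
      (((integrable_total lam hmean n).const_mul ε).add hmin) fun v => ?_
    have ht : (0 : ℝ) ≤ total n v := NNReal.coe_nonneg _
    dsimp only
    rcases le_total (Real.sqrt (total n v)) ε⁻¹ with h | h
    · rw [min_eq_left h]
      have : 0 ≤ ε * total n v := by positivity
      linarith
    · rw [min_eq_right h]
      have h1 : 1 ≤ ε * Real.sqrt (total n v) := by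
        rw [← mul_inv_cancel₀ hεp.ne']; gcongr
      have h2 : Real.sqrt (total n v) ≤ ε * total n v := by
        calc Real.sqrt (total n v) = 1 * Real.sqrt (total n v) := (one_mul _).symm
          _ ≤ (ε * Real.sqrt (total n v)) * Real.sqrt (total n v) := by gcongr
          _ = ε * total n v := by rw [mul_assoc, Real.mul_self_sqrt ht]
      have : 0 < ε⁻¹ := by positivity
      linarith
  rw [integral_add ((integrable_total lam hmean n).const_mul ε) hmin, integral_const_mul,
    integral_total hmean] at hle
  linarith

/-- If the total masses died out, the square root error in `entropy_succ_le` would eventually be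
below half of the drift, and the entropy would decrease linearly. But it is nonnegative, as the mean
is one. -/
theorem not_ae_tendsto_total_zero (hmean : ∫⁻ a, (a : ℝ≥0∞) ∂lam = 1)
    (hent : Integrable (fun a : ℝ≥0 => (a : ℝ) * Real.log a) lam)
    (hlt : ∫ a : ℝ≥0, (a : ℝ) * Real.log a ∂lam < Real.log 2) :
    ¬ ∀ᵐ v ∂law lam, Tendsto (fun n => total n v) atTop (𝓝 0) := by
  intro h0
  set δ := Real.log 2 - ∫ a : ℝ≥0, (a : ℝ) * Real.log a ∂lam with hδ
  have hδp : 0 < δ := by linarith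
  have hlim := ((tendsto_meanSqrt_zero hmean h0).pow 2).const_mul 2
  rw [zero_pow two_ne_zero, mul_zero] at hlim
  obtain ⟨N, hN⟩ := eventually_atTop.1 ((tendsto_order.1 hlim).2 (δ / 2) (by positivity))
  have hint := integrable_total_mul_log hmean hent
  have hdec (k : ℕ) : entropy lam (N + k) ≤ entropy lam N - k * (δ / 2) := by
    induction k with
    | zero => simp
    | succ k ih =>
      have h1 := (entropy_succ_le hmean hent (hint (N + k))).2
      have h2 := hN (N + k) (by omega)
      rw [← add_assoc]
      push_cast
      linarith
  obtain ⟨k, hk⟩ := exists_nat_gt (entropy lam N / (δ / 2))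
  rw [div_lt_iff₀ (by positivity)] at hk
  have := hdec k
  have := entropy_nonneg hmean (hint (N + k))
  linarith

/-- The limit of the total masses is almost surely positive. -/
theorem ae_limTotal_pos (hpos : ∀ᵐ a ∂lam, 0 < a) (hmean : ∫⁻ a, (a : ℝ≥0∞) ∂lam = 1)
    (hent : Integrable (fun a : ℝ≥0 => (a : ℝ) * Real.log a) lam)
    (hlt : ∫ a : ℝ≥0, (a : ℝ) * Real.log a ∂lam < Real.log 2) :
    ∀ᵐ v ∂law lam, 0 < limTotal v := by
  set S : Set Weights := {v | limTotal v = 0} with hS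
  have hSm : MeasurableSet S := measurable_limTotal (measurableSet_singleton 0)
  -- A vanishing limit at the root, below a positive root weight, forces both independent subtrees
  -- to vanish. So q ≤ q² for the extinction probability q, which leaves only 0 and 1.
  have hsq : law lam S ≤ law lam S * law lam S := by
    have hmp := measurePreserving_node lam
    calc law lam S = (lam.prod ((law lam).prod (law lam))) (node ⁻¹' S) :=
          (hmp.measure_preimage hSm.nullMeasurableSet).symm
      _ ≤ (lam.prod ((law lam).prod (law lam))) (Set.univ ×ˢ (S ×ˢ S)) := by
          refine measure_mono_ae ?_
          have hfst : ∀ᵐ p ∂lam.prod ((law lam).prod (law lam)), 0 < p.1 :=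
            Measure.quasiMeasurePreserving_fst.ae hpos
          filter_upwards [hfst] with p hp hpS
          have h1 : limTotal (node p) = 0 := hpS
          have h2 := mul_limTotal_child_le (node p)
          rw [h1, nonpos_iff_eq_zero, mul_eq_zero, add_eq_zero, node_nil] at h2
          rcases h2 with h2 | h2
          · rw [ENNReal.coe_eq_zero] at h2
            exact absurd h2 (by positivity)
          · exact ⟨trivial, h2.1, h2.2⟩
      _ = _ := by simp [Measure.prod_prod]
  have hne : law lam S ≠ 1 := by
    intro h1
    refine not_ae_tendsto_total_zero hmean hent hlt ?_
    have hae : ∀ᵐ v ∂law lam, v ∈ S := (prob_compl_eq_zero_iff hSm).2 h1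
    filter_upwards [hae, ae_tendsto_total lam hmean] with v hv ⟨c, hc⟩
    have : (c : ℝ≥0∞) = 0 := (limTotal_eq_of_tendsto hc).symm.trans hv
    rw [ENNReal.coe_eq_zero] at this
    exact this ▸ hc
  have h0 : law lam S = 0 := by
    by_contra h0
    refine hne (le_antisymm prob_le_one ?_)
    calc (1 : ℝ≥0∞) = law lam S * (law lam S)⁻¹ :=
          (ENNReal.mul_inv_cancel h0 (measure_ne_top _ _)).symm
      _ ≤ law lam S * law lam S * (law lam S)⁻¹ := by gcongr
      _ = law lam S := by
          rw [mul_assoc, ENNReal.mul_inv_cancel h0 (measure_ne_top _ _), mul_one]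
  have : ∀ᵐ v ∂law lam, ¬ limTotal v = 0 := by rwa [ae_iff, show {v | ¬¬ limTotal v = 0} = S by simp [hS]]
  filter_upwards [this] with v hv using pos_iff_ne_zero.2 hv

end Weights

end Cascade

theorem ENNReal.mul_rpow_of_ne_zero_of_ne_top {c : ℝ≥0∞} (h0 : c ≠ 0) (ht : c ≠ ∞) (y : ℝ≥0∞)
    (z : ℝ) : (c * y) ^ z = c ^ z * y ^ z := by
  rw [ENNReal.mul_rpow_eq_ite]
  simp [h0, ht]

namespace Cascade

theorem eq_of_eq_mul_of_mul_eq {a b l r : ℝ≥0∞} (c : ℝ≥0∞) (h : l = r) (h1 : a = c * l)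
    (h2 : c * r = b) : a = b := by
  rw [h1, h, h2]

/-! ### Separating nodes -/

/-- For words `x` and `y` below two neighbouring nodes (`x` below the left one, `y` below the right
one), a word below the left node (`Sum.inl`) or below the right node (`Sum.inr`) whose interval
lies between those of `x` and `y`. -/
def adjSep : List Bool → List Bool → List Bool ⊕ List Bool
  | [], _ => .inl []
  | false :: _, _ => .inl [true]
  | true :: _, [] => .inl []
  | true :: _, true :: _ => .inr [false]
  | true :: x, false :: y => (adjSep x y).map (true :: ·) (false :: ·)

/-- A node whose interval lies in the convex hull of the intervals of `x` and `y`. -/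
def sep : List Bool → List Bool → List Bool
  | [], _ => []
  | _ :: _, [] => []
  | false :: x, false :: y => false :: sep x y
  | true :: x, true :: y => true :: sep x y
  | false :: x, true :: y => (adjSep x y).elim (false :: ·) (true :: ·)
  | true :: x, false :: y => (adjSep y x).elim (false :: ·) (true :: ·)

/-- The node `J` is equal to `x` or is a sibling of a prefix of `x`. -/
inductive Beside : List Bool → List Bool → Prop
  | refl : Beside [] []
  | side (b : Bool) (x : List Bool) : Beside (b :: x) [!b]
  | cons (b : Bool) {x J : List Bool} : Beside x J → Beside (b :: x) (b :: J)

/-- The recursion descends only while `x` follows the right edge of its node and `y` the left edge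
of its own. At the first deviation the sibling cell lies between them; without any deviation `x`
itself is taken. -/
theorem beside_adjSep {x y : List Bool} (h : x.length = y.length) :
    (∀ J, adjSep x y = .inl J → Beside x J) ∧ ∀ J, adjSep x y = .inr J → Beside y J := by
  induction x generalizing y with
  | nil =>
    refine ⟨?_, ?_⟩ <;> rintro J hJ <;> simp [adjSep] at hJ
    exact hJ ▸ .refl
  | cons b x ih =>
    rcases y with - | ⟨c, y⟩
    · simp at h
    rcases b with - | -
    · refine ⟨?_, ?_⟩ <;> rintro J hJ <;> simp [adjSep] at hJ
      exact hJ ▸ .side false x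
    rcases c with - | -
    · have ih' := ih (y := y) (by simpa using h)
      refine ⟨?_, ?_⟩ <;> rintro J hJ <;> simp only [adjSep] at hJ <;>
        rcases hxy : adjSep x y with J' | J' <;> simp [hxy] at hJ <;> subst hJ
      exacts [.cons _ (ih'.1 _ hxy), .cons _ (ih'.2 _ hxy)]
    · refine ⟨?_, ?_⟩ <;> rintro J hJ <;> simp [adjSep] at hJ
      exact hJ ▸ .side true y

namespace Weights

variable {lam : Measure ℝ≥0} [IsProbabilityMeasure lam]

/-- Independence of the root weight and the two subtrees. The factorisation is required only for
positive root weights because negative powers do not split at 0. -/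
theorem lintegral_law_eq_mul (hpos : ∀ᵐ a ∂lam, 0 < a) {F : Weights → ℝ≥0∞} (hF : Measurable F)
    {α : ℝ≥0 → ℝ≥0∞} {β γ : Weights → ℝ≥0∞} (hα : Measurable α) (hβ : Measurable β)
    (hγ : Measurable γ)
    (h : ∀ a u w, 0 < a → F (node (a, u, w)) = α a * (β u * γ w)) :
    ∫⁻ v, F v ∂law lam =
      (∫⁻ a, α a ∂lam) * ((∫⁻ v, β v ∂law lam) * ∫⁻ v, γ v ∂law lam) := by
  rw [lintegral_law hF, ← lintegral_mul_const _ hα]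
  refine lintegral_congr_ae ?_
  filter_upwards [hpos] with a ha
  simp only [h a _ _ ha]
  simp_rw [lintegral_const_mul _ (hγ.const_mul _), lintegral_const_mul _ hγ]
  rw [lintegral_const_mul _ (hβ.mul_const _), lintegral_mul_const _ hβ]

/-! ### Negative moments -/

theorem limTotal_node_rpow_neg_le {s : ℝ} (hs : 0 < s) {a : ℝ≥0} (ha : 0 < a) (u w : Weights) :
    limTotal (node (a, u, w)) ^ (-s) ≤
      ((2⁻¹ * a : ℝ≥0) : ℝ≥0∞) ^ (-s) * min (limTotal u ^ (-s)) (limTotal w ^ (-s)) := by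
  have h := mul_limTotal_child_le (node (a, u, w))
  rw [node_nil, child_false_node, child_true_node] at h
  have hc : ((2⁻¹ * a : ℝ≥0) : ℝ≥0∞) ≠ 0 := by
    rw [Ne, ENNReal.coe_eq_zero]; positivity
  have key (y : ℝ≥0∞) (hy : y ≤ limTotal u + limTotal w) : limTotal (node (a, u, w)) ^ (-s) ≤
      ((2⁻¹ * a : ℝ≥0) : ℝ≥0∞) ^ (-s) * y ^ (-s) := by
    rw [← ENNReal.mul_rpow_of_ne_zero_of_ne_top hc ENNReal.coe_ne_top, ENNReal.rpow_neg,
      ENNReal.rpow_neg, ENNReal.inv_le_inv]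
    exact ENNReal.rpow_le_rpow ((mul_le_mul_right hy _).trans h) hs.le
  rcases min_choice (limTotal u ^ (-s)) (limTotal w ^ (-s)) with e | e <;> rw [e]
  exacts [key _ le_self_add, key _ le_add_self]

theorem min_mul_le_max_mul (A x N : ℝ≥0∞) : min (A * x) N ≤ max A 1 * min x N := by
  rcases le_total x N with h | h
  · rw [min_eq_left h]
    exact (min_le_left _ _).trans (mul_le_mul_left (le_max_left _ _) _)
  · rw [min_eq_right h]
    refine (min_le_right _ _).trans ?_
    calc N = 1 * N := (one_mul N).symm
      _ ≤ _ := mul_le_mul_left (le_max_right _ _) _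

/-- For Z = Y^(-s) one has Z ≤ A min(Z', Z'') with A a function of the root weight and Z', Z''
independent copies of Z. Use Z'' when Z'' ≤ T and Z' otherwise: E Z ≤ E[A] (T + P(Z > T) E Z).
Choosing T with E[A] P(Z > T) ≤ 1/2 lets the last term be absorbed. -/
theorem lintegral_limTotal_rpow_neg_lt_top (hpos : ∀ᵐ a ∂lam, 0 < a)
    (hlim : ∀ᵐ v ∂law lam, 0 < limTotal v) {s : ℝ} (hs : 0 < s)
    (hmom : ∫⁻ a, (a : ℝ≥0∞) ^ (-s) ∂lam < ∞) :
    ∫⁻ v, limTotal v ^ (-s) ∂law lam < ∞ := by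
  set Z : Weights → ℝ≥0∞ := fun v => limTotal v ^ (-s) with hZ
  have hZm : Measurable Z := by fun_prop
  -- The maximum with 1 is what lets the truncation at `N` pass through the product, by
  -- `min_mul_le_max_mul`.
  set A : ℝ≥0 → ℝ≥0∞ := fun a => max (((2⁻¹ * a : ℝ≥0) : ℝ≥0∞) ^ (-s)) 1 with hA
  have hAm : Measurable A := by fun_prop
  have hAi : ∫⁻ a, A a ∂lam ≠ ∞ := by
    refine ne_top_of_le_ne_top ?_ (lintegral_mono (g := fun a : ℝ≥0 =>
      ((2⁻¹ : ℝ≥0) : ℝ≥0∞) ^ (-s) * (a : ℝ≥0∞) ^ (-s) + 1) fun a => ?_)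
    · rw [lintegral_add_right _ measurable_const, lintegral_const_mul _ (by fun_prop)]
      refine ENNReal.add_ne_top.2 ⟨ENNReal.mul_ne_top ?_ hmom.ne, by simp⟩
      simp [ENNReal.rpow_eq_top_iff]
    · simp only [hA]
      rw [ENNReal.coe_mul, ENNReal.mul_rpow_of_ne_zero_of_ne_top (by simp) ENNReal.coe_ne_top]
      exact max_le le_self_add le_add_self
  obtain ⟨T, hT⟩ : ∃ T : ℕ, (∫⁻ a, A a ∂lam) * law lam {v | (T : ℝ≥0∞) < Z v} ≤ 2⁻¹ := by
    have h1 : Tendsto (fun T : ℕ => law lam {v | (T : ℝ≥0∞) < Z v}) atTop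
        (𝓝 (law lam (⋂ T : ℕ, {v | (T : ℝ≥0∞) < Z v}))) := by
      refine tendsto_measure_iInter_atTop
        (fun T => (measurableSet_lt measurable_const hZm).nullMeasurableSet) ?_
        ⟨0, measure_ne_top _ _⟩
      intro T T' h v (hv : (T' : ℝ≥0∞) < Z v)
      exact lt_of_le_of_lt (by exact_mod_cast h : (T : ℝ≥0∞) ≤ T') hv
    have h2 : law lam (⋂ T : ℕ, {v | (T : ℝ≥0∞) < Z v}) = 0 := by
      refine measure_mono_null (fun v hv => ?_) (ae_iff.1 hlim)
      simp only [Set.mem_iInter, Set.mem_ofPred_eq] at hv ⊢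
      intro h0
      obtain ⟨T, hT⟩ := ENNReal.exists_nat_gt (r := Z v) (by
        simp only [hZ, Ne, ENNReal.rpow_eq_top_iff, not_or, not_and_or]
        exact ⟨Or.inl h0.ne', Or.inr (by linarith)⟩)
      exact lt_asymm hT (hv T)
    rw [h2] at h1
    have h3 := ENNReal.Tendsto.const_mul h1 (Or.inr hAi)
    rw [mul_zero] at h3
    exact ((tendsto_order.1 h3).2 2⁻¹ (by simp)).exists.imp fun _ h => h.le
  set M : ℝ≥0∞ := ∫⁻ a, A a ∂lam with hM
  -- The truncated mean is finite, so it may be subtracted; the bound does not depend on `N`.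
  have hbound (N : ℕ) : ∫⁻ v, min (Z v) N ∂law lam ≤ 2 * (M * T) := by
    set x : ℝ≥0∞ := ∫⁻ v, min (Z v) N ∂law lam with hx
    have hxt : x ≠ ∞ := by
      refine ne_top_of_le_ne_top (b := (N : ℝ≥0∞)) (by simp) ?_
      calc x ≤ ∫⁻ _, (N : ℝ≥0∞) ∂law lam := lintegral_mono fun v => min_le_right _ _
        _ = N := by simp
    have hind : Measurable fun w : Weights => {v | (T : ℝ≥0∞) < Z v}.indicator (1 : Weights → ℝ≥0∞) w :=
      measurable_one.indicator (measurableSet_lt measurable_const hZm)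
    have h1 : x ≤ M * (T + x * law lam {v | (T : ℝ≥0∞) < Z v}) := by
      calc x = ∫⁻ a, ∫⁻ u, ∫⁻ w, min (Z (node (a, u, w))) N ∂law lam ∂law lam ∂lam :=
            lintegral_law (by fun_prop)
        _ ≤ ∫⁻ a, ∫⁻ u, ∫⁻ w, A a * (T + min (Z u) N *
              {v | (T : ℝ≥0∞) < Z v}.indicator (1 : Weights → ℝ≥0∞) w) ∂law lam ∂law lam ∂lam := by
            refine lintegral_mono_ae ?_
            filter_upwards [hpos] with a ha
            refine lintegral_mono fun u => lintegral_mono fun w => ?_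
            have h := limTotal_node_rpow_neg_le hs ha u w
            by_cases hw : (T : ℝ≥0∞) < Z w
            · rw [Set.indicator_of_mem (show w ∈ {v | (T : ℝ≥0∞) < Z v} from hw), Pi.one_apply,
                mul_one]
              calc min (Z (node (a, u, w))) N
                  ≤ min (((2⁻¹ * a : ℝ≥0) : ℝ≥0∞) ^ (-s) * Z u) N :=
                    min_le_min_right _ (h.trans (mul_le_mul_right (min_le_left _ _) _))
                _ ≤ A a * min (Z u) N := min_mul_le_max_mul _ _ _
                _ ≤ _ := mul_le_mul_right le_add_self _
            · calc min (Z (node (a, u, w))) N ≤ Z (node (a, u, w)) := min_le_left _ _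
                _ ≤ ((2⁻¹ * a : ℝ≥0) : ℝ≥0∞) ^ (-s) * Z w :=
                    h.trans (mul_le_mul_right (min_le_right _ _) _)
                _ ≤ A a * T := mul_le_mul' (le_max_left _ _) (not_lt.1 hw)
                _ ≤ _ := mul_le_mul_right le_self_add _
        _ = M * (T + x * law lam {v | (T : ℝ≥0∞) < Z v}) := by
            have hu : Measurable fun u : Weights => min (Z u) (N : ℝ≥0∞) := by fun_prop
            have e (a : ℝ≥0) : ∫⁻ u, ∫⁻ w, A a * (T + min (Z u) N *
                {v | (T : ℝ≥0∞) < Z v}.indicator (1 : Weights → ℝ≥0∞) w) ∂law lam ∂law lam =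
                A a * (T + x * law lam {v | (T : ℝ≥0∞) < Z v}) := by
              have e1 (u : Weights) : ∫⁻ w, A a * (T + min (Z u) N *
                  {v | (T : ℝ≥0∞) < Z v}.indicator (1 : Weights → ℝ≥0∞) w) ∂law lam =
                  A a * (T + min (Z u) N * law lam {v | (T : ℝ≥0∞) < Z v}) := by
                rw [lintegral_const_mul (A a) (f := fun w => T + min (Z u) N *
                    {v | (T : ℝ≥0∞) < Z v}.indicator (1 : Weights → ℝ≥0∞) w)
                    (measurable_const.add (hind.const_mul _)),
                  lintegral_add_left measurable_const, lintegral_const_mul _ hind,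
                  lintegral_indicator_one (measurableSet_lt measurable_const hZm), lintegral_const,
                  measure_univ, mul_one]
              simp_rw [e1]
              rw [lintegral_const_mul (A a) (f := fun u => T + min (Z u) N *
                  law lam {v | (T : ℝ≥0∞) < Z v}) (measurable_const.add (hu.mul_const _)),
                lintegral_add_left measurable_const, lintegral_mul_const _ hu, lintegral_const,
                measure_univ, mul_one]
            simp_rw [e]
            rw [lintegral_mul_const _ hAm]
    have h2 : x ≤ M * T + 2⁻¹ * x := by
      calc x ≤ _ := h1
        _ = M * T + (M * law lam {v | (T : ℝ≥0∞) < Z v}) * x := by ring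
        _ ≤ _ := by gcongr
    have h3 : 2 * x ≤ 2 * (M * T) + x := by
      calc 2 * x ≤ 2 * (M * T + 2⁻¹ * x) := by gcongr
        _ = 2 * (M * T) + x := by
          rw [mul_add, ← mul_assoc 2 2⁻¹ x, ENNReal.mul_inv_cancel (by simp) (by simp), one_mul]
    rw [two_mul] at h3
    exact (ENNReal.add_le_add_iff_right hxt).1 h3
  have hsup : ∫⁻ v, Z v ∂law lam = ⨆ N : ℕ, ∫⁻ v, min (Z v) N ∂law lam := by
    rw [← lintegral_iSup (f := fun (N : ℕ) v => min (Z v) (N : ℝ≥0∞)) (fun N => by fun_prop)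
      (fun N N' h v => min_le_min_left _ (by exact_mod_cast h))]
    refine lintegral_congr fun v => ?_
    refine le_antisymm ?_ (iSup_le fun N => min_le_left _ _)
    rcases eq_or_ne (Z v) ∞ with h | h
    · simp [h, ENNReal.iSup_natCast]
    · obtain ⟨N, hN⟩ := ENNReal.exists_nat_gt h
      exact le_iSup_of_le N (le_min le_rfl hN.le)
  rw [hsup]
  refine (iSup_le hbound).trans_lt ?_
  exact ENNReal.mul_lt_top (by simp) (ENNReal.mul_lt_top hAi.lt_top (by simp))

/-! ### Mixed moments -/

theorem mul_rpow_coe (a b : ℝ≥0) {s : ℝ} (hs : 0 < s) :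
    ((a * b : ℝ≥0) : ℝ≥0∞) ^ s = (a : ℝ≥0∞) ^ s * (b : ℝ≥0∞) ^ s := by
  rw [ENNReal.coe_mul, ENNReal.mul_rpow_of_nonneg _ _ hs.le]

/-- The basic cancellation: a weight that occurs both in a path product and in the mass of the
separating node disappears and leaves only 2^s. -/
theorem half_mul_rpow_neg {a : ℝ≥0} (ha : 0 < a) (y : ℝ≥0∞) (s : ℝ) :
    (a : ℝ≥0∞) ^ s * (((2⁻¹ * a : ℝ≥0) : ℝ≥0∞) * y) ^ (-s) = 2 ^ s * y ^ (-s) := by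
  have h0 : (a : ℝ≥0∞) ≠ 0 := by simpa using ha.ne'
  rw [ENNReal.coe_mul, mul_assoc, ENNReal.mul_rpow_of_ne_zero_of_ne_top (by simp)
    ENNReal.coe_ne_top, ENNReal.mul_rpow_of_ne_zero_of_ne_top h0 ENNReal.coe_ne_top,
    ENNReal.coe_inv two_ne_zero, ENNReal.inv_rpow, ENNReal.rpow_neg ((2 : ℝ≥0) : ℝ≥0∞), inv_inv]
  calc _ = (a : ℝ≥0∞) ^ s * (a : ℝ≥0∞) ^ (-s) * (((2 : ℝ≥0) : ℝ≥0∞) ^ s * y ^ (-s)) := by ring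
    _ = _ := by
      rw [← ENNReal.rpow_add _ _ h0 ENNReal.coe_ne_top, add_neg_cancel, ENNReal.rpow_zero, one_mul]
      simp

theorem lintegral_pathProd_rpow (hpos : ∀ᵐ a ∂lam, 0 < a) {s : ℝ} (hs : 0 < s)
    (x : List Bool) :
    ∫⁻ v, (pathProd v x : ℝ≥0∞) ^ s ∂law lam = (∫⁻ a, (a : ℝ≥0∞) ^ s ∂lam) ^ x.length := by
  induction x with
  | nil => simp [pathProd]
  | cons b x ih =>
    have key : ∫⁻ v, (pathProd v (b :: x) : ℝ≥0∞) ^ s ∂law lam =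
        (∫⁻ a, (a : ℝ≥0∞) ^ s ∂lam) * ∫⁻ v, (pathProd v x : ℝ≥0∞) ^ s ∂law lam := by
      cases b
      · rw [lintegral_law_eq_mul hpos (α := fun a => (a : ℝ≥0∞) ^ s)
          (β := fun v => (pathProd v x : ℝ≥0∞) ^ s) (γ := fun _ => 1) (by fun_prop) (by fun_prop)
          (by fun_prop) measurable_const]
        · simp
        · intro a u w _
          simp only [pathProd, mul_rpow_coe _ _ hs, node_nil, child_false_node, mul_one]
      · rw [lintegral_law_eq_mul hpos (α := fun a => (a : ℝ≥0∞) ^ s) (β := fun _ => 1)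
          (γ := fun v => (pathProd v x : ℝ≥0∞) ^ s) (by fun_prop) (by fun_prop)
          measurable_const (by fun_prop)]
        · simp
        · intro a u w _
          simp only [pathProd, mul_rpow_coe _ _ hs, node_nil, child_true_node, one_mul]
    rw [key, ih, List.length_cons, pow_succ']

/-- The weights at the proper prefixes of `J` are shared with `x` and leave 2^s each; the other
weights on the path to `x` are independent of the subtree below `J` and give one moment each. The
moments at shared nodes are multiplied onto the left side to avoid dividing in `ℝ≥0∞`. -/
theorem lintegral_pathProd_mul_mass (hpos : ∀ᵐ a ∂lam, 0 < a) {s : ℝ} (hs : 0 < s)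
    {x J : List Bool} (h : Beside x J) :
    (∫⁻ v, (pathProd v x : ℝ≥0∞) ^ s * mass v J ^ (-s) ∂law lam) *
        (∫⁻ a, (a : ℝ≥0∞) ^ s ∂lam) ^ J.length =
      (2 ^ s) ^ J.length * (∫⁻ a, (a : ℝ≥0∞) ^ s ∂lam) ^ x.length *
        ∫⁻ v, limTotal v ^ (-s) ∂law lam := by
  induction h with
  | refl => simp [pathProd, mass]
  | side b x =>
    have key : ∫⁻ v, (pathProd v (b :: x) : ℝ≥0∞) ^ s * mass v [!b] ^ (-s) ∂law lam =
        2 ^ s * ((∫⁻ v, (pathProd v x : ℝ≥0∞) ^ s ∂law lam) *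
          ∫⁻ v, limTotal v ^ (-s) ∂law lam) := by
      cases b
      · rw [lintegral_law_eq_mul hpos (α := fun _ => 2 ^ s)
          (β := fun v => (pathProd v x : ℝ≥0∞) ^ s) (γ := fun v => limTotal v ^ (-s))
          (by fun_prop) (by fun_prop) (by fun_prop) (by fun_prop)]
        · simp
        · intro a u w ha
          simp only [pathProd, mul_rpow_coe _ _ hs, mass, node_nil, child_false_node, Bool.not_false,
            child_true_node]
          rw [mul_right_comm, half_mul_rpow_neg ha]
          ring
      · rw [lintegral_law_eq_mul hpos (α := fun _ => 2 ^ s)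
          (γ := fun v => (pathProd v x : ℝ≥0∞) ^ s) (β := fun v => limTotal v ^ (-s))
          (by fun_prop) (by fun_prop) (by fun_prop) (by fun_prop)]
        · simp [mul_comm]
        · intro a u w ha
          simp only [pathProd, mul_rpow_coe _ _ hs, mass, node_nil, child_false_node, Bool.not_true,
            child_true_node]
          rw [mul_right_comm, half_mul_rpow_neg ha]
          ring
    rw [key, lintegral_pathProd_rpow hpos hs]
    simp only [List.length_cons, List.length_nil, zero_add, pow_succ]
    ring
  | @cons b x J _ ih =>
    have key : ∫⁻ v, (pathProd v (b :: x) : ℝ≥0∞) ^ s * mass v (b :: J) ^ (-s) ∂law lam =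
        2 ^ s * ∫⁻ v, (pathProd v x : ℝ≥0∞) ^ s * mass v J ^ (-s) ∂law lam := by
      cases b
      · rw [lintegral_law_eq_mul hpos (α := fun _ => 2 ^ s)
          (β := fun v => (pathProd v x : ℝ≥0∞) ^ s * mass v J ^ (-s)) (γ := fun _ => 1)
          (by fun_prop) (by fun_prop) (by fun_prop) (by fun_prop)]
        · simp
        · intro a u w ha
          simp only [pathProd, mul_rpow_coe _ _ hs, mass, node_nil, child_false_node]
          rw [mul_right_comm, half_mul_rpow_neg ha]
          ring
      · rw [lintegral_law_eq_mul hpos (α := fun _ => 2 ^ s) (β := fun _ => 1)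
          (γ := fun v => (pathProd v x : ℝ≥0∞) ^ s * mass v J ^ (-s))
          (by fun_prop) (by fun_prop) (by fun_prop) (by fun_prop)]
        · simp
        · intro a u w ha
          simp only [pathProd, mul_rpow_coe _ _ hs, mass, node_nil, child_true_node]
          rw [mul_right_comm, half_mul_rpow_neg ha]
          ring
    rw [key, List.length_cons, List.length_cons, pow_succ, pow_succ, pow_succ]
    exact eq_of_eq_mul_of_mul_eq (2 ^ s * ∫⁻ a, (a : ℝ≥0∞) ^ s ∂lam) (ih) (by ring) (by ring)

/-- Each proper prefix of `sep x y` is a proper prefix of `x` or of `y`, so its weight cancels one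
of the 2|x| factors of the two path products and leaves 2^s. At a common ancestor of `x` and `y` the
second factor survives and contributes a moment. -/
theorem lintegral_pathProd_mul_pathProd_mul_mass (hpos : ∀ᵐ a ∂lam, 0 < a) {s : ℝ} (hs : 0 < s)
    {x y : List Bool} (h : x.length = y.length) :
    (∫⁻ v, (pathProd v x : ℝ≥0∞) ^ s * (pathProd v y : ℝ≥0∞) ^ s * mass v (sep x y) ^ (-s)
        ∂law lam) * (∫⁻ a, (a : ℝ≥0∞) ^ s ∂lam) ^ (sep x y).length =
      (2 ^ s) ^ (sep x y).length * (∫⁻ a, (a : ℝ≥0∞) ^ s ∂lam) ^ (2 * x.length) *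
        ∫⁻ v, limTotal v ^ (-s) ∂law lam := by
  set m := ∫⁻ a, (a : ℝ≥0∞) ^ s ∂lam with hm
  have hαm : Measurable fun a : ℝ≥0 => 2 ^ s * (a : ℝ≥0∞) ^ s := by fun_prop
  have hα : ∫⁻ a, 2 ^ s * (a : ℝ≥0∞) ^ s ∂lam = 2 ^ s * m :=
    lintegral_const_mul _ (by fun_prop)
  have alg {a : ℝ≥0} (ha : 0 < a) (p q r : ℝ≥0∞) :
      (a : ℝ≥0∞) ^ s * p * ((a : ℝ≥0∞) ^ s * q) * (((2⁻¹ * a : ℝ≥0) : ℝ≥0∞) * r) ^ (-s) =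
        2 ^ s * (a : ℝ≥0∞) ^ s * (p * q * r ^ (-s)) := by
    calc _ = ((a : ℝ≥0∞) ^ s * (((2⁻¹ * a : ℝ≥0) : ℝ≥0∞) * r) ^ (-s)) *
          ((a : ℝ≥0∞) ^ s * (p * q)) := by ring
      _ = _ := by rw [half_mul_rpow_neg ha]; ring
  have hinl {x y J : List Bool} (h : x.length = y.length) (hJ : Beside x J) :
      (∫⁻ v, (pathProd v (false :: x) : ℝ≥0∞) ^ s * (pathProd v (true :: y) : ℝ≥0∞) ^ s *
        mass v (false :: J) ^ (-s) ∂law lam) * m ^ (J.length + 1) =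
      (2 ^ s) ^ (J.length + 1) * m ^ (2 * (x.length + 1)) *
        ∫⁻ v, limTotal v ^ (-s) ∂law lam := by
    rw [lintegral_law_eq_mul hpos (α := fun a => 2 ^ s * (a : ℝ≥0∞) ^ s)
      (β := fun v => (pathProd v x : ℝ≥0∞) ^ s * mass v J ^ (-s))
      (γ := fun v => (pathProd v y : ℝ≥0∞) ^ s) (by fun_prop) hαm (by fun_prop) (by fun_prop),
      hα, lintegral_pathProd_rpow hpos hs]
    · have := lintegral_pathProd_mul_mass hpos hs hJ
      rw [← hm, ← h]
      exact eq_of_eq_mul_of_mul_eq (2 ^ s * m * m * m ^ x.length) (this) (by ring) (by ring)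
    · intro a u w ha
      simp only [pathProd, mul_rpow_coe _ _ hs, mass, node_nil, child_true_node, child_false_node]
      rw [alg ha]
      ring
  have hinr {x y J : List Bool} (h : x.length = y.length) (hJ : Beside y J) :
      (∫⁻ v, (pathProd v (false :: x) : ℝ≥0∞) ^ s * (pathProd v (true :: y) : ℝ≥0∞) ^ s *
        mass v (true :: J) ^ (-s) ∂law lam) * m ^ (J.length + 1) =
      (2 ^ s) ^ (J.length + 1) * m ^ (2 * (x.length + 1)) *
        ∫⁻ v, limTotal v ^ (-s) ∂law lam := by
    rw [lintegral_law_eq_mul hpos (α := fun a => 2 ^ s * (a : ℝ≥0∞) ^ s)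
      (β := fun v => (pathProd v x : ℝ≥0∞) ^ s)
      (γ := fun v => (pathProd v y : ℝ≥0∞) ^ s * mass v J ^ (-s))
      (by fun_prop) hαm (by fun_prop) (by fun_prop),
      hα, lintegral_pathProd_rpow hpos hs]
    · have := lintegral_pathProd_mul_mass hpos hs hJ
      rw [← hm, ← h] at this
      rw [← hm]
      exact eq_of_eq_mul_of_mul_eq (2 ^ s * m * m * m ^ x.length) (this) (by ring) (by ring)
    · intro a u w ha
      simp only [pathProd, mul_rpow_coe _ _ hs, mass, node_nil, child_true_node, child_false_node]
      rw [alg ha]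
      ring
  have hadj {x y : List Bool} (h : x.length = y.length) :
      (∫⁻ v, (pathProd v (false :: x) : ℝ≥0∞) ^ s * (pathProd v (true :: y) : ℝ≥0∞) ^ s *
        mass v (sep (false :: x) (true :: y)) ^ (-s) ∂law lam) *
          m ^ (sep (false :: x) (true :: y)).length =
      (2 ^ s) ^ (sep (false :: x) (true :: y)).length * m ^ (2 * (x.length + 1)) *
        ∫⁻ v, limTotal v ^ (-s) ∂law lam := by
    rcases hxy : adjSep x y with J | J
    · simpa [sep, hxy] using hinl h ((beside_adjSep h).1 J hxy)
    · simpa [sep, hxy] using hinr h ((beside_adjSep h).2 J hxy)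
  induction x generalizing y with
  | nil =>
    obtain rfl : y = [] := List.length_eq_zero_iff.1 h.symm
    simp [pathProd, mass, sep]
  | cons b x ih =>
    rcases y with - | ⟨c, y⟩
    · simp at h
    have h' : x.length = y.length := by simpa using h
    rcases b with - | - <;> rcases c with - | -
    · have key : ∫⁻ v, (pathProd v (false :: x) : ℝ≥0∞) ^ s *
          (pathProd v (false :: y) : ℝ≥0∞) ^ s * mass v (false :: sep x y) ^ (-s) ∂law lam =
          2 ^ s * m * ∫⁻ v, (pathProd v x : ℝ≥0∞) ^ s * (pathProd v y : ℝ≥0∞) ^ s *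
            mass v (sep x y) ^ (-s) ∂law lam := by
        rw [lintegral_law_eq_mul hpos (α := fun a => 2 ^ s * (a : ℝ≥0∞) ^ s)
          (β := fun v => (pathProd v x : ℝ≥0∞) ^ s * (pathProd v y : ℝ≥0∞) ^ s *
            mass v (sep x y) ^ (-s)) (γ := fun _ => 1) (by fun_prop) hαm (by fun_prop)
          measurable_const, hα]
        · simp
        · intro a u w ha
          simp only [pathProd, mul_rpow_coe _ _ hs, mass, node_nil, child_false_node]
          rw [alg ha, mul_one]
      rw [sep, key, List.length_cons, List.length_cons]
      exact eq_of_eq_mul_of_mul_eq (2 ^ s * m * m) (ih h') (by ring) (by ring)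
    · exact hadj h'
    · have hsep : sep (true :: x) (false :: y) = sep (false :: y) (true :: x) := by simp [sep]
      rw [hsep, List.length_cons, h', ← hadj h'.symm]
      congr 1
      exact lintegral_congr fun v => by ring
    · have key : ∫⁻ v, (pathProd v (true :: x) : ℝ≥0∞) ^ s *
          (pathProd v (true :: y) : ℝ≥0∞) ^ s * mass v (true :: sep x y) ^ (-s) ∂law lam =
          2 ^ s * m * ∫⁻ v, (pathProd v x : ℝ≥0∞) ^ s * (pathProd v y : ℝ≥0∞) ^ s *
            mass v (sep x y) ^ (-s) ∂law lam := by
        rw [lintegral_law_eq_mul hpos (α := fun a => 2 ^ s * (a : ℝ≥0∞) ^ s) (β := fun _ => 1)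
          (γ := fun v => (pathProd v x : ℝ≥0∞) ^ s * (pathProd v y : ℝ≥0∞) ^ s *
            mass v (sep x y) ^ (-s)) (by fun_prop) hαm measurable_const (by fun_prop), hα]
        · simp
        · intro a u w ha
          simp only [pathProd, mul_rpow_coe _ _ hs, mass, node_nil, child_true_node]
          rw [alg ha, one_mul]
      rw [sep, key, List.length_cons, List.length_cons]
      exact eq_of_eq_mul_of_mul_eq (2 ^ s * m * m) (ih h') (by ring) (by ring)

end Weights

end Cascade

namespace Cascade

/-! ### Flows on the binary tree -/

/-- The binary words of length `n`. -/
def words : ℕ → Finset (List Bool)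
  | 0 => {[]}
  | n + 1 => (words n).map ⟨List.cons false, List.cons_injective⟩ ∪
      (words n).map ⟨List.cons true, List.cons_injective⟩

theorem mem_words {n : ℕ} {x : List Bool} : x ∈ words n ↔ x.length = n := by
  induction n generalizing x with
  | zero => simp [words]
  | succ n ih => rcases x with - | ⟨_ | _, x⟩ <;> simp [words, ih]

theorem sum_words_zero {M : Type*} [AddCommMonoid M] (f : List Bool → M) :
    ∑ x ∈ words 0, f x = f [] := by
  simp [words]

theorem sum_words_succ {M : Type*} [AddCommMonoid M] (n : ℕ) (f : List Bool → M) :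
    ∑ x ∈ words (n + 1), f x =
      ∑ x ∈ words n, f (false :: x) + ∑ x ∈ words n, f (true :: x) := by
  rw [words, Finset.sum_union]
  · simp
  · rw [Finset.disjoint_left]
    rintro (- | ⟨_ | _, x⟩) <;> simp

/-- A nonnegative function on the nodes of the binary tree which is additive over children. -/
def IsFlow (θ : List Bool → ℝ≥0) : Prop :=
  ∀ x, θ x = θ (x ++ [false]) + θ (x ++ [true])

namespace IsFlow

variable {θ η : List Bool → ℝ≥0}

theorem shift (h : IsFlow θ) (b : Bool) : IsFlow fun x => θ (b :: x) := fun x => h (b :: x)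

theorem child_le (h : IsFlow θ) (b : Bool) : θ [b] ≤ θ [] := by
  rw [h []]
  cases b
  exacts [le_self_add, le_add_self]

theorem sum_words (h : IsFlow θ) (n : ℕ) : ∑ x ∈ words n, θ x = θ [] := by
  induction n generalizing θ with
  | zero => exact sum_words_zero θ
  | succ n ih => rw [sum_words_succ, ih (h.shift false), ih (h.shift true), h []]; rfl

/-- Among the four pairs of first letters only (true, false) continues the recursion, with a factor
τ and with c replaced by cκ. The others stop at a node of length one and contribute at most 2τcθ[].
Hence the inequality imposed on `a`. -/
theorem sum_adjSep_le {τ κ a : ℝ≥0} (ha : 1 ≤ a) (ha' : 2 * τ + τ * κ * a ≤ a)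
    (hθ : IsFlow θ) (hη : IsFlow η) {c : ℝ≥0} (hc : ∀ x, η x ≤ c * κ ^ x.length) (n : ℕ) :
    ∑ x ∈ words n, ∑ y ∈ words n,
      θ x * η y * τ ^ (adjSep x y).elim List.length List.length ≤ a * c * θ [] := by
  induction n generalizing θ η c with
  | zero =>
    simp only [sum_words_zero]
    have h := hc []
    simp only [List.length_nil, pow_zero, mul_one] at h
    calc θ [] * η [] * τ ^ (adjSep [] []).elim List.length List.length = 1 * η [] * θ [] := by
          simp [adjSep, mul_comm]
      _ ≤ a * c * θ [] := by gcongr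
  | succ n ih =>
    have hc0 (x : List Bool) : η (false :: x) ≤ c * κ * κ ^ x.length := by
      refine (hc _).trans_eq ?_
      rw [List.length_cons, pow_succ]; ring
    have h0 := ih (hθ.shift true) (hη.shift false) hc0
    have hη0 : η [] ≤ c := by simpa using hc []
    have e1 : ∑ x ∈ words n, ∑ y ∈ words n, θ (false :: x) * η (false :: y) * τ =
        θ [false] * η [false] * τ := by
      rw [← (hθ.shift false).sum_words n, ← (hη.shift false).sum_words n, Finset.sum_mul_sum,
        Finset.sum_mul]
      simp only [Finset.sum_mul]
    have e2 : ∑ x ∈ words n, ∑ y ∈ words n, θ (false :: x) * η (true :: y) * τ =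
        θ [false] * η [true] * τ := by
      rw [← (hθ.shift false).sum_words n, ← (hη.shift true).sum_words n, Finset.sum_mul_sum,
        Finset.sum_mul]
      simp only [Finset.sum_mul]
    have e3 : ∑ x ∈ words n, ∑ y ∈ words n, θ (true :: x) * η (true :: y) * τ =
        θ [true] * η [true] * τ := by
      rw [← (hθ.shift true).sum_words n, ← (hη.shift true).sum_words n, Finset.sum_mul_sum,
        Finset.sum_mul]
      simp only [Finset.sum_mul]
    have e4 : ∑ x ∈ words n, ∑ y ∈ words n, θ (true :: x) * η (false :: y) *
        τ ^ (adjSep (true :: x) (false :: y)).elim List.length List.length =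
        τ * ∑ x ∈ words n, ∑ y ∈ words n, θ (true :: x) * η (false :: y) *
          τ ^ (adjSep x y).elim List.length List.length := by
      simp only [Finset.mul_sum]
      refine Finset.sum_congr rfl fun x _ => Finset.sum_congr rfl fun y _ => ?_
      rcases h : adjSep x y with J | J <;>
        simp only [adjSep, h, Sum.map_inl, Sum.map_inr, Sum.elim_inl, Sum.elim_inr,
          List.length_cons, pow_succ] <;> ring
    simp only [sum_words_succ, Finset.sum_add_distrib]
    rw [e4]
    simp only [adjSep, Sum.elim_inl, Sum.elim_inr, List.length_singleton, pow_one, e1, e2, e3]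
    calc _ = (θ [false] * (η [false] + η [true]) + θ [true] * η [true]) * τ +
          τ * ∑ x ∈ words n, ∑ y ∈ words n, θ (true :: x) * η (false :: y) *
          τ ^ (adjSep x y).elim List.length List.length := by ring
      _ ≤ (θ [] * c + θ [] * c) * τ + τ * (a * (c * κ) * θ []) := by
          have h1 : η [false] + η [true] ≤ c := (hη []).symm.trans_le hη0
          have h2 := hθ.child_le false
          have h3 := hθ.child_le true
          have h4 := (hη.child_le true).trans hη0
          refine add_le_add (by gcongr) (mul_le_mul_right (h0.trans ?_) _)
          gcongr
      _ = (2 * τ + τ * κ * a) * c * θ [] := by ring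
      _ ≤ a * c * θ [] := by gcongr

/-- Splitting by first letters, the two diagonal blocks reproduce the sum one level down with
constants τ and cκ, and each of the two mixed blocks is τ times a sum bounded by `sum_adjSep_le`. -/
theorem sum_sep_le {τ κ a d : ℝ≥0} (ha : 1 ≤ a) (ha' : 2 * τ + τ * κ * a ≤ a)
    (hd : 1 ≤ d) (hd' : τ * κ * d + 2 * τ * κ * a ≤ d)
    (hθ : IsFlow θ) {c : ℝ≥0} (hc : ∀ x, θ x ≤ c * κ ^ x.length) (n : ℕ) :
    ∑ x ∈ words n, ∑ y ∈ words n, θ x * θ y * τ ^ (sep x y).length ≤ d * c * θ [] := by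
  induction n generalizing θ c with
  | zero =>
    simp only [sum_words_zero]
    have h := hc []
    simp only [List.length_nil, pow_zero, mul_one] at h
    calc θ [] * θ [] * τ ^ (sep [] []).length = 1 * θ [] * θ [] := by simp [sep]
      _ ≤ d * c * θ [] := by gcongr
  | succ n ih =>
    have hcb (b : Bool) (x : List Bool) : θ (b :: x) ≤ c * κ * κ ^ x.length := by
      refine (hc _).trans_eq ?_
      rw [List.length_cons, pow_succ]; ring
    have h0 := ih (hθ.shift false) (hcb false)
    have h1 := ih (hθ.shift true) (hcb true)
    have h2 := sum_adjSep_le ha ha' (hθ.shift false) (hθ.shift true) (hcb true) n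
    have e (b : Bool) : ∑ x ∈ words n, ∑ y ∈ words n, θ (b :: x) * θ (b :: y) *
        τ ^ (sep (b :: x) (b :: y)).length = τ * ∑ x ∈ words n, ∑ y ∈ words n,
          θ (b :: x) * θ (b :: y) * τ ^ (sep x y).length := by
      simp only [Finset.mul_sum]
      refine Finset.sum_congr rfl fun x _ => Finset.sum_congr rfl fun y _ => ?_
      cases b <;> simp only [sep, List.length_cons, pow_succ] <;> ring
    have e3 : ∑ x ∈ words n, ∑ y ∈ words n, θ (false :: x) * θ (true :: y) *
        τ ^ (sep (false :: x) (true :: y)).length = τ * ∑ x ∈ words n, ∑ y ∈ words n,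
          θ (false :: x) * θ (true :: y) * τ ^ (adjSep x y).elim List.length List.length := by
      simp only [Finset.mul_sum]
      refine Finset.sum_congr rfl fun x _ => Finset.sum_congr rfl fun y _ => ?_
      rcases h : adjSep x y with J | J <;>
        simp only [sep, h, Sum.elim_inl, Sum.elim_inr, List.length_cons, pow_succ] <;> ring
    have e4 : ∑ x ∈ words n, ∑ y ∈ words n, θ (true :: x) * θ (false :: y) *
        τ ^ (sep (true :: x) (false :: y)).length = τ * ∑ x ∈ words n, ∑ y ∈ words n,
          θ (false :: x) * θ (true :: y) * τ ^ (adjSep x y).elim List.length List.length := by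
      rw [Finset.sum_comm]
      simp only [Finset.mul_sum]
      refine Finset.sum_congr rfl fun x _ => Finset.sum_congr rfl fun y _ => ?_
      rcases h : adjSep x y with J | J <;>
        simp only [sep, h, Sum.elim_inl, Sum.elim_inr, List.length_cons, pow_succ] <;> ring
    simp only [sum_words_succ, Finset.sum_add_distrib]
    rw [e, e, e3, e4]
    set A := ∑ x ∈ words n, ∑ y ∈ words n,
      θ (false :: x) * θ (true :: y) * τ ^ (adjSep x y).elim List.length List.length
    calc _ ≤ τ * (d * (c * κ) * θ [false]) + τ * (a * (c * κ) * θ []) +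
          (τ * (a * (c * κ) * θ []) + τ * (d * (c * κ) * θ [true])) := by
          have h3 : A ≤ a * (c * κ) * θ [] := h2.trans (by gcongr; exact hθ.child_le false)
          gcongr
      _ = τ * κ * d * c * (θ [false] + θ [true]) + 2 * τ * κ * a * c * θ [] := by ring
      _ = (τ * κ * d + 2 * τ * κ * a) * c * θ [] := by
          rw [show θ [false] + θ [true] = θ [] from (hθ []).symm]; ring
      _ ≤ d * c * θ [] := by gcongr

/-- The energy sums of a flow with enough decay are bounded. -/
theorem exists_sum_sep_le {τ κ : ℝ≥0} (hτκ : τ * κ < 1) (hθ : IsFlow θ) {c : ℝ≥0}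
    (hc : ∀ x, θ x ≤ c * κ ^ x.length) :
    ∃ B : ℝ≥0, ∀ n, ∑ x ∈ words n, ∑ y ∈ words n, θ x * θ y * τ ^ (sep x y).length ≤ B := by
  -- Both constants solve an affine inequality of slope τκ < 1.
  have key (p : ℝ≥0) : ∃ a : ℝ≥0, 1 ≤ a ∧ p + τ * κ * a ≤ a := by
    have hq : 1 - τ * κ + τ * κ = 1 := tsub_add_cancel_of_le hτκ.le
    have hq0 : 0 < 1 - τ * κ := tsub_pos_of_lt hτκ
    refine ⟨(1 + p) / (1 - τ * κ), ?_, ?_⟩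
    · rw [one_le_div hq0]
      exact tsub_le_self.trans le_self_add
    · calc p + τ * κ * ((1 + p) / (1 - τ * κ))
          ≤ (1 + p) + τ * κ * ((1 + p) / (1 - τ * κ)) := by gcongr; exact le_add_self
        _ = (1 - τ * κ) * ((1 + p) / (1 - τ * κ)) + τ * κ * ((1 + p) / (1 - τ * κ)) := by
            rw [mul_div_cancel₀ _ hq0.ne']
        _ = _ := by rw [← add_mul, hq, one_mul]
  obtain ⟨a, ha, ha'⟩ := key (2 * τ)
  obtain ⟨d, hd, hd'⟩ := key (2 * τ * κ * a)
  exact ⟨_, hθ.sum_sep_le ha ha' hd (by rwa [add_comm]) hc⟩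

end IsFlow

namespace Weights

/-! ### The tilted sums and their energy -/

/-- The weight of the word `x` of length `n` in the cascade with weights `W ^ s / m`
started from `θ`. -/
def tilted (θ : List Bool → ℝ≥0) (m : ℝ≥0) (s : ℝ) (v : Weights) (x : List Bool) : ℝ≥0∞ :=
  θ x * (m : ℝ≥0∞)⁻¹ ^ x.length * (pathProd v x : ℝ≥0∞) ^ s

/-- The total mass of the tilted weights at level `n`. -/
def tiltedSum (θ : List Bool → ℝ≥0) (m : ℝ≥0) (s : ℝ) (n : ℕ) (v : Weights) : ℝ≥0∞ :=
  ∑ x ∈ words n, tilted θ m s v x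

/-- The discrete energy of the tilted weights at level `n`. -/
def energy (θ : List Bool → ℝ≥0) (m : ℝ≥0) (s : ℝ) (n : ℕ) (v : Weights) : ℝ≥0∞ :=
  ∑ x ∈ words n, ∑ y ∈ words n, tilted θ m s v x * tilted θ m s v y * mass v (sep x y) ^ (-s)

variable {lam : Measure ℝ≥0} [IsProbabilityMeasure lam] {θ : List Bool → ℝ≥0} {m : ℝ≥0} {s : ℝ}

@[fun_prop]
theorem measurable_tilted (x : List Bool) : Measurable fun v => tilted θ m s v x := by
  unfold tilted; fun_prop

@[fun_prop]
theorem measurable_tiltedSum (n : ℕ) : Measurable (tiltedSum θ m s n) := by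
  unfold tiltedSum; fun_prop

@[fun_prop]
theorem measurable_energy (n : ℕ) : Measurable (energy θ m s n) := by
  unfold energy; fun_prop

theorem lintegral_tiltedSum (hpos : ∀ᵐ a ∂lam, 0 < a) (hs : 0 < s) (hm0 : m ≠ 0)
    (hm : ∫⁻ a, (a : ℝ≥0∞) ^ s ∂lam = m) (hθ : IsFlow θ) (n : ℕ) :
    ∫⁻ v, tiltedSum θ m s n v ∂law lam = θ [] := by
  unfold tiltedSum
  rw [lintegral_finsetSum _ fun x _ => by fun_prop]
  have h (x : List Bool) : ∫⁻ v, tilted θ m s v x ∂law lam = θ x := by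
    unfold tilted
    rw [lintegral_const_mul _ (by fun_prop), lintegral_pathProd_rpow hpos hs, hm, mul_assoc,
      ← mul_pow, ENNReal.inv_mul_cancel (by simpa using hm0) ENNReal.coe_ne_top, one_pow, mul_one]
  simp_rw [h]
  rw [← hθ.sum_words n, ENNReal.ofNNReal_finsetSum]

/-- By the exact mixed moment, normalising by `m` turns the mean energy into the deterministic flow
sum with ratio τ = 2^s / m, times the negative moment of the total mass. -/
theorem lintegral_energy_le (hpos : ∀ᵐ a ∂lam, 0 < a) (hs : 0 < s) (hm0 : m ≠ 0)
    (hm : ∫⁻ a, (a : ℝ≥0∞) ^ s ∂lam = m) {B : ℝ≥0}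
    (hB : ∀ n, ∑ x ∈ words n, ∑ y ∈ words n, θ x * θ y * (2 ^ s / m) ^ (sep x y).length ≤ B)
    (n : ℕ) :
    ∫⁻ v, energy θ m s n v ∂law lam ≤ B * ∫⁻ v, limTotal v ^ (-s) ∂law lam := by
  have hm0' : (m : ℝ≥0∞) ≠ 0 := by simpa using hm0
  set Y := ∫⁻ v, limTotal v ^ (-s) ∂law lam with hY
  have h {x y : List Bool} (hx : x ∈ words n) (hy : y ∈ words n) :
      ∫⁻ v, tilted θ m s v x * tilted θ m s v y * mass v (sep x y) ^ (-s) ∂law lam =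
        ((θ x * θ y * (2 ^ s / m) ^ (sep x y).length : ℝ≥0) : ℝ≥0∞) * Y := by
    rw [mem_words] at hx hy
    have h1 := lintegral_pathProd_mul_pathProd_mul_mass hpos hs (hx.trans hy.symm)
    rw [hm] at h1
    set G := ∫⁻ v, (pathProd v x : ℝ≥0∞) ^ s * (pathProd v y : ℝ≥0∞) ^ s *
      mass v (sep x y) ^ (-s) ∂law lam with hG
    have e1 : ∫⁻ v, tilted θ m s v x * tilted θ m s v y * mass v (sep x y) ^ (-s) ∂law lam =
        θ x * θ y * (m : ℝ≥0∞)⁻¹ ^ (2 * x.length) * G := by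
      rw [hG, ← lintegral_const_mul _ (by fun_prop)]
      refine lintegral_congr fun v => ?_
      rw [tilted, tilted, hx, hy]
      ring
    have e2 (k : ℕ) : (m : ℝ≥0∞)⁻¹ ^ k * (m : ℝ≥0∞) ^ k = 1 := by
      rw [← mul_pow, ENNReal.inv_mul_cancel hm0' ENNReal.coe_ne_top, one_pow]
    have e3 : (((2 : ℝ≥0) ^ s / m : ℝ≥0) : ℝ≥0∞) = 2 ^ s * (m : ℝ≥0∞)⁻¹ := by
      rw [ENNReal.coe_div hm0, ENNReal.coe_rpow_of_nonneg _ hs.le, ENNReal.div_eq_inv_mul, mul_comm]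
      rfl
    have e4 : G = (2 ^ s * (m : ℝ≥0∞)⁻¹) ^ (sep x y).length * (m : ℝ≥0∞) ^ (2 * x.length) * Y := by
      calc G = G * (m : ℝ≥0∞) ^ (sep x y).length * (m : ℝ≥0∞)⁻¹ ^ (sep x y).length := by
            rw [mul_assoc, mul_comm (_ ^ _) (_ ^ _), e2, mul_one]
        _ = _ := by rw [h1, mul_pow]; ring
    rw [e1, e4]
    push_cast
    rw [e3]
    calc _ = θ x * θ y * (2 ^ s * (m : ℝ≥0∞)⁻¹) ^ (sep x y).length * Y *
          ((m : ℝ≥0∞)⁻¹ ^ (2 * x.length) * (m : ℝ≥0∞) ^ (2 * x.length)) := by ring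
      _ = _ := by rw [e2, mul_one]
  unfold energy
  rw [lintegral_finsetSum _ fun x _ => by fun_prop]
  have hsum (x : List Bool) : ∫⁻ v, ∑ y ∈ words n,
      tilted θ m s v x * tilted θ m s v y * mass v (sep x y) ^ (-s) ∂law lam =
      ∑ y ∈ words n, ∫⁻ v, tilted θ m s v x * tilted θ m s v y * mass v (sep x y) ^ (-s) ∂law lam :=
    lintegral_finsetSum _ fun y _ => by fun_prop
  simp_rw [hsum]
  rw [Finset.sum_congr rfl fun x hx => Finset.sum_congr rfl fun y hy => h hx hy]
  simp_rw [← Finset.sum_mul, ← ENNReal.ofNNReal_finsetSum]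
  gcongr
  exact hB n

/-- A separating node has at most the total mass, so every kernel value in the energy is at least
`limTotal v ^ (-s)`. -/
theorem tiltedSum_sq_le (hs : 0 < s) {v : Weights} (h0 : limTotal v ≠ 0) (ht : limTotal v ≠ ∞)
    (n : ℕ) : tiltedSum θ m s n v ^ 2 ≤ energy θ m s n v * limTotal v ^ s := by
  have h1 : tiltedSum θ m s n v ^ 2 * limTotal v ^ (-s) ≤ energy θ m s n v := by
    unfold tiltedSum energy
    rw [sq, Finset.sum_mul_sum, Finset.sum_mul]
    refine Finset.sum_le_sum fun x _ => ?_
    rw [Finset.sum_mul]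
    refine Finset.sum_le_sum fun y _ => ?_
    rw [ENNReal.rpow_neg, ENNReal.rpow_neg]
    gcongr
    exact mass_le_limTotal _ _
  calc tiltedSum θ m s n v ^ 2 = tiltedSum θ m s n v ^ 2 * limTotal v ^ (-s) * limTotal v ^ s := by
        rw [mul_assoc, ← ENNReal.rpow_add _ _ h0 ht, neg_add_cancel, ENNReal.rpow_zero, mul_one]
    _ ≤ _ := by gcongr

/-- Hölder's inequality with the exponents 1/2, s/2, (1 - s)/2, applied to the energy, to the total
mass of mean at most one, and to the indicator of `S`. Since s < 1, the last exponent is positive,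
and bounded mean energies make the tilted sums uniformly integrable. -/
theorem setLIntegral_tiltedSum_le (hs : 0 < s) (hs1 : s < 1)
    (hmean : ∫⁻ a, (a : ℝ≥0∞) ∂lam = 1) (hlim : ∀ᵐ v ∂law lam, 0 < limTotal v) (n : ℕ)
    {S : Set Weights} (hS : MeasurableSet S) :
    ∫⁻ v in S, tiltedSum θ m s n v ∂law lam ≤
      (∫⁻ v, energy θ m s n v ∂law lam) ^ (1 / 2 : ℝ) * law lam S ^ ((1 - s) / 2) := by
  have hfin : ∀ᵐ v ∂law lam, limTotal v < ∞ :=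
    ae_lt_top measurable_limTotal
      ((lintegral_limTotal_le lam hmean).trans_lt ENNReal.one_lt_top).ne
  set f : Fin 3 → Weights → ℝ≥0∞ := ![energy θ m s n, limTotal, S.indicator 1] with hf
  set p : Fin 3 → ℝ := ![1 / 2, s / 2, (1 - s) / 2] with hp
  have hpp : ∀ i, 0 < p i := by
    intro i; fin_cases i <;> simp [hp] <;> linarith
  have hH := ENNReal.lintegral_prod_norm_pow_le (μ := law lam) (f := f) Finset.univ
    (fun i _ => by
      fin_cases i
      exacts [(measurable_energy n).aemeasurable, measurable_limTotal.aemeasurable,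
        (measurable_one.indicator hS).aemeasurable])
    (p := p) (by simp [hp, Fin.sum_univ_three]; ring) (fun i _ => (hpp i).le)
  simp only [Fin.prod_univ_three] at hH
  have e0 : p 0 = 1 / 2 := rfl
  have e1 : p 1 = s / 2 := rfl
  have e2 : p 2 = (1 - s) / 2 := rfl
  have f0 : f 0 = energy θ m s n := rfl
  have f1 : f 1 = limTotal := rfl
  have f2 : f 2 = S.indicator 1 := rfl
  rw [e0, e1, e2, f0, f1, f2, lintegral_indicator_one hS] at hH
  calc ∫⁻ v in S, tiltedSum θ m s n v ∂law lam
      = ∫⁻ v, S.indicator (tiltedSum θ m s n) v ∂law lam := (lintegral_indicator hS _).symm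
    _ ≤ _ := lintegral_mono_ae ?_
    _ ≤ _ := hH
    _ ≤ (∫⁻ v, energy θ m s n v ∂law lam) ^ (1 / 2 : ℝ) * 1 * law lam S ^ ((1 - s) / 2) := by
        gcongr
        exact ENNReal.rpow_le_one (lintegral_limTotal_le lam hmean) (by linarith)
    _ = _ := by rw [mul_one]
  filter_upwards [hlim, hfin] with v hv0 hvt
  by_cases hv : v ∈ S
  · rw [Set.indicator_of_mem hv, Set.indicator_of_mem hv, Pi.one_apply, ENNReal.one_rpow, mul_one]
    calc tiltedSum θ m s n v = (tiltedSum θ m s n v ^ 2) ^ (1 / 2 : ℝ) := by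
          rw [← ENNReal.rpow_natCast, ← ENNReal.rpow_mul]; norm_num
      _ ≤ (energy θ m s n v * limTotal v ^ s) ^ (1 / 2 : ℝ) :=
          ENNReal.rpow_le_rpow (tiltedSum_sq_le hs hv0.ne' hvt.ne n) (by norm_num)
      _ = energy θ m s n v ^ (1 / 2 : ℝ) * limTotal v ^ (s / 2) := by
          rw [ENNReal.mul_rpow_of_nonneg _ _ (by norm_num), ← ENNReal.rpow_mul]
          congr 2; ring
  · rw [Set.indicator_of_notMem hv]
    exact zero_le

end Weights

end Cascade

namespace Cascade

namespace Weights

/-! ### The energy is controlled with positive probability -/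

/-- The weights for which the energy is infinitely often comparable to the squared mass. -/
def goodSet (θ : List Bool → ℝ≥0) (m : ℝ≥0) (s : ℝ) : Set Weights :=
  {v | ∃ k : ℕ, ∃ᶠ n in atTop, energy θ m s n v ≤ k * tiltedSum θ m s n v ^ 2}

variable {lam : Measure ℝ≥0} [IsProbabilityMeasure lam] {θ : List Bool → ℝ≥0} {m : ℝ≥0} {s : ℝ}

theorem goodSet_eq : goodSet θ m s =
    ⋃ k : ℕ, ⋂ N : ℕ, ⋃ n ≥ N, {v | energy θ m s n v ≤ k * tiltedSum θ m s n v ^ 2} := by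
  ext v
  simp [goodSet, frequently_atTop]

theorem measurableSet_goodSet : MeasurableSet (goodSet θ m s) := by
  rw [goodSet_eq]
  refine .iUnion fun k => .iInter fun N => .iUnion fun n => .iUnion fun _ => ?_
  exact measurableSet_le (measurable_energy n) (by fun_prop)

/-- Let N be the tilted sum, with mean θ[] = 4c. The part with N < c contributes at most c. By
Markov the energy reaches kc² only with small probability if k is large, so by uniform integrability
that part contributes less than c. If the event {energy ≤ kN²} were also unlikely, the total would
be at most 3c. So its probability is at least a fixed ε at every level, and the limsup of these
events inherits this. -/
theorem measure_goodSet_pos (hpos : ∀ᵐ a ∂lam, 0 < a) (hs : 0 < s) (hs1 : s < 1) (hm0 : m ≠ 0)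
    (hm : ∫⁻ a, (a : ℝ≥0∞) ^ s ∂lam = m) (hmean : ∫⁻ a, (a : ℝ≥0∞) ∂lam = 1)
    (hlim : ∀ᵐ v ∂law lam, 0 < limTotal v) (hθ : IsFlow θ) (hθ0 : θ [] ≠ 0) {C : ℝ≥0∞}
    (hCt : C ≠ ∞) (hC : ∀ n, ∫⁻ v, energy θ m s n v ∂law lam ≤ C) :
    0 < law lam (goodSet θ m s) := by
  have hp : 0 < (1 - s) / 2 := by linarith
  have hset (n : ℕ) {S : Set Weights} (hS : MeasurableSet S) :
      ∫⁻ v in S, tiltedSum θ m s n v ∂law lam ≤ C ^ (1 / 2 : ℝ) * law lam S ^ ((1 - s) / 2) :=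
    (setLIntegral_tiltedSum_le hs hs1 hmean hlim n hS).trans
      (mul_le_mul_left (ENNReal.rpow_le_rpow (hC n) (by norm_num)) _)
  set c : ℝ≥0∞ := θ [] / 4 with hc
  have hθt : (θ [] : ℝ≥0∞) ≠ 0 := by simpa using hθ0
  have hc0 : c ≠ 0 := by simp [hc, hθ0]
  have hct : c ≠ ∞ := ENNReal.div_ne_top ENNReal.coe_ne_top (by simp)
  have hlim0 : Tendsto (fun q : ℝ≥0∞ => C ^ (1 / 2 : ℝ) * q ^ ((1 - s) / 2)) (𝓝 0) (𝓝 0) := by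
    have h1 : Tendsto (fun q : ℝ≥0∞ => q ^ ((1 - s) / 2)) (𝓝 0) (𝓝 0) := by
      have := (ENNReal.continuous_rpow_const (y := (1 - s) / 2)).tendsto 0
      rwa [ENNReal.zero_rpow_of_pos hp] at this
    have h2 := ENNReal.Tendsto.const_mul (a := C ^ (1 / 2 : ℝ)) h1
      (Or.inr (ENNReal.rpow_ne_top_of_nonneg (by norm_num) hCt))
    rwa [mul_zero] at h2
  obtain ⟨ε, hε0, hε⟩ : ∃ ε : ℝ≥0∞, 0 < ε ∧
      ∀ q ≤ ε, C ^ (1 / 2 : ℝ) * q ^ ((1 - s) / 2) < c := by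
    obtain ⟨ε, hε0, hε⟩ := ENNReal.nhds_zero_basis_Iic.mem_iff.1
      (hlim0 (Iio_mem_nhds (pos_iff_ne_zero.2 hc0)))
    exact ⟨ε, hε0, fun q hq => hε hq⟩
  obtain ⟨k, hk⟩ : ∃ k : ℕ, C / (k * c ^ 2) ≤ ε := by
    obtain ⟨k, hk⟩ := ENNReal.exists_nat_gt (r := C / (ε * c ^ 2))
      (ENNReal.div_ne_top hCt (mul_ne_zero hε0.ne' (pow_ne_zero _ hc0)))
    refine ⟨k, ?_⟩
    have hc2 : c ^ 2 ≠ 0 := pow_ne_zero _ hc0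
    have hc2t : c ^ 2 ≠ ∞ := ENNReal.pow_ne_top hct
    have hk0 : (k : ℝ≥0∞) ≠ 0 := fun h => by rw [h] at hk; exact not_lt_zero hk
    refine ENNReal.div_le_of_le_mul ?_
    rcases eq_or_ne ε ∞ with hεt | hεt
    · rw [hεt, ENNReal.top_mul (mul_ne_zero hk0 hc2)]; exact le_top
    · have := (ENNReal.div_le_iff (mul_ne_zero hε0.ne' hc2) (ENNReal.mul_ne_top hεt hc2t)).1 hk.le
      refine this.trans_eq (by ring)
  set A : ℕ → Set Weights := fun n => {v | energy θ m s n v ≤ k * tiltedSum θ m s n v ^ 2} with hA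
  have hAm (n : ℕ) : MeasurableSet (A n) := measurableSet_le (measurable_energy n) (by fun_prop)
  -- Off `A n` and off `D`, kN² < energy < kc², so the tilted sum is below c.
  have hAε (n : ℕ) : ε ≤ law lam (A n) := by
    by_contra! hlt
    set D : Set Weights := {v | k * c ^ 2 ≤ energy θ m s n v} with hD
    have hDm : MeasurableSet D := measurableSet_le measurable_const (measurable_energy n)
    have hDε : law lam D ≤ ε := by
      refine le_trans ?_ hk
      by_cases hk0 : (k : ℝ≥0∞) = 0
      · rcases eq_or_ne C 0 with rfl | hC0
        · exfalso
          have h1 := hset n MeasurableSet.univ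
          rw [setLIntegral_univ, lintegral_tiltedSum hpos hs hm0 hm hθ,
            ENNReal.zero_rpow_of_pos (by norm_num), zero_mul, nonpos_iff_eq_zero] at h1
          exact hθt h1
        · simp [hk0, ENNReal.div_zero hC0]
      · refine (meas_ge_le_lintegral_div (measurable_energy n).aemeasurable
          (mul_ne_zero hk0 (pow_ne_zero _ hc0))
          (ENNReal.mul_ne_top (by simp) (ENNReal.pow_ne_top hct))).trans ?_
        gcongr
        exact hC n
    have h1 : (θ [] : ℝ≥0∞) ≤ c + (∫⁻ v in A n, tiltedSum θ m s n v ∂law lam +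
        ∫⁻ v in D, tiltedSum θ m s n v ∂law lam) := by
      rw [← lintegral_tiltedSum hpos hs hm0 hm hθ n, ← lintegral_indicator (hAm n),
        ← lintegral_indicator hDm]
      calc ∫⁻ v, tiltedSum θ m s n v ∂law lam ≤ ∫⁻ v, (c + ((A n).indicator (tiltedSum θ m s n) v +
            D.indicator (tiltedSum θ m s n) v)) ∂law lam := lintegral_mono fun v => by
            by_cases hvA : v ∈ A n
            · rw [Set.indicator_of_mem hvA]
              exact le_self_add.trans le_add_self
            by_cases hvD : v ∈ D
            · rw [Set.indicator_of_mem hvD]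
              exact le_add_self.trans le_add_self
            have h2 : k * tiltedSum θ m s n v ^ 2 < k * c ^ 2 :=
              (not_le.1 hvA).trans (not_le.1 hvD)
            have h3 : tiltedSum θ m s n v < c := by
              by_contra! h
              exact absurd h2 (not_lt.2 (by gcongr))
            exact h3.le.trans le_self_add
        _ = _ := by
            rw [lintegral_add_left measurable_const,
              lintegral_add_left ((measurable_tiltedSum n).indicator (hAm n)), lintegral_const,
              measure_univ, mul_one]
    have h2 : (θ [] : ℝ≥0∞) ≤ c + (c + c) := by
      refine h1.trans ?_
      gcongr
      · exact (hset n (hAm n)).trans (hε _ hlt.le).le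
      · exact (hset n hDm).trans (hε _ hDε).le
    have h3 : (θ [] : ℝ≥0∞) = c + (c + c) + c := by
      rw [hc]
      calc (θ [] : ℝ≥0∞) = 4 * (θ [] / 4) := (ENNReal.mul_div_cancel (by simp) (by simp)).symm
        _ = _ := by ring
    have h4 : c + (c + c) ≠ ∞ := by simp [hct]
    rw [h3] at h2
    exact hc0 (by simpa using (ENNReal.add_le_add_iff_left h4 (b := c) (c := 0)).1 (by simpa using h2))
  have hanti : Antitone fun N : ℕ => ⋃ n ≥ N, A n := fun M N h =>
    Set.iUnion₂_mono' fun n hn => ⟨n, le_trans h hn, le_rfl⟩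
  have hmeas : ε ≤ law lam (⋂ N : ℕ, ⋃ n ≥ N, A n) := by
    have h1 := tendsto_measure_iInter_atTop (μ := law lam) (s := fun N : ℕ => ⋃ n ≥ N, A n)
      (fun N => (MeasurableSet.iUnion fun n => .iUnion fun _ => hAm n).nullMeasurableSet) hanti
      ⟨0, measure_ne_top _ _⟩
    refine ge_of_tendsto' h1 fun N => (hAε N).trans (measure_mono ?_)
    exact Set.subset_iUnion₂ (s := fun n (_ : n ≥ N) => A n) N le_rfl
  refine hε0.trans_le (hmeas.trans (measure_mono ?_))
  rw [goodSet_eq]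
  exact Set.subset_iUnion (fun k : ℕ => ⋂ N : ℕ, ⋃ n ≥ N,
    {v | energy θ m s n v ≤ k * tiltedSum θ m s n v ^ 2}) k

/-! ### Changing finitely many weights -/

/-- Total masses are positive combinations of path products, so a termwise comparison carries over.
The scalars `a` and `b` collect the weights already passed in the descent. -/
theorem mul_total_le {c : ℝ≥0} {u w : Weights} {a b : ℝ≥0}
    (h : ∀ x, a * pathProd u x ≤ c * (b * pathProd w x)) (n : ℕ) :
    a * total n u ≤ c * (b * total n w) := by
  induction n generalizing a b u w with
  | zero => simpa [pathProd, total] using h []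
  | succ n ih =>
    have hb (β : Bool) : a * u [] * total n (child β u) ≤ c * (b * w [] * total n (child β w)) :=
      ih fun x => by simpa only [pathProd, mul_assoc] using h (β :: x)
    calc a * total (n + 1) u = 2⁻¹ * (a * u [] * total n (child false u) +
          a * u [] * total n (child true u)) := by simp only [total]; ring
      _ ≤ 2⁻¹ * (c * (b * w [] * total n (child false w)) +
          c * (b * w [] * total n (child true w))) :=
        mul_le_mul_right (add_le_add (hb false) (hb true)) _
      _ = _ := by simp only [total]; ring

theorem mul_limTotal (a : ℝ≥0) (v : Weights) :
    (a : ℝ≥0∞) * limTotal v = liminf (fun n => ((a * total n v : ℝ≥0) : ℝ≥0∞)) atTop := by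
  have h := (ENNReal.continuous_const_mul (a := (a : ℝ≥0∞)) ENNReal.coe_ne_top).continuousAt
    (x := limTotal v)
  have := (show Monotone fun x : ℝ≥0∞ => (a : ℝ≥0∞) * x from
    fun x y hxy => mul_le_mul_right hxy _).map_liminf_of_continuousAt (F := atTop)
      (fun n => (total n v : ℝ≥0∞)) h
  simpa [Function.comp_def, limTotal] using this

theorem mul_mass_le {c : ℝ≥0} {u w : Weights} {a b : ℝ≥0}
    (h : ∀ x, a * pathProd u x ≤ c * (b * pathProd w x)) (x : List Bool) :
    a * mass u x ≤ c * (b * mass w x) := by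
  induction x generalizing a b u w with
  | nil =>
    rw [mass, mass, ← mul_assoc, ← ENNReal.coe_mul, mul_limTotal, mul_limTotal]
    refine liminf_le_liminf (.of_forall fun n => ?_)
    rw [mul_assoc]
    exact_mod_cast mul_total_le h n
  | cons β x ih =>
    have h' : (a * u [] : ℝ≥0) * mass (child β u) x ≤ c * ((b * w [] : ℝ≥0) * mass (child β w) x) :=
      ih fun y => by simpa only [pathProd, mul_assoc] using h (β :: y)
    calc (a : ℝ≥0∞) * mass u (β :: x) = (2⁻¹ : ℝ≥0) * ((a * u [] : ℝ≥0) * mass (child β u) x) := by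
          rw [mass, ENNReal.coe_mul, ENNReal.coe_mul]; ring
      _ ≤ (2⁻¹ : ℝ≥0) * (c * ((b * w [] : ℝ≥0) * mass (child β w) x)) := by gcongr
      _ = _ := by rw [mass, ENNReal.coe_mul, ENNReal.coe_mul]; ring

theorem exists_pathProd_le {u w : Weights} (hw : ∀ x, w x ≠ 0) (L : ℕ)
    (h : ∀ x, L ≤ x.length → u x = w x) : ∃ c : ℝ≥0, ∀ x, pathProd u x ≤ c * pathProd w x := by
  induction L generalizing u w with
  | zero =>
    obtain rfl : u = w := funext fun x => h x (Nat.zero_le _)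
    exact ⟨1, fun x => by simp⟩
  | succ L ih =>
    have hb (β : Bool) : ∃ c : ℝ≥0, ∀ x, pathProd (child β u) x ≤ c * pathProd (child β w) x :=
      ih (fun x => hw _) fun x hx => h _ (by simpa using hx)
    obtain ⟨c₀, h₀⟩ := hb false
    obtain ⟨c₁, h₁⟩ := hb true
    refine ⟨1 + u [] / w [] * (c₀ + c₁), fun x => ?_⟩
    rcases x with - | ⟨β, x⟩
    · simp [pathProd]
    · have hc : pathProd (child β u) x ≤ (c₀ + c₁) * pathProd (child β w) x := by
        cases β
        · exact (h₀ x).trans (by gcongr; exact le_self_add)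
        · exact (h₁ x).trans (by gcongr; exact le_add_self)
      calc pathProd u (β :: x) ≤ u [] * ((c₀ + c₁) * pathProd (child β w) x) := by
            rw [pathProd]; gcongr
        _ = u [] / w [] * (c₀ + c₁) * pathProd w (β :: x) := by
            rw [pathProd]; field_simp [hw []]
        _ ≤ _ := by gcongr; exact le_add_self

/-- Comparable path products change tilted weights and (-s)-th powers of masses by at most B = c^s.
The energy costs three factors (two tilted weights, one kernel) and the squared tilted sum two,
hence B^5 in the new constant. -/
theorem mem_goodSet_of_le (hs : 0 < s) {u w : Weights} {c : ℝ≥0}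
    (h₁ : ∀ x, pathProd u x ≤ c * pathProd w x) (h₂ : ∀ x, pathProd w x ≤ c * pathProd u x)
    (hw : w ∈ goodSet θ m s) : u ∈ goodSet θ m s := by
  have hc0 : c ≠ 0 := by
    rintro rfl
    simpa [pathProd] using h₁ []
  have hcE : (c : ℝ≥0∞) ≠ 0 := by simpa using hc0
  set B : ℝ≥0∞ := (c : ℝ≥0∞) ^ s with hB
  have hBt : B ≠ ∞ := ENNReal.rpow_ne_top_of_nonneg hs.le ENNReal.coe_ne_top
  have hX {u w : Weights} (h : ∀ x, pathProd u x ≤ c * pathProd w x) (x : List Bool) :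
      tilted θ m s u x ≤ B * tilted θ m s w x := by
    calc tilted θ m s u x
        ≤ θ x * (m : ℝ≥0∞)⁻¹ ^ x.length * ((c * pathProd w x : ℝ≥0) : ℝ≥0∞) ^ s := by
          unfold tilted
          gcongr
          exact h x
      _ = _ := by rw [mul_rpow_coe _ _ hs, tilted]; ring
  have hM (x : List Bool) : mass u x ^ (-s) ≤ B * mass w x ^ (-s) := by
    have h3 : mass w x ≤ c * mass u x := by
      simpa using mul_mass_le (a := 1) (b := 1) (c := c) (u := w) (w := u) (by simpa using h₂) x
    have h4 : B * (c * mass u x) ^ (-s) = mass u x ^ (-s) := by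
      rw [ENNReal.mul_rpow_of_ne_zero_of_ne_top hcE ENNReal.coe_ne_top, ← mul_assoc, hB,
        ← ENNReal.rpow_add _ _ hcE ENNReal.coe_ne_top, add_neg_cancel, ENNReal.rpow_zero, one_mul]
    rw [← h4, ENNReal.rpow_neg, ENNReal.rpow_neg]
    gcongr
  have hN (n : ℕ) : tiltedSum θ m s n w ≤ B * tiltedSum θ m s n u := by
    unfold tiltedSum
    rw [Finset.mul_sum]
    exact Finset.sum_le_sum fun x _ => hX h₂ x
  have hE (n : ℕ) : energy θ m s n u ≤ B ^ 3 * energy θ m s n w := by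
    unfold energy
    simp only [Finset.mul_sum]
    refine Finset.sum_le_sum fun x _ => Finset.sum_le_sum fun y _ => ?_
    calc _ ≤ B * tilted θ m s w x * (B * tilted θ m s w y) * (B * mass w (sep x y) ^ (-s)) :=
          mul_le_mul' (mul_le_mul' (hX h₁ x) (hX h₁ y)) (hM _)
      _ = _ := by ring
  obtain ⟨k, hk⟩ := hw
  obtain ⟨k', hk'⟩ := ENNReal.exists_nat_gt (r := B ^ 5 * k)
    (ENNReal.mul_ne_top (ENNReal.pow_ne_top hBt) (by simp))
  refine ⟨k', hk.mono fun n hn => ?_⟩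
  calc energy θ m s n u ≤ B ^ 3 * energy θ m s n w := hE n
    _ ≤ B ^ 3 * (k * (B * tiltedSum θ m s n u) ^ 2) := by
        gcongr
        exact hn.trans (by gcongr; exact hN n)
    _ = B ^ 5 * k * tiltedSum θ m s n u ^ 2 := by ring
    _ ≤ _ := by gcongr

/-- Replace vanishing weights by `1`. -/
def posPart (v : Weights) : Weights := fun x => if v x = 0 then 1 else v x

/-- Replace the weights at the levels below `n` by `1`. -/
def tail (n : ℕ) (v : Weights) : Weights := fun x => if x.length < n then 1 else v x

theorem posPart_ne_zero (v : Weights) (x : List Bool) : posPart v x ≠ 0 := by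
  unfold posPart
  split_ifs with h
  exacts [one_ne_zero, h]

theorem measurable_posPart : Measurable posPart :=
  measurable_pi_lambda _ fun x => Measurable.ite
    (measurableSet_eq_fun (measurable_pi_apply x) measurable_const) measurable_const
    (measurable_pi_apply x)

theorem posPart_eq {v : Weights} (h : ∀ x, 0 < v x) : posPart v = v :=
  funext fun x => if_neg (h x).ne'

/-- Changing the weights of finitely many levels alters path products by bounded factors, provided
no weight is 0. `posPart` ensures this everywhere, so the event is exactly, and not just almost
surely, invariant. -/
theorem preimage_tail_goodSet (hs : 0 < s) (L : ℕ) :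
    tail L ⁻¹' (posPart ⁻¹' goodSet θ m s) = posPart ⁻¹' goodSet θ m s := by
  have hagree (v : Weights) (x : List Bool) (hx : L ≤ x.length) :
      posPart (tail L v) x = posPart v x := by
    simp [posPart, tail, not_lt.2 hx]
  refine Set.ext fun v => ?_
  change posPart (tail L v) ∈ goodSet θ m s ↔ posPart v ∈ goodSet θ m s
  obtain ⟨c₁, h₁⟩ := exists_pathProd_le (posPart_ne_zero v) L (hagree v)
  obtain ⟨c₂, h₂⟩ := exists_pathProd_le (posPart_ne_zero (tail L v)) L
    fun x hx => (hagree v x hx).symm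
  have h₁' (x) : pathProd (posPart (tail L v)) x ≤ (c₁ + c₂) * pathProd (posPart v) x :=
    (h₁ x).trans (by gcongr; exact le_self_add)
  have h₂' (x) : pathProd (posPart v) x ≤ (c₁ + c₂) * pathProd (posPart (tail L v)) x :=
    (h₂ x).trans (by gcongr; exact le_add_self)
  exact ⟨mem_goodSet_of_le hs h₂' h₁', mem_goodSet_of_le hs h₁' h₂'⟩

/-- A zero-one law for events which do not depend on finitely many levels. -/
theorem measure_eq_zero_or_one_of_preimage_tail {S : Set Weights} (hS : MeasurableSet S)
    (h : ∀ L, tail L ⁻¹' S = S) : law lam S = 0 ∨ law lam S = 1 := by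
  have hind : iIndep (fun x : List Bool => MeasurableSpace.comap
      (fun v : Weights => v x) inferInstance) (law lam) :=
    iIndepFun_infinitePi (P := fun _ : List Bool => lam) (X := fun _ => id) fun _ => measurable_id
  -- Kolmogorov's law along the filter on words whose length tends to infinity; its limsup σ-algebra
  -- is the tail over the levels of the tree.
  refine measure_zero_or_one_of_measurableSet_limsup (f := comap List.length atTop)
    (p := fun t => ∃ L, t = {x : List Bool | x.length < L})
    (ns := fun L : ℕ => {x : List Bool | x.length < L})
    (fun x => (measurable_pi_apply x).comap_le) hind ?_ ?_ (fun L => ⟨L, rfl⟩)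
    (fun x => ⟨x.length + 1, Nat.lt_succ_self _⟩) ?_
  · rintro _ ⟨L, rfl⟩
    exact ⟨Set.Ici L, Ici_mem_atTop L, fun x (hx : L ≤ x.length) (hx' : x.length < L) => by omega⟩
  · exact directed_of_isDirected_le fun L M h x hx => lt_of_lt_of_le hx h
  · rw [limsup_eq_iInf_iSup, MeasurableSpace.measurableSet_iInf]
    intro t
    rw [MeasurableSpace.measurableSet_iInf]
    intro ht
    obtain ⟨t', ht', hsub⟩ := mem_comap.1 ht
    obtain ⟨L, hL⟩ := mem_atTop_sets.1 ht'
    -- By invariance `S` is its own preimage under `tail L`, a map that reads only the weights at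
    -- levels at least `L`.
    rw [← h L]
    have hT : @Measurable _ _ (⨆ x ∈ t, MeasurableSpace.comap (fun v : Weights => v x) inferInstance)
        MeasurableSpace.pi (tail L) := by
      refine @measurable_pi_lambda _ _ _ (_) _ _ fun x => ?_
      by_cases hx : x.length < L
      · simp only [tail, hx, if_true]
        exact @measurable_const _ _ _ (_) _
      · simp only [tail, hx, if_false]
        refine (comap_measurable _).mono ?_ le_rfl
        exact le_iSup₂_of_le x (hsub (hL _ (not_lt.1 hx))) le_rfl
    exact hT hS

/-- Almost surely, the energy is infinitely often comparable to the squared mass. -/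
theorem ae_mem_goodSet (hpos : ∀ᵐ a ∂lam, 0 < a) (hs : 0 < s) (hs1 : s < 1) (hm0 : m ≠ 0)
    (hm : ∫⁻ a, (a : ℝ≥0∞) ^ s ∂lam = m) (hmean : ∫⁻ a, (a : ℝ≥0∞) ∂lam = 1)
    (hlim : ∀ᵐ v ∂law lam, 0 < limTotal v) (hθ : IsFlow θ) (hθ0 : θ [] ≠ 0) {C : ℝ≥0∞}
    (hCt : C ≠ ∞) (hC : ∀ n, ∫⁻ v, energy θ m s n v ∂law lam ≤ C) :
    ∀ᵐ v ∂law lam, v ∈ goodSet θ m s := by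
  have h := measure_goodSet_pos hpos hs hs1 hm0 hm hmean hlim hθ hθ0 hCt hC
  have hae : ∀ᵐ v ∂law lam, posPart v = v := by
    filter_upwards [ae_apply lam hpos] with v hv using posPart_eq hv
  have hmeas : MeasurableSet (posPart ⁻¹' goodSet θ m s) := measurable_posPart measurableSet_goodSet
  have heq : (posPart ⁻¹' goodSet θ m s : Set Weights) =ᵐ[law lam] goodSet θ m s := by
    filter_upwards [hae] with v hv
    exact congrArg (· ∈ goodSet θ m s) hv
  rcases measure_eq_zero_or_one_of_preimage_tail (lam := lam) hmeas
    (preimage_tail_goodSet hs) with h0 | h1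
  · rw [measure_congr heq] at h0
    exact absurd h0 h.ne'
  · rw [measure_congr heq] at h1
    exact (prob_compl_eq_zero_iff measurableSet_goodSet).2 h1

end Weights

end Cascade

namespace Cascade

/-! ### Words and dyadic intervals -/

/-- The number of the dyadic interval of a word. -/
def wordIndex : List Bool → ℕ
  | [] => 0
  | b :: x => b.toNat * 2 ^ x.length + wordIndex x

theorem wordIndex_lt (x : List Bool) : wordIndex x < 2 ^ x.length := by
  induction x with
  | nil => simp [wordIndex]
  | cons b x ih =>
    rw [wordIndex, List.length_cons, pow_succ]
    have : b.toNat ≤ 1 := Bool.toNat_le b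
    nlinarith

/-- The dyadic interval of a word. -/
def toDyadic (x : List Bool) : Dyadic := ⟨x.length, ⟨wordIndex x, wordIndex_lt x⟩⟩

theorem dyadic_ext_iff {I J : Dyadic} : I = J ↔ I.1 = J.1 ∧ (I.2 : ℕ) = J.2 := by
  refine ⟨fun h => h ▸ ⟨rfl, rfl⟩, fun ⟨h1, h2⟩ => ?_⟩
  obtain ⟨n, i⟩ := I
  obtain ⟨n', i'⟩ := J
  dsimp only at h1 h2
  subst h1
  obtain rfl : i = i' := Fin.ext h2
  rfl

theorem toDyadic_injective : Function.Injective toDyadic := by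
  intro x y h
  obtain ⟨h1, h2⟩ := dyadic_ext_iff.1 h
  dsimp only [toDyadic] at h1 h2
  induction x generalizing y with
  | nil => exact (List.length_eq_zero_iff.1 h1.symm).symm
  | cons b x ih =>
    rcases y with - | ⟨c, y⟩
    · simp at h1
    have h3 : x.length = y.length := by simpa using h1
    have hx := wordIndex_lt x
    have hy := wordIndex_lt y
    rw [wordIndex, wordIndex, h3] at h2
    rw [h3] at hx
    have hbc : b = c := by
      rcases b with - | - <;> rcases c with - | - <;> simp at h2 ⊢ <;> omega
    subst hbc
    have h4 : wordIndex x = wordIndex y := by omega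
    rw [ih (dyadic_ext_iff.2 ⟨h3, h4⟩) h3 h4]

/-- The word of length `n` of the dyadic interval that contains `x`. -/
def wordAt : ℕ → ℝ → List Bool
  | 0, _ => []
  | n + 1, x => if x ≤ 1 / 2 then false :: wordAt n (2 * x) else true :: wordAt n (2 * x - 1)

@[simp] theorem length_wordAt (n : ℕ) (x : ℝ) : (wordAt n x).length = n := by
  induction n generalizing x with
  | zero => rfl
  | succ n ih => rw [wordAt]; split_ifs <;> simp [ih]

/-- Sending a midpoint to the left half is the convention behind ⌈2ⁿx⌉ - 1. In the right half the
ceiling is positive, so the truncated subtraction commutes with adding 2ⁿ. -/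
theorem wordIndex_wordAt (n : ℕ) {x : ℝ} (h0 : 0 ≤ x) (h1 : x ≤ 1) :
    wordIndex (wordAt n x) = min (⌈x * 2 ^ n⌉₊ - 1) (2 ^ n - 1) := by
  induction n generalizing x with
  | zero => simp [wordAt, wordIndex]
  | succ n ih =>
    have hpow : 2 ^ (n + 1) = 2 * 2 ^ n := pow_succ' 2 n
    have hpos : 0 < 2 ^ n := by positivity
    rw [wordAt]
    split_ifs with h
    · have hle : ⌈x * 2 ^ (n + 1)⌉₊ ≤ 2 ^ n := by
        rw [Nat.ceil_le, pow_succ]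
        push_cast
        have : (0 : ℝ) < 2 ^ n := by positivity
        nlinarith
      rw [wordIndex, ih (by linarith) (by linarith), show 2 * x * 2 ^ n = x * 2 ^ (n + 1) by ring]
      simp only [Bool.toNat_false, zero_mul, zero_add]
      omega
    · have hx : 1 / 2 < x := not_le.1 h
      have hpos' : (0 : ℝ) < 2 ^ n := by positivity
      have hceil : ⌈x * 2 ^ (n + 1)⌉₊ = ⌈(2 * x - 1) * 2 ^ n⌉₊ + 2 ^ n := by
        rw [show x * 2 ^ (n + 1) = (2 * x - 1) * 2 ^ n + ((2 ^ n : ℕ) : ℝ) by push_cast; ring]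
        exact Nat.ceil_add_natCast (by nlinarith) _
      have hle : ⌈(2 * x - 1) * 2 ^ n⌉₊ ≤ 2 ^ n := by
        rw [Nat.ceil_le]; push_cast; nlinarith
      have hge : 0 < ⌈(2 * x - 1) * 2 ^ n⌉₊ := Nat.ceil_pos.2 (by nlinarith)
      rw [wordIndex, ih (by linarith) (by linarith), hceil, length_wordAt]
      simp only [Bool.toNat_true, one_mul]
      omega

theorem dyadicAt_eq (n : ℕ) {x : ℝ} (h0 : 0 ≤ x) (h1 : x ≤ 1) :
    dyadicAt n x = toDyadic (wordAt n x) :=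
  dyadic_ext_iff.2 ⟨(length_wordAt n x).symm, (wordIndex_wordAt n h0 h1).symm⟩

theorem wordAt_succ_half (n : ℕ) {y : ℝ} (hy : y ≤ 1) :
    wordAt (n + 1) (y / 2) = false :: wordAt n y := by
  rw [wordAt, if_pos (by linarith), mul_div_cancel₀ y two_ne_zero]

theorem wordAt_succ_half_add (n : ℕ) {y : ℝ} (hy : 0 < y) :
    wordAt (n + 1) ((y + 1) / 2) = true :: wordAt n y := by
  rw [wordAt, if_neg (by linarith), mul_div_cancel₀ (y + 1) two_ne_zero, add_sub_cancel_right]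

/-- The left end of the interval of a word. -/
def left : List Bool → ℝ
  | [] => 0
  | false :: x => left x / 2
  | true :: x => (left x + 1) / 2

/-- The closed dyadic interval of a word. -/
def cellIcc (x : List Bool) : Set ℝ := Set.Icc (left x) (left x + 2⁻¹ ^ x.length)

theorem left_nonneg (x : List Bool) : 0 ≤ left x := by
  induction x with
  | nil => exact le_rfl
  | cons b x ih => cases b <;> simp only [left] <;> linarith

theorem left_add_le_one (x : List Bool) : left x + 2⁻¹ ^ x.length ≤ 1 := by
  induction x with
  | nil => simp [left]
  | cons b x ih => cases b <;> simp only [left, List.length_cons, pow_succ] <;> linarith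

theorem cellIcc_subset (x : List Bool) : cellIcc x ⊆ Set.Icc 0 1 :=
  Set.Icc_subset_Icc (left_nonneg x) (left_add_le_one x)

theorem half_mem_cellIcc {x : List Bool} {y : ℝ} (hy : y ∈ cellIcc x) :
    y / 2 ∈ cellIcc (false :: x) := by
  simp only [cellIcc, Set.mem_Icc, left, List.length_cons, pow_succ] at hy ⊢
  constructor <;> linarith

theorem half_add_mem_cellIcc {x : List Bool} {y : ℝ} (hy : y ∈ cellIcc x) :
    (y + 1) / 2 ∈ cellIcc (true :: x) := by
  simp only [cellIcc, Set.mem_Icc, left, List.length_cons, pow_succ] at hy ⊢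
  constructor <;> linarith

namespace Weights

/-! ### The approximating measures -/

theorem measurable_comp_wordAt {α : Type*} [MeasurableSpace α] (f : List Bool → α) (n : ℕ) :
    Measurable fun x => f (wordAt n x) := by
  induction n generalizing f with
  | zero =>
    simp only [wordAt]
    exact measurable_const
  | succ n ih =>
    have h : (fun x => f (wordAt (n + 1) x)) = fun x : ℝ => if x ≤ 1 / 2 then
        f (false :: wordAt n (2 * x)) else f (true :: wordAt n (2 * x - 1)) := by
      ext x; rw [wordAt]; split_ifs <;> rfl
    rw [h]
    exact Measurable.ite measurableSet_Iic
      ((ih fun w => f (false :: w)).comp (measurable_const_mul 2))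
      ((ih fun w => f (true :: w)).comp ((measurable_const_mul 2).sub_const 1))

/-- The `n`-th approximation of the cascade measure. -/
def approx (n : ℕ) (v : Weights) : Measure ℝ :=
  (volume.restrict (Set.Icc (0 : ℝ) 1)).withDensity fun x => (pathProd v (wordAt n x) : ℝ≥0∞)

theorem density_eq_pathProd {V : Dyadic → ℝ} {v : Weights} (h : ∀ x, V (toDyadic x) = v x) (n : ℕ)
    {x : ℝ} (h0 : 0 ≤ x) (h1 : x ≤ 1) : density V n x = pathProd v (wordAt n x) := by
  have key (n : ℕ) (v : Weights) (x : ℝ) :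
      ∏ j ∈ Finset.range n, (v (wordAt j x) : ℝ) = pathProd v (wordAt n x) := by
    induction n generalizing v x with
    | zero => simp [wordAt, pathProd]
    | succ n ih =>
      rw [Finset.prod_range_succ']
      by_cases hx : x ≤ 1 / 2
      · simp only [wordAt, hx, if_true, pathProd, NNReal.coe_mul]
        rw [← ih (child false v) (2 * x), mul_comm]
        rfl
      · simp only [wordAt, hx, if_false, pathProd, NNReal.coe_mul]
        rw [← ih (child true v) (2 * x - 1), mul_comm]
        rfl
  rw [density, ← key]
  refine Finset.prod_congr rfl fun j _ => ?_
  rw [dyadicAt_eq j h0 h1, h]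

theorem approxMeasure_eq {V : Dyadic → ℝ} {v : Weights} (h : ∀ x, V (toDyadic x) = v x) (n : ℕ) :
    (approxMeasure V n : Measure ℝ) = approx n v := by
  change (volume.restrict (Set.Icc (0 : ℝ) 1)).withDensity _ = _
  refine withDensity_congr_ae ?_
  filter_upwards [ae_restrict_mem measurableSet_Icc] with x hx
  rw [density_eq_pathProd h n hx.1 hx.2, ENNReal.ofReal_coe_nnreal]

theorem lintegral_half (F : ℝ → ℝ≥0∞) (hF : Measurable F) (b : ℝ) :
    ∫⁻ x, F x = 2⁻¹ * ∫⁻ y, F ((y + b) / 2) := by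
  have h := Real.smul_map_volume_mul_left (a := 2⁻¹) (by norm_num)
  calc ∫⁻ x, F x = ∫⁻ x, F x ∂(ENNReal.ofReal |(2⁻¹ : ℝ)| • Measure.map (2⁻¹ * ·) volume) := by rw [h]
    _ = 2⁻¹ * ∫⁻ y, F (2⁻¹ * y) := by
        rw [lintegral_smul_measure, lintegral_map hF (measurable_const_mul _),
          abs_of_pos (by norm_num), ENNReal.ofReal_inv_of_pos (by norm_num)]
        simp
    _ = 2⁻¹ * ∫⁻ y, F ((y + b) / 2) := by
        rw [← lintegral_add_right_eq_self (fun y => F (2⁻¹ * y)) b]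
        simp only [div_eq_inv_mul]

/-- The second integral is over a half-open interval because the midpoint belongs to the left half,
as in `wordAt`. -/
theorem setLIntegral_Icc_eq (F : ℝ → ℝ≥0∞) (hF : Measurable F) :
    ∫⁻ x in Set.Icc (0 : ℝ) 1, F x = 2⁻¹ * (∫⁻ y in Set.Icc (0 : ℝ) 1, F (y / 2)) +
      2⁻¹ * ∫⁻ y in Set.Ioc (0 : ℝ) 1, F ((y + 1) / 2) := by
  have hunion : Set.Icc (0 : ℝ) 1 = Set.Icc 0 (1 / 2) ∪ Set.Ioc (1 / 2) 1 :=
    (Set.Icc_union_Ioc_eq_Icc (by norm_num) (by norm_num)).symm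
  rw [hunion, lintegral_union measurableSet_Ioc, ← hunion]
  · congr 1
    · rw [← lintegral_indicator measurableSet_Icc, lintegral_half _ (hF.indicator measurableSet_Icc) 0,
        ← lintegral_indicator measurableSet_Icc]
      congr 1
      refine lintegral_congr fun y => ?_
      have : (y + 0) / 2 ∈ Set.Icc (0 : ℝ) (1 / 2) ↔ y ∈ Set.Icc (0 : ℝ) 1 := by
        simp only [Set.mem_Icc]; constructor <;> rintro ⟨h1, h2⟩ <;> constructor <;> linarith
      by_cases hy : y ∈ Set.Icc (0 : ℝ) 1
      · rw [Set.indicator_of_mem hy, Set.indicator_of_mem (this.2 hy), add_zero]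
      · rw [Set.indicator_of_notMem hy, Set.indicator_of_notMem (this.not.2 hy)]
    · rw [← lintegral_indicator measurableSet_Ioc, lintegral_half _ (hF.indicator measurableSet_Ioc) 1,
        ← lintegral_indicator measurableSet_Ioc]
      congr 1
      refine lintegral_congr fun y => ?_
      have : (y + 1) / 2 ∈ Set.Ioc (1 / 2 : ℝ) 1 ↔ y ∈ Set.Ioc (0 : ℝ) 1 := by
        simp only [Set.mem_Ioc]; constructor <;> rintro ⟨h1, h2⟩ <;> constructor <;> linarith
      by_cases hy : y ∈ Set.Ioc (0 : ℝ) 1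
      · rw [Set.indicator_of_mem hy, Set.indicator_of_mem (this.2 hy)]
      · rw [Set.indicator_of_notMem hy, Set.indicator_of_notMem (this.not.2 hy)]
  · rw [Set.disjoint_left]
    rintro x ⟨_, h⟩ ⟨h', _⟩
    linarith

theorem lintegral_approx (n : ℕ) (v : Weights) {f : ℝ → ℝ≥0∞} (hf : Measurable f) :
    ∫⁻ x, f x ∂approx n v = ∫⁻ x in Set.Icc (0 : ℝ) 1, pathProd v (wordAt n x) * f x :=
  lintegral_withDensity_eq_lintegral_mul _
    (measurable_comp_wordAt (fun w => (pathProd v w : ℝ≥0∞)) n) hf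

theorem lintegral_approx_succ (n : ℕ) (v : Weights) {f : ℝ → ℝ≥0∞} (hf : Measurable f) :
    ∫⁻ x, f x ∂approx (n + 1) v = (2⁻¹ * v [] : ℝ≥0) *
      (∫⁻ y, f (y / 2) ∂approx n (child false v) +
        ∫⁻ y, f ((y + 1) / 2) ∂approx n (child true v)) := by
  have hm (u : Weights) := measurable_comp_wordAt (fun w => (pathProd u w : ℝ≥0∞)) n
  rw [lintegral_approx _ _ hf, lintegral_approx _ _ (by fun_prop), lintegral_approx _ _ (by fun_prop),
    setLIntegral_Icc_eq (fun x => pathProd v (wordAt (n + 1) x) * f x)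
      ((measurable_comp_wordAt (fun w => (pathProd v w : ℝ≥0∞)) (n + 1)).mul hf), mul_add]
  have h2 : ((2⁻¹ * v [] : ℝ≥0) : ℝ≥0∞) = 2⁻¹ * v [] := by
    rw [ENNReal.coe_mul, ENNReal.coe_inv two_ne_zero]; rfl
  congr 1
  · rw [h2, mul_assoc, ← lintegral_const_mul (v [] : ℝ≥0∞)
      (f := fun x => pathProd (child false v) (wordAt n x) * f (x / 2)) ((hm _).mul (by fun_prop))]
    congr 1
    refine setLIntegral_congr_fun measurableSet_Icc fun y hy => ?_
    rw [wordAt_succ_half n hy.2, pathProd, ENNReal.coe_mul, mul_assoc]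
  · rw [h2, mul_assoc, ← lintegral_const_mul (v [] : ℝ≥0∞)
      (f := fun x => pathProd (child true v) (wordAt n x) * f ((x + 1) / 2))
      ((hm _).mul (by fun_prop)),
      setLIntegral_congr (Ioc_ae_eq_Icc (μ := volume) (a := (0 : ℝ)) (b := 1)).symm]
    congr 1
    refine setLIntegral_congr_fun measurableSet_Ioc fun y hy => ?_
    rw [wordAt_succ_half_add n hy.1, pathProd, ENNReal.coe_mul, mul_assoc]

/-- Self-similarity: each half of the unit interval carries a rescaled copy of the approximation for
the corresponding subtree. Inductions over the tree transfer to measures through this identity. -/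
theorem approx_succ (n : ℕ) (v : Weights) :
    approx (n + 1) v = ((2⁻¹ * v [] : ℝ≥0) : ℝ≥0∞) •
      ((approx n (child false v)).map (fun y => y / 2) +
        (approx n (child true v)).map fun y => (y + 1) / 2) := by
  ext A hA
  rw [← lintegral_indicator_one hA, lintegral_approx_succ n v (measurable_one.indicator hA),
    Measure.smul_apply, Measure.add_apply, Measure.map_apply (by fun_prop) hA,
    Measure.map_apply (by fun_prop) hA, smul_eq_mul,
    ← lintegral_indicator_one (measurableSet_preimage (by fun_prop) hA),
    ← lintegral_indicator_one (measurableSet_preimage (by fun_prop) hA)]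
  rfl

theorem approx_univ (n : ℕ) (v : Weights) : approx n v Set.univ = total n v := by
  induction n generalizing v with
  | zero => simp [approx, wordAt, pathProd, total]
  | succ n ih =>
    rw [approx_succ, Measure.smul_apply, Measure.add_apply,
      Measure.map_apply (by fun_prop) .univ, Measure.map_apply (by fun_prop) .univ]
    simp [ih, total]

instance (n : ℕ) (v : Weights) : IsFiniteMeasure (approx n v) :=
  ⟨by rw [approx_univ]; exact ENNReal.coe_lt_top⟩

theorem approx_compl_Icc (n : ℕ) (v : Weights) : approx n v (Set.Icc 0 1)ᶜ = 0 :=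
  withDensity_absolutelyContinuous _ _ (by simp)

theorem mass_le_liminf_approx (v : Weights) (x : List Bool) :
    mass v x ≤ liminf (fun n => approx n v (cellIcc x)) atTop := by
  induction x generalizing v with
  | nil =>
    have h (n : ℕ) : (total n v : ℝ≥0∞) = approx n v (cellIcc []) := by
      have e : cellIcc [] = Set.Icc 0 1 := by simp [cellIcc, left]
      rw [← approx_univ, e, ← measure_add_measure_compl (μ := approx n v) measurableSet_Icc,
        approx_compl_Icc, add_zero]
    rw [mass, limTotal]
    simp only [h, le_refl]
  | cons b x ih =>
    rw [mass, ← liminf_nat_add _ 1]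
    refine (mul_le_mul_right (ih (child b v)) _).trans ?_
    have h1 : ((2⁻¹ * v [] : ℝ≥0) : ℝ≥0∞) * liminf (fun n => approx n (child b v) (cellIcc x)) atTop ≤
        liminf (fun n => ((2⁻¹ * v [] : ℝ≥0) : ℝ≥0∞) * approx n (child b v) (cellIcc x)) atTop := by
      refine le_trans ?_ ENNReal.le_liminf_mul
      rw [liminf_const]
    refine h1.trans (liminf_le_liminf (.of_forall fun n => ?_))
    have hmeas : MeasurableSet (cellIcc (b :: x)) := measurableSet_Icc
    rw [approx_succ, Measure.smul_apply, Measure.add_apply, smul_eq_mul,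
      Measure.map_apply (f := fun y : ℝ => y / 2) (by fun_prop) hmeas,
      Measure.map_apply (f := fun y : ℝ => (y + 1) / 2) (by fun_prop) hmeas]
    gcongr
    cases b
    · exact (measure_mono fun y hy => half_mem_cellIcc hy).trans le_self_add
    · exact (measure_mono fun y hy => half_add_mem_cellIcc hy).trans le_add_self

/-! ### Weak convergence -/

/-- The total masses converge on all subtrees. -/
def Converges (v : Weights) : Prop :=
  ∀ x, ∃ c : ℝ≥0, Tendsto (fun n => total n (subtree x v)) atTop (𝓝 c)

theorem Converges.child {v : Weights} (h : Converges v) (b : Bool) : Converges (child b v) :=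
  fun x => h (b :: x)

theorem integral_approx_succ (n : ℕ) (v : Weights) {f : ℝ → ℝ} (hf : Continuous f) {C : ℝ}
    (hC : ∀ x, |f x| ≤ C) :
    ∫ x, f x ∂approx (n + 1) v = (2⁻¹ * v [] : ℝ≥0) *
      (∫ y, f (y / 2) ∂approx n (Weights.child false v) +
        ∫ y, f ((y + 1) / 2) ∂approx n (Weights.child true v)) := by
  have hi (μ : Measure ℝ) [IsFiniteMeasure μ] : Integrable f μ :=
    Integrable.of_bound hf.aestronglyMeasurable C (ae_of_all _ hC)
  have : IsFiniteMeasure ((approx n (Weights.child false v)).map fun y => y / 2) :=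
    Measure.isFiniteMeasure_map _ _
  have : IsFiniteMeasure ((approx n (Weights.child true v)).map fun y => (y + 1) / 2) :=
    Measure.isFiniteMeasure_map _ _
  rw [approx_succ, integral_smul_measure, integral_add_measure (hi _) (hi _),
    integral_map (by fun_prop) hf.aestronglyMeasurable,
    integral_map (by fun_prop) hf.aestronglyMeasurable]
  rfl

/-- Replace the test function by a constant on each cell of level `N`. The integral becomes a fixed
linear combination of total masses of subtrees, which converge, and the error is at most ε times the
total mass. -/
theorem exists_tendsto_near_integral (N : ℕ) {v : Weights} (hv : Converges v) {f : ℝ → ℝ}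
    (hf : Continuous f) {C : ℝ} (hC : ∀ x, |f x| ≤ C) {ε : ℝ}
    (h : ∀ x ∈ words N, ∃ c : ℝ, ∀ y ∈ cellIcc x, |f y - c| ≤ ε) :
    ∃ a : ℕ → ℝ, (∃ l, Tendsto a atTop (𝓝 l)) ∧
      ∀ᶠ n in atTop, |∫ x, f x ∂approx n v - a n| ≤ ε * total n v := by
  induction N generalizing v f with
  | zero =>
    obtain ⟨c, hc⟩ := h [] (mem_words.2 rfl)
    obtain ⟨t, ht⟩ := hv []
    refine ⟨fun n => c * total n v, ⟨_, (NNReal.tendsto_coe.2 ht).const_mul c⟩,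
      .of_forall fun n => ?_⟩
    have hμ : (approx n v).real Set.univ = total n v := by
      rw [measureReal_def, approx_univ]; rfl
    have hi : Integrable f (approx n v) :=
      Integrable.of_bound hf.aestronglyMeasurable C (ae_of_all _ hC)
    have e : ∫ x, f x ∂approx n v - c * total n v = ∫ x, (f x - c) ∂approx n v := by
      rw [integral_sub hi (integrable_const c), integral_const, hμ, smul_eq_mul, mul_comm]
    rw [e, ← hμ, ← Real.norm_eq_abs]
    refine norm_integral_le_of_norm_le_const ?_
    have hae : ∀ᵐ x ∂approx n v, x ∈ Set.Icc (0 : ℝ) 1 := approx_compl_Icc n v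
    filter_upwards [hae] with x hx
    exact hc x (by simpa [cellIcc, left] using hx)
  | succ N ih =>
    obtain ⟨a, ⟨l, hl⟩, ha⟩ := ih (hv.child false) (f := fun y => f (y / 2)) (by fun_prop)
      (fun y => hC _) fun x hx => by
        obtain ⟨c, hc⟩ := h (false :: x) (by simpa [mem_words] using hx)
        exact ⟨c, fun y hy => hc _ (half_mem_cellIcc hy)⟩
    obtain ⟨b, ⟨l', hl'⟩, hb⟩ := ih (hv.child true) (f := fun y => f ((y + 1) / 2)) (by fun_prop)
      (fun y => hC _) fun x hx => by
        obtain ⟨c, hc⟩ := h (true :: x) (by simpa [mem_words] using hx)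
        exact ⟨c, fun y hy => hc _ (half_add_mem_cellIcc hy)⟩
    -- Level `n` of the tree uses level `n - 1` of its subtrees; the junk value at `n = 0` does not
    -- affect the limit.
    refine ⟨fun n => (2⁻¹ * v [] : ℝ≥0) * (a (n - 1) + b (n - 1)),
      ⟨(2⁻¹ * v [] : ℝ≥0) * (l + l'), ?_⟩, ?_⟩
    · rw [← tendsto_add_atTop_iff_nat 1]
      exact (hl.add hl').const_mul _
    · have hpred := tendsto_sub_atTop_nat 1
      filter_upwards [hpred.eventually ha, hpred.eventually hb, eventually_ge_atTop 1]
        with n h1 h2 hn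
      obtain ⟨n, rfl⟩ : ∃ k, n = k + 1 := ⟨n - 1, by omega⟩
      rw [Nat.add_sub_cancel] at h1 h2 ⊢
      rw [integral_approx_succ n v hf hC, ← mul_sub, add_sub_add_comm, abs_mul,
        abs_of_nonneg (NNReal.coe_nonneg _)]
      calc _ ≤ ((2⁻¹ * v [] : ℝ≥0) : ℝ) * (ε * total n (Weights.child false v) +
            ε * total n (Weights.child true v)) := by
            gcongr
            exact (abs_add_le _ _).trans (add_le_add h1 h2)
        _ = _ := by simp only [total]; push_cast; ring

theorem exists_tendsto_integral {v : Weights} (hv : Converges v) {f : ℝ → ℝ}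
    (hf : Continuous f) {C : ℝ} (hC : ∀ x, |f x| ≤ C) :
    ∃ l, Tendsto (fun n => ∫ x, f x ∂approx n v) atTop (𝓝 l) := by
  refine cauchySeq_tendsto_of_complete (Metric.cauchySeq_iff.2 fun δ hδ => ?_)
  obtain ⟨t, ht⟩ := hv []
  obtain ⟨K, hK⟩ := ht.bddAbove_range
  have hKt (n : ℕ) : (total n v : ℝ) ≤ K + 1 := by
    have h1 : total n v ≤ K := hK ⟨n, rfl⟩
    have h2 : (total n v : ℝ) ≤ K := by exact_mod_cast h1
    linarith
  set ε := δ / (4 * (K + 1)) with hε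
  have hε0 : 0 < ε := by positivity
  have huc := isCompact_Icc.uniformContinuousOn_of_continuous (hf.continuousOn (s := Set.Icc 0 1))
  obtain ⟨η, hη, hηf⟩ := Metric.uniformContinuousOn_iff.1 huc ε hε0
  obtain ⟨N, hN⟩ := exists_pow_lt_of_lt_one hη (show (2⁻¹ : ℝ) < 1 by norm_num)
  obtain ⟨a, ⟨l, hl⟩, ha⟩ := exists_tendsto_near_integral N hv hf hC (ε := ε) fun x hx => by
    refine ⟨f (left x), fun y hy => ?_⟩
    have hleft : left x ∈ cellIcc x := ⟨le_rfl, by simp⟩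
    have := hηf y (cellIcc_subset x hy) (left x) (cellIcc_subset x hleft) (by
      have h1 := hy.1
      have h2 := hy.2
      rw [mem_words.1 hx] at h2
      rw [Real.dist_eq, abs_of_nonneg (by linarith)]
      linarith)
    exact this.le
  obtain ⟨M, hM⟩ := eventually_atTop.1 (ha.and (Metric.tendsto_nhds.1 hl (δ / 4) (by positivity)))
  have key (n : ℕ) (hn : M ≤ n) : |∫ x, f x ∂approx n v - l| < δ / 2 := by
    obtain ⟨h1, h2⟩ := hM n hn
    have h3 : ε * total n v ≤ δ / 4 := by
      calc ε * total n v ≤ ε * (K + 1) := by gcongr; exact hKt n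
        _ = δ / 4 := by rw [hε]; field_simp
    rw [Real.dist_eq] at h2
    have := abs_sub_le (∫ x, f x ∂approx n v) (a n) l
    linarith
  refine ⟨M, fun m hm n hn => ?_⟩
  have h1 := key m hm
  have h2 := key n hn
  rw [Real.dist_eq]
  have h3 := abs_sub_le (∫ x, f x ∂approx m v) l (∫ x, f x ∂approx n v)
  rw [abs_sub_comm l] at h3
  linarith

/-- Measures of bounded mass on [0, 1] form a compact set, which provides a cluster point μ.
Integrals of bounded continuous functions converge, and their limits must be the integrals against
μ. -/
theorem exists_tendsto_approxMeasure {V : Dyadic → ℝ} {v : Weights}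
    (h : ∀ x, V (toDyadic x) = v x) (hv : Converges v) :
    ∃ μ, Tendsto (approxMeasure V) atTop (𝓝 μ) := by
  obtain ⟨t, ht⟩ := hv []
  obtain ⟨K, hK⟩ := ht.bddAbove_range
  have hmem (n : ℕ) : approxMeasure V n ∈
      {μ : FiniteMeasure ℝ | μ.mass ≤ K ∧ μ (Set.Icc 0 1)ᶜ = 0} := by
    constructor
    · rw [← ENNReal.coe_le_coe, FiniteMeasure.ennreal_mass, approxMeasure_eq h, approx_univ,
        ENNReal.coe_le_coe]
      exact hK ⟨n, rfl⟩
    · rw [← ENNReal.coe_eq_zero, FiniteMeasure.ennreal_coeFn_eq_coeFn_toMeasure,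
        approxMeasure_eq h, approx_compl_Icc]
  obtain ⟨μ, -, hμ⟩ := (isCompact_setOfPred_finiteMeasure_le_of_isCompact K
    (isCompact_Icc (a := (0 : ℝ)) (b := 1))).exists_mapClusterPt (f := atTop)
    (u := approxMeasure V) (tendsto_principal.2 (.of_forall hmem))
  refine ⟨μ, FiniteMeasure.tendsto_iff_forall_integral_tendsto.2 fun f => ?_⟩
  obtain ⟨l, hl⟩ := exists_tendsto_integral hv f.continuous (C := ‖f‖) fun x => f.norm_coe_le_norm x
  have hl' : Tendsto (fun n => ∫ x, f x ∂(approxMeasure V n : Measure ℝ)) atTop (𝓝 l) := by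
    simpa only [approxMeasure_eq h] using hl
  have hcont : Tendsto (fun ν : FiniteMeasure ℝ => ∫ x, f x ∂(ν : Measure ℝ)) (𝓝 μ)
      (𝓝 (∫ x, f x ∂(μ : Measure ℝ))) :=
    FiniteMeasure.tendsto_iff_forall_integral_tendsto.1 tendsto_id f
  have hclus : MapClusterPt (∫ x, f x ∂(μ : Measure ℝ)) atTop
      (fun n => ∫ x, f x ∂(approxMeasure V n : Measure ℝ)) := hμ.tendsto_comp hcont
  have heq : ∫ x, f x ∂(μ : Measure ℝ) = l :=
    eq_of_nhds_neBot (hclus.neBot.mono (inf_le_inf_left _ hl'))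
  rwa [heq]

/-- The cascade measure of the interval of a node is at least the mass of the node. -/
theorem mass_le_cascadeMeasure {V : Dyadic → ℝ} {v : Weights} (h : ∀ x, V (toDyadic x) = v x)
    (hv : Converges v) (x : List Bool) :
    mass v x ≤ (cascadeMeasure V : Measure ℝ) (cellIcc x) := by
  have ht : Tendsto (approxMeasure V) atTop (𝓝 (cascadeMeasure V)) :=
    tendsto_nhds_limUnder (exists_tendsto_approxMeasure h hv)
  calc mass v x ≤ liminf (fun n => approx n v (cellIcc x)) atTop := mass_le_liminf_approx v x
    _ ≤ limsup (fun n => approx n v (cellIcc x)) atTop := liminf_le_limsup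
    _ = limsup (fun n => (approxMeasure V n : Measure ℝ) (cellIcc x)) atTop := by
        simp only [approxMeasure_eq h]
    -- The portmanteau inequality for closed sets; this is why cells are closed.
    _ ≤ _ := FiniteMeasure.limsup_measure_closed_le_of_tendsto ht isClosed_Icc

end Weights

end Cascade

namespace Cascade

/-! ### The content of a subset of the Cantor space -/

/-- The first `n` terms of a binary sequence. -/
def pre (n : ℕ) (b : ℕ → Bool) : List Bool := (List.range n).map b

@[simp] theorem length_pre (n : ℕ) (b : ℕ → Bool) : (pre n b).length = n := by simp [pre]

theorem pre_succ (n : ℕ) (b : ℕ → Bool) : pre (n + 1) b = pre n b ++ [b n] := by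
  simp [pre, List.range_succ]

theorem pre_prefix (b : ℕ → Bool) {m n : ℕ} (h : m ≤ n) : pre m b <+: pre n b := by
  induction n, h using Nat.le_induction with
  | base => exact List.prefix_rfl
  | succ n _ ih => exact ih.trans (pre_succ n b ▸ List.prefix_append _ _)

/-- The binary sequences that begin with the word `z`. -/
def cylinder (z : List Bool) : Set (ℕ → Bool) := {b | pre z.length b = z}

theorem cylinder_nil : cylinder [] = Set.univ := by simp [cylinder, pre]

theorem mem_cylinder_append {b : ℕ → Bool} {z : List Bool} {a : Bool} :
    b ∈ cylinder (z ++ [a]) ↔ b ∈ cylinder z ∧ b z.length = a := by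
  change pre (z ++ [a]).length b = _ ↔ pre z.length b = z ∧ _
  rw [List.length_append, List.length_singleton, pre_succ]
  constructor
  · intro h
    have := List.append_inj h (by simp)
    simpa using this
  · rintro ⟨h1, h2⟩
    rw [h1, h2]

theorem cylinder_eq_union (z : List Bool) :
    cylinder z = cylinder (z ++ [false]) ∪ cylinder (z ++ [true]) := by
  ext b
  rw [Set.mem_union, mem_cylinder_append, mem_cylinder_append, ← and_or_left]
  cases b z.length <;> simp

theorem isOpen_cylinder (z : List Bool) : IsOpen (cylinder z) := by
  induction z using List.reverseRecOn with
  | nil => rw [cylinder_nil]; exact isOpen_univ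
  | append_singleton z a ih =>
    have : cylinder (z ++ [a]) = cylinder z ∩ (fun b : ℕ → Bool => b z.length) ⁻¹' {a} := by
      ext b; rw [mem_cylinder_append]; rfl
    rw [this]
    exact ih.inter ((isOpen_discrete _).preimage (continuous_apply _))

theorem prefix_of_mem_cylinder {b : ℕ → Bool} {z w : List Bool} (hz : b ∈ cylinder z)
    (hw : b ∈ cylinder w) (h : z.length ≤ w.length) : z <+: w := by
  have := pre_prefix b h
  rwa [show pre z.length b = z from hz, show pre w.length b = w from hw] at this

/-- The content of `A`: the infimum of `∑ κ ^ |z|` over the covers of `A` by cylinders. -/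
def content (κ : ℝ≥0∞) (A : Set (ℕ → Bool)) : ℝ≥0∞ :=
  ⨅ (Z : Set (List Bool)) (_ : A ⊆ ⋃ z ∈ Z, cylinder z), ∑' z : Z, κ ^ z.1.length

variable {κ : ℝ≥0∞}

theorem content_le_tsum {A : Set (ℕ → Bool)} {Z : Set (List Bool)}
    (h : A ⊆ ⋃ z ∈ Z, cylinder z) : content κ A ≤ ∑' z : Z, κ ^ z.1.length :=
  iInf₂_le Z h

theorem exists_tsum_lt_of_content_lt {A : Set (ℕ → Bool)} {a : ℝ≥0∞} (h : content κ A < a) :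
    ∃ Z : Set (List Bool), A ⊆ ⋃ z ∈ Z, cylinder z ∧ ∑' z : Z, κ ^ z.1.length < a := by
  simp only [content, iInf_lt_iff] at h
  obtain ⟨Z, hZ, h⟩ := h
  exact ⟨Z, hZ, h⟩

theorem content_mono {A B : Set (ℕ → Bool)} (h : A ⊆ B) : content κ A ≤ content κ B :=
  le_iInf₂ fun _ hZ => content_le_tsum (h.trans hZ)

theorem content_empty : content κ ∅ = 0 := by
  refine le_antisymm ((content_le_tsum (Z := ∅) (Set.empty_subset _)).trans ?_) zero_le
  simp

theorem content_cylinder_le (A : Set (ℕ → Bool)) (z : List Bool) :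
    content κ (A ∩ cylinder z) ≤ κ ^ z.length := by
  refine (content_le_tsum (Z := {z}) ?_).trans ?_
  · simp
  · rw [tsum_singleton z fun w : List Bool => κ ^ w.length]

theorem content_iUnion_le {ι : Type*} [Countable ι] (A : ι → Set (ℕ → Bool)) :
    content κ (⋃ i, A i) ≤ ∑' i, content κ (A i) := by
  refine ENNReal.le_of_forall_pos_le_add fun ε hε hfin => ?_
  obtain ⟨δ, hδ, hsum⟩ := ENNReal.exists_pos_sum_of_countable (ENNReal.coe_pos.2 hε).ne' ι
  have h (i : ι) : content κ (A i) < content κ (A i) + δ i :=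
    ENNReal.lt_add_right (ne_top_of_le_ne_top hfin.ne (ENNReal.le_tsum i))
      (ENNReal.coe_pos.2 (hδ i)).ne'
  choose Z hZ hlt using fun i => exists_tsum_lt_of_content_lt (h i)
  calc content κ (⋃ i, A i) ≤ ∑' z : ⋃ i, Z i, κ ^ z.1.length := by
        refine content_le_tsum (Set.iUnion_subset fun i => (hZ i).trans ?_)
        exact Set.biUnion_subset_biUnion_left (Set.subset_iUnion Z i)
    _ ≤ ∑' i, ∑' z : Z i, κ ^ z.1.length :=
        ENNReal.tsum_iUnion_le_tsum (fun z : List Bool => κ ^ z.length) Z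
    _ ≤ ∑' i, (content κ (A i) + δ i) := ENNReal.tsum_le_tsum fun i => (hlt i).le
    _ ≤ _ := by rw [ENNReal.tsum_add]; gcongr

theorem content_union_le (A B : Set (ℕ → Bool)) :
    content κ (A ∪ B) ≤ content κ A + content κ B := by
  have h := content_iUnion_le (κ := κ) fun b : Bool => cond b A B
  rw [tsum_bool, ← Set.union_eq_iUnion] at h
  rwa [add_comm]

theorem content_inter_cylinder_le (A : Set (ℕ → Bool)) (z : List Bool) :
    content κ (A ∩ cylinder z) ≤
      content κ (A ∩ cylinder (z ++ [false])) + content κ (A ∩ cylinder (z ++ [true])) := by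
  rw [cylinder_eq_union, Set.inter_union_distrib_left]
  exact content_union_le _ _

/-- A cover cheaper than κ^|z| contains no word of length at most |z|, as κ ≤ 1. Its useful members
therefore extend one of the two children of `z`, and the cover splits into two disjoint parts. -/
theorem content_add_content_le (hκ : κ ≤ 1) {A : Set (ℕ → Bool)} {z : List Bool}
    (h : content κ (A ∩ cylinder z) < κ ^ z.length) :
    content κ (A ∩ cylinder (z ++ [false])) + content κ (A ∩ cylinder (z ++ [true])) ≤
      content κ (A ∩ cylinder z) := by
  refine le_of_forall_gt fun a ha => ?_
  obtain ⟨Z, hZ, hlt⟩ := exists_tsum_lt_of_content_lt (lt_min ha h)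
  have hlen (w : List Bool) (hw : w ∈ Z) : z.length < w.length := by
    by_contra! hle
    refine (hlt.trans_le (min_le_right _ _)).not_ge ?_
    exact (pow_le_pow_right_of_le_one' hκ hle).trans
      (ENNReal.le_tsum (f := fun z : Z => κ ^ z.1.length) ⟨w, hw⟩)
  have hcov (b : Bool) : A ∩ cylinder (z ++ [b]) ⊆ ⋃ w ∈ {w ∈ Z | z ++ [b] <+: w}, cylinder w := by
    rintro x ⟨hxA, hx⟩
    obtain ⟨w, hw, hxw⟩ := Set.mem_iUnion₂.1 (hZ ⟨hxA, (mem_cylinder_append.1 hx).1⟩)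
    refine Set.mem_iUnion₂.2 ⟨w, ⟨hw, prefix_of_mem_cylinder hx hxw ?_⟩, hxw⟩
    simpa using hlen w hw
  have hdisj : Disjoint {w ∈ Z | z ++ [false] <+: w} {w ∈ Z | z ++ [true] <+: w} := by
    rw [Set.disjoint_left]
    rintro w ⟨-, h1⟩ ⟨-, h2⟩
    have := List.prefix_of_prefix_length_le h1 h2 (by simp)
    simpa using this.eq_of_length (by simp)
  calc _ ≤ ∑' w : {w ∈ Z | z ++ [false] <+: w}, κ ^ w.1.length +
        ∑' w : {w ∈ Z | z ++ [true] <+: w}, κ ^ w.1.length :=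
        add_le_add (content_le_tsum (hcov false)) (content_le_tsum (hcov true))
    _ = ∑' w : ({w ∈ Z | z ++ [false] <+: w} ∪ {w ∈ Z | z ++ [true] <+: w} : Set (List Bool)),
        κ ^ w.1.length :=
        (ENNReal.summable.tsum_union_disjoint (f := fun w : List Bool => κ ^ w.length) hdisj
          ENNReal.summable).symm
    _ ≤ ∑' w : Z, κ ^ w.1.length :=
        ENNReal.tsum_mono_subtype (fun w : List Bool => κ ^ w.length)
          (Set.union_subset (Set.sep_subset _ _) (Set.sep_subset _ _))
    _ < a := hlt.trans_le (min_le_left _ _)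

/-! ### Continuity of the content along increasing unions. -/

theorem content_le_one (A : Set (ℕ → Bool)) : content κ A ≤ 1 := by
  have := content_cylinder_le (κ := κ) A []
  rwa [cylinder_nil, Set.inter_univ, List.length_nil, pow_zero] at this

/-- Cutting `R` along any cover gains a factor `r` on its cost. So the content is at most `r` times
itself, and it is finite. -/
theorem content_eq_zero_of_forall_le {r : ℝ≥0∞} (hr0 : r ≠ 0) (hr : r < 1) {R : Set (ℕ → Bool)}
    (h : ∀ z, (R ∩ cylinder z).Nonempty → content κ (R ∩ cylinder z) ≤ r * κ ^ z.length) :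
    content κ R = 0 := by
  have key (Z : Set (List Bool)) (hZ : R ⊆ ⋃ z ∈ Z, cylinder z) :
      content κ R ≤ r * ∑' z : Z, κ ^ z.1.length := by
    have hR : R = ⋃ z : Z, R ∩ cylinder z := by
      rw [← Set.inter_iUnion, ← Set.biUnion_eq_iUnion Z fun z _ => cylinder z]
      exact (Set.inter_eq_left.2 hZ).symm
    calc content κ R = content κ (⋃ z : Z, R ∩ cylinder z) := by rw [← hR]
      _ ≤ ∑' z : Z, content κ (R ∩ cylinder z) := content_iUnion_le _
      _ ≤ ∑' z : Z, r * κ ^ z.1.length := by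
          refine ENNReal.tsum_le_tsum fun z => ?_
          rcases (R ∩ cylinder z).eq_empty_or_nonempty with he | he
          · rw [he, content_empty]; exact zero_le
          · exact h z he
      _ = _ := ENNReal.tsum_mul_left
  by_contra h0
  have hlt : content κ R < content κ R / r := by
    rw [ENNReal.lt_div_iff_mul_lt (.inl hr0) (.inl hr.ne_top), mul_comm]
    have := ENNReal.mul_lt_mul_left h0 (ne_top_of_le_ne_top ENNReal.one_ne_top (content_le_one R)) hr
    rwa [one_mul] at this
  obtain ⟨Z, hZ, hlt'⟩ := exists_tsum_lt_of_content_lt hlt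
  rw [ENNReal.lt_div_iff_mul_lt (.inl hr0) (.inl hr.ne_top), mul_comm] at hlt'
  exact hlt'.not_ge (key Z hZ)

/-- The minimal words of `S` that extend `z` by at most `N` letters. -/
def stopped (S : Set (List Bool)) : ℕ → List Bool → Set (List Bool)
  | 0, z => {w | z ∈ S ∧ w = z}
  | N + 1, z => {w | z ∈ S ∧ w = z} ∪
      {w | z ∉ S ∧ (w ∈ stopped S N (z ++ [false]) ∨ w ∈ stopped S N (z ++ [true]))}

theorem stopped_subset_succ (S : Set (List Bool)) (N : ℕ) (z : List Bool) :
    stopped S N z ⊆ stopped S (N + 1) z := by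
  induction N generalizing z with
  | zero => exact Set.subset_union_left
  | succ N ih =>
    refine Set.union_subset_union_right _ ?_
    rintro w ⟨h, hw⟩
    exact ⟨h, hw.imp (fun h => ih _ h) fun h => ih _ h⟩

theorem exists_mem_stopped {S : Set (List Bool)} {b : ℕ → Bool} (N : ℕ) {z : List Bool}
    (hb : b ∈ cylinder z) {k : ℕ} (hk : k ≤ N) (h : pre (z.length + k) b ∈ S) :
    ∃ w ∈ stopped S N z, b ∈ cylinder w := by
  by_cases hz : z ∈ S
  · refine ⟨z, ?_, hb⟩
    cases N
    · exact ⟨hz, rfl⟩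
    · exact .inl ⟨hz, rfl⟩
  rcases k with - | k
  · rw [add_zero, show pre z.length b = z from hb] at h
    exact absurd h hz
  obtain ⟨N, rfl⟩ : ∃ M, N = M + 1 := ⟨N - 1, by omega⟩
  induction N generalizing z k with
  | zero =>
    obtain rfl : k = 0 := by omega
    have hb' : b ∈ cylinder (z ++ [b z.length]) := mem_cylinder_append.2 ⟨hb, rfl⟩
    rw [zero_add, pre_succ, show pre z.length b = z from hb] at h
    refine ⟨_, .inr ⟨hz, ?_⟩, hb'⟩
    cases hbz : b z.length <;> rw [hbz] at h
    · exact .inl ⟨h, rfl⟩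
    · exact .inr ⟨h, rfl⟩
  | succ N ih =>
    have hb' : b ∈ cylinder (z ++ [b z.length]) := mem_cylinder_append.2 ⟨hb, rfl⟩
    have hex : ∃ w ∈ stopped S (N + 1) (z ++ [b z.length]), b ∈ cylinder w := by
      by_cases hz' : z ++ [b z.length] ∈ S
      · exact ⟨_, .inl ⟨hz', rfl⟩, hb'⟩
      · rcases k with - | k
        · rw [zero_add, pre_succ, show pre z.length b = z from hb] at h
          exact absurd h hz'
        · refine ih hb' hz' k ?_ (by omega)
          rwa [List.length_append, List.length_singleton, add_assoc, add_comm 1]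
    obtain ⟨w, hw, hbw⟩ := hex
    refine ⟨w, .inr ⟨hz, ?_⟩, hbw⟩
    cases hbz : b z.length <;> rw [hbz] at hw
    · exact .inl hw
    · exact .inr hw

/-- A stopping argument: the budget `g z` is passed on to the children until a word of `S` is
reached, where it pays for `f`. -/
theorem tsum_stopped_le {S : Set (List Bool)} {f g : List Bool → ℝ≥0∞} (h1 : ∀ z ∈ S, f z ≤ g z)
    (h2 : ∀ z ∉ S, g (z ++ [false]) + g (z ++ [true]) ≤ g z) (N : ℕ) (z : List Bool) :
    ∑' w : stopped S N z, f w ≤ g z := by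
  by_cases hz : z ∈ S
  · have : stopped S N z = {z} := by cases N <;> simp [stopped, hz]
    rw [this, tsum_singleton z f]
    exact h1 z hz
  induction N generalizing z with
  | zero =>
    have : stopped S 0 z = ∅ := by simp [stopped, hz]
    rw [this]
    simp
  | succ N ih =>
    have key (w : List Bool) : ∑' w : stopped S N w, f w ≤ g w := by
      by_cases hw : w ∈ S
      · have : stopped S N w = {w} := by cases N <;> simp [stopped, hw]
        rw [this, tsum_singleton w f]
        exact h1 w hw
      · exact ih w hw
    have : stopped S (N + 1) z = stopped S N (z ++ [false]) ∪ stopped S N (z ++ [true]) := by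
      ext w; simp [stopped, hz]
    rw [this]
    exact (ENNReal.tsum_union_le f _ _).trans ((add_le_add (key _) (key _)).trans (h2 z hz))

theorem _root_.ENNReal.tsum_iUnion_le_of_monotone {α : Type*} {s : ℕ → Set α} (hs : Monotone s)
    {f : α → ℝ≥0∞} {c : ℝ≥0∞} (h : ∀ n, ∑' x : s n, f x ≤ c) : ∑' x : ⋃ n, s n, f x ≤ c := by
  rw [ENNReal.tsum_eq_iSup_sum]
  refine iSup_le fun F => ?_
  obtain ⟨n, hn⟩ := hs.directed_le.exists_mem_subset_of_finset_subset_biUnion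
    (s := F.map (Function.Embedding.subtype _)) (by
      rintro x hx
      obtain ⟨y, -, rfl⟩ := Finset.mem_map.1 hx
      exact y.2)
  calc ∑ x ∈ F, f x = ∑ x ∈ F.map (Function.Embedding.subtype _), f x := by
        rw [Finset.sum_map]; rfl
    _ ≤ ∑' x : s n, f x := by
        rw [← Finset.tsum_subtype']
        exact ENNReal.tsum_mono_subtype f hn
    _ ≤ c := h n

/-- Call a word full if the limiting content `g` of its cylinder is at least rκ^|z|. Off the full
words `g` is superadditive over children, so the minimal full words cost at most `g []`, which
controls the set `T` of sequences through a full word. Outside `T` every cylinder is deficient by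
the factor `r`, so what remains has content zero. -/
theorem mul_content_iUnion_le (hκ : κ ≤ 1) {A : ℕ → Set (ℕ → Bool)} (hA : Monotone A)
    {r : ℝ≥0∞} (hr0 : r ≠ 0) (hr : r < 1) :
    r * content κ (⋃ n, A n) ≤ ⨆ n, content κ (A n) := by
  set g : List Bool → ℝ≥0∞ := fun z => ⨆ n, content κ (A n ∩ cylinder z) with hg
  set S : Set (List Bool) := {z | r * κ ^ z.length ≤ g z} with hS
  set T : Set (ℕ → Bool) := {b | ∃ n, pre n b ∈ S} with hT
  have hmono (z : List Bool) : Monotone fun n => content κ (A n ∩ cylinder z) :=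
    fun m n h => content_mono (Set.inter_subset_inter_left _ (hA h))
  have hlt (z : List Bool) (hz : z ∉ S) : g z < r * κ ^ z.length := not_le.1 hz
  have h2 (z : List Bool) (hz : z ∉ S) : g (z ++ [false]) + g (z ++ [true]) ≤ g z := by
    rw [hg, ENNReal.iSup_add_iSup_of_monotone (hmono _) (hmono _)]
    refine iSup_mono fun n => content_add_content_le hκ ?_
    calc _ ≤ g z := le_iSup (fun n => content κ (A n ∩ cylinder z)) n
      _ < _ := hlt z hz
      _ ≤ _ := mul_le_of_le_one_left' hr.le
  have hR : content κ ((⋃ n, A n) \ T) = 0 := by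
    have e : (⋃ n, A n) \ T = ⋃ n, A n \ T := Set.iUnion_sdiff _ _
    have h0 (n : ℕ) : content κ (A n \ T) = 0 := by
      refine content_eq_zero_of_forall_le hr0 hr fun z ⟨b, hb, hbz⟩ => ?_
      have hz : z ∉ S := fun hz => hb.2 ⟨z.length, by rwa [show pre z.length b = z from hbz]⟩
      calc _ ≤ content κ (A n ∩ cylinder z) :=
            content_mono (Set.inter_subset_inter_left _ Set.sdiff_subset)
        _ ≤ g z := le_iSup (fun n => content κ (A n ∩ cylinder z)) n
        _ ≤ _ := (hlt z hz).le
    rw [e]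
    refine le_antisymm ((content_iUnion_le _).trans ?_) zero_le
    simp [h0]
  have hTle : r * content κ T ≤ g [] := by
    have hcov : T ⊆ ⋃ z ∈ ⋃ N, stopped S N [], cylinder z := by
      rintro b ⟨n, hn⟩
      obtain ⟨w, hw, hbw⟩ := exists_mem_stopped n (z := []) (by rw [cylinder_nil]; trivial) le_rfl
        (by simpa using hn)
      exact Set.mem_iUnion₂.2 ⟨w, Set.mem_iUnion.2 ⟨n, hw⟩, hbw⟩
    calc r * content κ T ≤ r * ∑' z : ⋃ N, stopped S N [], κ ^ z.1.length := by
          gcongr; exact content_le_tsum hcov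
      _ = ∑' z : ⋃ N, stopped S N [], r * κ ^ z.1.length := ENNReal.tsum_mul_left.symm
      _ ≤ g [] := ENNReal.tsum_iUnion_le_of_monotone (f := fun z : List Bool => r * κ ^ z.length)
          (monotone_nat_of_le_succ fun N => stopped_subset_succ S N [])
          fun N => tsum_stopped_le (fun z hz => hz) h2 N []
  calc r * content κ (⋃ n, A n) ≤ r * (content κ T + content κ ((⋃ n, A n) \ T)) := by
        gcongr
        refine (content_mono ?_).trans (content_union_le _ _)
        rw [Set.union_sdiff_self]
        exact Set.subset_union_right
    _ = r * content κ T := by rw [hR, add_zero]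
    _ ≤ g [] := hTle
    _ = _ := by simp only [hg, cylinder_nil, Set.inter_univ]

theorem exists_lt_content_of_lt_content_iUnion (hκ : κ ≤ 1) {A : ℕ → Set (ℕ → Bool)}
    (hA : Monotone A) {c : ℝ≥0∞} (h : c < content κ (⋃ n, A n)) : ∃ n, c < content κ (A n) := by
  have hne : content κ (⋃ n, A n) ≠ ∞ := ne_top_of_le_ne_top ENNReal.one_ne_top (content_le_one _)
  obtain ⟨d, hcd, hd⟩ := exists_between h
  have hd0 : d ≠ 0 := (zero_le.trans_lt hcd).ne'
  have hM0 : content κ (⋃ n, A n) ≠ 0 := (zero_le.trans_lt h).ne'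
  have := mul_content_iUnion_le hκ hA (r := d / content κ (⋃ n, A n))
    (ENNReal.div_ne_zero.2 ⟨hd0, hne⟩)
    ((ENNReal.div_lt_iff (.inl hM0) (.inl hne)).2 (by rwa [one_mul]))
  rw [ENNReal.div_mul_cancel hM0 hne] at this
  exact lt_iSup_iff.1 (hcd.trans_le this)

/-! ### Analytic sets and compact subsets of large content -/

/-- Counterexamples, set to 0 from coordinate k on, lie in the compact box. A limit of a subsequence
is also the limit of the unmodified counterexamples, so it lies in the box but outside the open set.
-/
theorem exists_truncation_subset {n : ℕ → ℕ} {O : Set (ℕ → ℕ)} (hO : IsOpen O)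
    (h : (Set.univ.pi fun i => Set.Iic (n i)) ⊆ O) :
    ∃ k, {σ : ℕ → ℕ | ∀ i < k, σ i ≤ n i} ⊆ O := by
  by_contra! hcon
  simp only [Set.not_subset] at hcon
  choose σ hσ hσO using hcon
  have hcpt : IsCompact (Set.univ.pi fun i => Set.Iic (n i)) :=
    isCompact_univ_pi fun i => (Set.finite_Iic _).isCompact
  obtain ⟨τ, hτ, φ, hφ, hlim⟩ := hcpt.isSeqCompact (x := fun k i => if i < k then σ k i else 0)
    fun k i _ => by
      dsimp only
      split_ifs with hi
      · exact hσ k i hi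
      · exact Nat.zero_le _
  have hlim' : Tendsto (fun k => σ (φ k)) atTop (𝓝 τ) := by
    rw [tendsto_pi_nhds] at hlim ⊢
    intro i
    refine (hlim i).congr' ?_
    filter_upwards [hφ.tendsto_atTop.eventually_gt_atTop i] with k hk
    exact if_pos hk
  exact hO.isClosed_compl.mem_of_tendsto hlim' (.of_forall fun k => hσO (φ k)) (h hτ)

/-- Choquet's capacitability argument: parametrise `A` by ℕ^ℕ and bound the coordinates one at a
time, keeping the content above `c` by continuity along increasing unions. A cylinder cover of the
image of the resulting compact box is open, so it already covers the image of some stage with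
finitely many bounds. -/
theorem exists_isCompact_content_ge {κ : ℝ≥0∞} (hκ : κ ≤ 1) {A : Set (ℕ → Bool)}
    (hA : AnalyticSet A) {c : ℝ≥0∞} (h : c < content κ A) :
    ∃ C ⊆ A, IsCompact C ∧ c ≤ content κ C := by
  rw [AnalyticSet] at hA
  rcases hA with rfl | ⟨f, hf, rfl⟩
  · rw [content_empty] at h
    exact absurd h not_lt_zero
  have step (B : {B : Set (ℕ → ℕ) // c < content κ (f '' B)}) (k : ℕ) :
      ∃ m, c < content κ (f '' (B ∩ {σ | σ k ≤ m})) := by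
    have hmono : Monotone fun m => f '' (B.1 ∩ {σ | σ k ≤ m}) := by
      intro m m' hm
      refine Set.image_mono (Set.inter_subset_inter_right _ fun σ hσ => ?_)
      exact le_trans (show σ k ≤ m from hσ) hm
    have hunion : ⋃ m, f '' (B.1 ∩ {σ | σ k ≤ m}) = f '' B.1 := by
      rw [← Set.image_iUnion, ← Set.inter_iUnion]
      congr 1
      exact Set.inter_eq_left.2 fun σ _ => Set.mem_iUnion.2 ⟨σ k, le_refl (σ k)⟩
    exact exists_lt_content_of_lt_content_iUnion hκ hmono (hunion ▸ B.2)
  choose m hm using step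
  let s : ℕ → {B : Set (ℕ → ℕ) // c < content κ (f '' B)} := fun k =>
    Nat.rec ⟨Set.univ, by rwa [Set.image_univ]⟩ (fun k B => ⟨B ∩ {σ | σ k ≤ m B k}, hm B k⟩) k
  have hs (k : ℕ) : (s k).1 = {σ | ∀ i < k, σ i ≤ m (s i) i} := by
    induction k with
    | zero => ext; simp [s]
    | succ k ih =>
      have : (s (k + 1)).1 = (s k).1 ∩ {σ | σ k ≤ m (s k) k} := rfl
      rw [this, ih]
      ext σ
      simp only [Set.mem_inter_iff, Set.mem_ofPred_eq, Nat.lt_succ_iff_lt_or_eq]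
      constructor
      · rintro ⟨h1, h2⟩ i (hi | rfl)
        · exact h1 i hi
        · exact h2
      · exact fun h => ⟨fun i hi => h i (.inl hi), h k (.inr rfl)⟩
  refine ⟨f '' Set.univ.pi fun i => Set.Iic (m (s i) i), Set.image_subset_range _ _,
    (isCompact_univ_pi fun i => (Set.finite_Iic _).isCompact).image hf, ?_⟩
  refine le_iInf₂ fun Z hZ => ?_
  have hopen : IsOpen (f ⁻¹' ⋃ z ∈ Z, cylinder z) :=
    (isOpen_biUnion fun z _ => isOpen_cylinder z).preimage hf
  obtain ⟨k, hk⟩ := exists_truncation_subset hopen (Set.image_subset_iff.1 hZ)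
  rw [← hs, ← Set.image_subset_iff] at hk
  exact (s k).2.le.trans (content_le_tsum hk)

/-! ### Splitting flows -/

/-- The flow of strength `c` that splits at each word in proportion to `g`. -/
def splitFlow : (List Bool → ℝ≥0) → ℝ≥0 → List Bool → ℝ≥0
  | _, c, [] => c
  | g, c, b :: x => splitFlow (fun y => g (b :: y)) (c * (g [b] / (g [false] + g [true]))) x

theorem splitFlow_append (g : List Bool → ℝ≥0) (c : ℝ≥0) (x : List Bool) (b : Bool) :
    splitFlow g c (x ++ [b]) =
      splitFlow g c x * (g (x ++ [b]) / (g (x ++ [false]) + g (x ++ [true]))) := by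
  induction x generalizing g c with
  | nil => rfl
  | cons a x ih => exact ih _ _

/-- Subadditivity of `g` leaves the children enough room: an inflow of at most `g x`, shared in
proportion to `g`, exceeds no child's capacity. -/
theorem splitFlow_le {g : List Bool → ℝ≥0} (hg : ∀ x, g x ≤ g (x ++ [false]) + g (x ++ [true]))
    {c : ℝ≥0} (hc : c ≤ g []) (x : List Bool) : splitFlow g c x ≤ g x := by
  induction x using List.reverseRecOn with
  | nil => exact hc
  | append_singleton x b ih =>
    rw [splitFlow_append]
    calc _ ≤ (g (x ++ [false]) + g (x ++ [true])) *
          (g (x ++ [b]) / (g (x ++ [false]) + g (x ++ [true]))) := by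
          gcongr; exact ih.trans (hg x)
      _ ≤ _ := by
          rcases eq_or_ne (g (x ++ [false]) + g (x ++ [true])) 0 with h | h
          · rw [h, zero_mul]; exact zero_le
          · exact (mul_div_cancel₀ _ h).le

theorem isFlow_splitFlow {g : List Bool → ℝ≥0}
    (hg : ∀ x, g x ≤ g (x ++ [false]) + g (x ++ [true])) {c : ℝ≥0} (hc : c ≤ g []) :
    IsFlow (splitFlow g c) := by
  intro x
  rw [splitFlow_append, splitFlow_append, ← mul_add, ← add_div]
  by_cases h : g (x ++ [false]) + g (x ++ [true]) = 0
  -- If both children have capacity 0, the quotients are junk, but then nothing flows into `x`.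
  · have : splitFlow g c x = 0 :=
      le_antisymm ((splitFlow_le hg hc x).trans ((hg x).trans h.le)) zero_le
    rw [this, zero_mul]
  · rw [div_self h, mul_one]

/-! ### Binary expansions and Frostman's lemma -/

/-- The number with the given binary digits. -/
def ofBits (b : ℕ → Bool) : ℝ := Real.ofDigits fun n => if b n then (1 : Fin 2) else 0

theorem continuous_ofBits : Continuous ofBits := by
  refine Real.continuous_ofDigits.comp (continuous_pi fun n => ?_)
  exact (continuous_of_discreteTopology (f := fun a : Bool => if a then (1 : Fin 2) else 0)).comp
    (continuous_apply n)

theorem ofBits_mem_Icc (b : ℕ → Bool) : ofBits b ∈ Set.Icc (0 : ℝ) 1 :=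
  ⟨Real.ofDigits_nonneg _, Real.ofDigits_le_one _⟩

theorem exists_ofBits_eq {x : ℝ} (hx : x ∈ Set.Icc (0 : ℝ) 1) : ∃ b, ofBits b = x := by
  obtain ⟨d, -, rfl⟩ := Real.ofDigits_SurjOn one_lt_two hx
  refine ⟨fun n => d n = 1, congrArg Real.ofDigits (funext fun n => ?_)⟩
  have h : ∀ a : Fin 2, (if decide (a = 1) then (1 : Fin 2) else 0) = a := by decide
  exact h (d n)

theorem ofBits_eq (b : ℕ → Bool) :
    ofBits b = ((if b 0 then 1 else 0) + ofBits fun n => b (n + 1)) / 2 := by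
  rw [ofBits, Real.ofDigits_eq_sum_add_ofDigits _ 1]
  rw [Finset.sum_range_one, Real.ofDigitsTerm, ofBits]
  cases b 0 <;> simp <;> ring

theorem pre_succ' (n : ℕ) (b : ℕ → Bool) : pre (n + 1) b = b 0 :: pre n fun k => b (k + 1) := by
  simp [pre, List.range_succ_eq_map, Function.comp_def]

theorem ofBits_mem_cellIcc_pre (n : ℕ) (b : ℕ → Bool) : ofBits b ∈ cellIcc (pre n b) := by
  induction n generalizing b with
  | zero => simpa [pre, cellIcc, left] using ofBits_mem_Icc b
  | succ n ih =>
    rw [pre_succ', ofBits_eq]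
    cases b 0
    · simpa using half_mem_cellIcc (ih fun k => b (k + 1))
    · simpa [add_comm] using half_add_mem_cellIcc (ih fun k => b (k + 1))

theorem ofBits_mem_cellIcc {b : ℕ → Bool} {z : List Bool} (h : b ∈ cylinder z) :
    ofBits b ∈ cellIcc z := by
  have := ofBits_mem_cellIcc_pre z.length b
  rwa [show pre z.length b = z from h] at this

/-- A cover of small total cost consists of small cells only, since each single term diam^t is small
and t > 0. So vanishing content yields covers admissible for the Hausdorff measure. -/
theorem hausdorffMeasure_eq_zero_of_content_eq_zero {t : ℝ≥0} (ht : 0 < t) {K : Set ℝ}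
    (hK : K ⊆ Set.Icc 0 1) (h : content ((2 : ℝ≥0∞) ^ (-t : ℝ)) (ofBits ⁻¹' K) = 0) :
    μH[t] K = 0 := by
  have hε (n : ℕ) : content ((2 : ℝ≥0∞) ^ (-t : ℝ)) (ofBits ⁻¹' K) < (n + 1 : ℝ≥0∞)⁻¹ := by
    rw [h]; simp
  choose Z hZ hlt using fun n => exists_tsum_lt_of_content_lt (hε n)
  have hdiam (z : List Bool) : Metric.ediam (cellIcc z) ^ (t : ℝ) =
      ((2 : ℝ≥0∞) ^ (-t : ℝ)) ^ z.length := by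
    rw [cellIcc, Real.ediam_Icc, add_sub_cancel_left, ENNReal.ofReal_pow (by norm_num),
      ENNReal.ofReal_inv_of_pos two_pos, ENNReal.ofReal_ofNat, ENNReal.rpow_neg, ← ENNReal.inv_rpow,
      ← ENNReal.rpow_natCast, ← ENNReal.rpow_natCast, ← ENNReal.rpow_mul, ← ENNReal.rpow_mul,
      mul_comm]
  have htend : Tendsto (fun n : ℕ => (n + 1 : ℝ≥0∞)⁻¹) atTop (𝓝 0) := by
    have := (tendsto_add_atTop_iff_nat 1).2 ENNReal.tendsto_inv_nat_nhds_zero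
    simpa using this
  have hr : Tendsto (fun n : ℕ => ((n + 1 : ℝ≥0∞)⁻¹) ^ (t⁻¹ : ℝ)) atTop (𝓝 0) := by
    have := htend.ennrpow_const (t⁻¹ : ℝ)
    rwa [ENNReal.zero_rpow_of_pos (by positivity)] at this
  have hle := Measure.hausdorffMeasure_le_liminf_tsum (ι := fun n => Z n) (t : ℝ) K _ hr
    (fun n z => cellIcc z) (.of_forall fun n z => by
      rw [ENNReal.le_rpow_inv_iff (by positivity), hdiam]
      exact (ENNReal.le_tsum (f := fun z : Z n => _ ^ z.1.length) z).trans (hlt n).le)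
    (.of_forall fun n x hx => by
      obtain ⟨b, rfl⟩ := exists_ofBits_eq (hK hx)
      obtain ⟨z, hz, hbz⟩ := Set.mem_iUnion₂.1 (hZ n hx)
      exact Set.mem_iUnion.2 ⟨⟨z, hz⟩, ofBits_mem_cellIcc hbz⟩)
  refine le_antisymm (hle.trans ?_) zero_le
  rw [← htend.liminf_eq]
  refine liminf_le_liminf (.of_forall fun n => ?_)
  simp only [hdiam]
  exact (hlt n).le

/-- Frostman's lemma, proved in the Cantor space, where sibling cylinders are disjoint. Below the
dimension the content is positive; a compact subset retains positive content, and the flow that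
splits in proportion to content is bounded by it. -/
theorem exists_isCompact_isFlow {K : Set ℝ} (hK : K ⊆ Set.Icc 0 1) (hKan : AnalyticSet K)
    {t : ℝ≥0} (ht : 0 < t) (h : (t : ℝ≥0∞) < dimH K) :
    ∃ C ⊆ K, IsCompact C ∧ ∃ θ, IsFlow θ ∧ θ [] ≠ 0 ∧
      (∀ z, θ z ≤ ((2 : ℝ≥0) ^ (-t : ℝ)) ^ z.length) ∧
      ∀ z, θ z ≠ 0 → (C ∩ cellIcc z).Nonempty := by
  have : PolishSpace Bool := inferInstance
  have hκ : ((2 : ℝ≥0∞) ^ (-t : ℝ)) ≤ 1 := by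
    rw [ENNReal.rpow_neg]
    exact ENNReal.inv_le_one.2 (ENNReal.one_le_rpow one_le_two (by positivity))
  have hcon : 0 < content ((2 : ℝ≥0∞) ^ (-t : ℝ)) (ofBits ⁻¹' K) := by
    refine pos_iff_ne_zero.2 fun h0 => ?_
    have := hausdorffMeasure_eq_zero_of_content_eq_zero ht hK h0
    rw [hausdorffMeasure_of_lt_dimH h] at this
    exact ENNReal.top_ne_zero this
  obtain ⟨c, hc0, hc⟩ := exists_between hcon
  obtain ⟨C, hCK, hCc, hcC⟩ :=
    exists_isCompact_content_ge hκ (hKan.preimage continuous_ofBits) hc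
  have hfin (A : Set (ℕ → Bool)) : content ((2 : ℝ≥0∞) ^ (-t : ℝ)) A ≠ ∞ :=
    ne_top_of_le_ne_top ENNReal.one_ne_top (content_le_one A)
  set g : List Bool → ℝ≥0 := fun z =>
    (content ((2 : ℝ≥0∞) ^ (-t : ℝ)) (C ∩ cylinder z)).toNNReal with hg
  have hg1 (z : List Bool) : g z ≤ g (z ++ [false]) + g (z ++ [true]) := by
    rw [hg, ← ENNReal.toNNReal_add (hfin _) (hfin _)]
    exact ENNReal.toNNReal_mono (ENNReal.add_ne_top.2 ⟨hfin _, hfin _⟩)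
      (content_inter_cylinder_le C z)
  refine ⟨ofBits '' C, Set.image_subset_iff.2 hCK, hCc.image continuous_ofBits,
    splitFlow g (g []), isFlow_splitFlow hg1 le_rfl, ?_, fun z => ?_, fun z hz => ?_⟩
  · change g [] ≠ 0
    simp only [hg]
    rw [cylinder_nil, Set.inter_univ, ENNReal.toNNReal_ne_zero]
    exact ⟨(hc0.trans_le hcC).ne', hfin _⟩
  · refine (splitFlow_le hg1 le_rfl z).trans ?_
    rw [← ENNReal.coe_le_coe, ENNReal.coe_toNNReal (hfin _), ENNReal.coe_pow,
      ENNReal.coe_rpow_of_ne_zero two_ne_zero]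
    exact content_cylinder_le C z
  · have hgz : g z ≠ 0 := fun h0 =>
      hz (le_antisymm ((splitFlow_le hg1 le_rfl z).trans h0.le) zero_le)
    have hne : (C ∩ cylinder z).Nonempty := by
      rw [Set.nonempty_iff_ne_empty]
      intro he
      rw [hg] at hgz
      simp [he, content_empty] at hgz
    obtain ⟨b, hbC, hbz⟩ := hne
    exact ⟨ofBits b, ⟨b, hbC, rfl⟩, ofBits_mem_cellIcc hbz⟩

/-! ### The interval of a separating node -/

theorem left_le_one (x : List Bool) : left x ≤ 1 := by
  have h1 := left_add_le_one x
  have h2 : (0 : ℝ) < 2⁻¹ ^ x.length := by positivity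
  linarith

/-- The right end of the interval of a word. -/
def right (x : List Bool) : ℝ := left x + 2⁻¹ ^ x.length

@[simp] theorem right_false (x : List Bool) : right (false :: x) = right x / 2 := by
  simp only [right, left, List.length_cons, pow_succ]; ring

@[simp] theorem right_true (x : List Bool) : right (true :: x) = (right x + 1) / 2 := by
  simp only [right, left, List.length_cons, pow_succ]; ring

theorem right_le_one (x : List Bool) : right x ≤ 1 := left_add_le_one x

theorem right_nonneg (x : List Bool) : 0 ≤ right x :=
  add_nonneg (left_nonneg x) (by positivity)

theorem adjSep_bounds {x y : List Bool} (h : x.length = y.length) :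
    (∀ J, adjSep x y = .inl J → left x ≤ left J) ∧
      ∀ J, adjSep x y = .inr J → right J ≤ right y := by
  induction x generalizing y with
  | nil =>
    refine ⟨?_, ?_⟩ <;> rintro J hJ <;> simp [adjSep] at hJ
    exact hJ ▸ le_rfl
  | cons b x ih =>
    rcases y with - | ⟨c, y⟩
    · simp at h
    rcases b with - | -
    · refine ⟨?_, ?_⟩ <;> rintro J hJ <;> simp [adjSep] at hJ
      subst hJ
      have := left_le_one x
      simp only [left]
      linarith
    rcases c with - | -
    · have ih' := ih (y := y) (by simpa using h)
      refine ⟨?_, ?_⟩ <;> rintro J hJ <;> simp only [adjSep] at hJ <;>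
        rcases hA : adjSep x y with A | A <;> rw [hA] at hJ <;>
        simp at hJ <;> subst hJ
      · have := ih'.1 A hA
        simp only [left]
        linarith
      · have := ih'.2 A hA
        simp only [right_false]
        linarith
    · refine ⟨?_, ?_⟩ <;> rintro J hJ <;> simp [adjSep] at hJ
      subst hJ
      have := right_nonneg y
      have : right [] = 1 := by simp [right, left]
      simp only [right_false, right_true]
      linarith

theorem sep_bounds {x y : List Bool} (h : x.length = y.length) :
    (left x ≤ left (sep x y) ∨ left y ≤ left (sep x y)) ∧
      (right (sep x y) ≤ right x ∨ right (sep x y) ≤ right y) := by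
  have cross {x y : List Bool} (h : x.length = y.length) :
      left (false :: x) ≤ left ((adjSep x y).elim (false :: ·) (true :: ·)) ∧
        right ((adjSep x y).elim (false :: ·) (true :: ·)) ≤ right (true :: y) := by
    obtain ⟨h1, h2⟩ := adjSep_bounds h
    have hx := left_le_one x
    have hy := right_nonneg y
    rcases hA : adjSep x y with A | A
    · have := h1 A hA
      have := right_le_one A
      simp only [Sum.elim_inl, left, right_false, right_true]
      constructor <;> linarith
    · have := h2 A hA
      have := left_nonneg A
      simp only [Sum.elim_inr, left, right_true]
      constructor <;> linarith
  induction x generalizing y with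
  | nil =>
    obtain rfl : y = [] := List.length_eq_zero_iff.1 h.symm
    exact ⟨.inl le_rfl, .inl le_rfl⟩
  | cons b x ih =>
    rcases y with - | ⟨c, y⟩
    · simp at h
    have h' : x.length = y.length := by simpa using h
    rcases b with - | - <;> rcases c with - | -
    · obtain ⟨h1, h2⟩ := ih h'
      simp only [sep, left, right_false]
      exact ⟨h1.imp (by intro; linarith) (by intro; linarith),
        h2.imp (by intro; linarith) (by intro; linarith)⟩
    · exact ⟨.inl (cross h').1, .inr (cross h').2⟩
    · exact ⟨.inr (cross h'.symm).1, .inl (cross h'.symm).2⟩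
    · obtain ⟨h1, h2⟩ := ih h'
      simp only [sep, left, right_true]
      exact ⟨h1.imp (by intro; linarith) (by intro; linarith),
        h2.imp (by intro; linarith) (by intro; linarith)⟩

theorem cellIcc_sep_subset {x y : List Bool} (h : x.length = y.length) {U : Set ℝ}
    (hU : U.OrdConnected) (hx : cellIcc x ⊆ U) (hy : cellIcc y ⊆ U) :
    cellIcc (sep x y) ⊆ U := by
  have hl (z : List Bool) : left z ∈ cellIcc z := ⟨le_rfl, by simp⟩
  have hr (z : List Bool) : right z ∈ cellIcc z := ⟨by simp [right], le_rfl⟩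
  obtain ⟨h1, h2⟩ := sep_bounds h
  rintro z ⟨hz1, hz2⟩
  rcases h1 with h1 | h1 <;> rcases h2 with h2 | h2
  · exact hU.out (hx (hl x)) (hx (hr x)) ⟨h1.trans hz1, hz2.trans h2⟩
  · exact hU.out (hx (hl x)) (hy (hr y)) ⟨h1.trans hz1, hz2.trans h2⟩
  · exact hU.out (hy (hl y)) (hx (hr x)) ⟨h1.trans hz1, hz2.trans h2⟩
  · exact hU.out (hy (hl y)) (hy (hr y)) ⟨h1.trans hz1, hz2.trans h2⟩

/-! ### Covers and energy -/

/-- The pseudometric `(x, y) ↦ μ [x, y]`. -/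
def intervalDist (μ : Measure ℝ) (x y : ℝ) : ℝ≥0∞ := μ (Set.Icc (min x y) (max x y))

/-- The order-convex hull of `t` has measure at most the diameter of `t`: by inner regularity it
suffices to look at compact subsets, and each lies in some [x, y] with endpoints in `t`, even if the
extremes of `t` are not attained. Outer regularity and passage to a connected component give the
open interval. -/
theorem exists_isOpen_ordConnected {μ : Measure ℝ} [IsFiniteMeasure μ] (t : Set ℝ) {ε : ℝ≥0∞}
    (hε : ε ≠ 0) : ∃ U, IsOpen U ∧ U.OrdConnected ∧ t ⊆ U ∧ (U.Nonempty → t.Nonempty) ∧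
      μ U ≤ diamOf (intervalDist μ) t + ε := by
  rcases t.eq_empty_or_nonempty with rfl | ⟨a, ha⟩
  · exact ⟨∅, isOpen_empty, Set.ordConnected_empty, le_rfl, id, by simp⟩
  set H : Set ℝ := {z | ∃ x ∈ t, ∃ y ∈ t, x ≤ z ∧ z ≤ y} with hH
  have htH : t ⊆ H := fun x hx => ⟨x, hx, x, hx, le_rfl, le_rfl⟩
  have hconn : H.OrdConnected := by
    refine ⟨?_⟩
    rintro z ⟨x, hx, -, -, hxz, -⟩ z' ⟨-, -, y, hy, -, hzy⟩ w ⟨h1, h2⟩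
    exact ⟨x, hx, y, hy, hxz.trans h1, h2.trans hzy⟩
  have hμH : μ H ≤ diamOf (intervalDist μ) t := by
    rw [hconn.measurableSet.measure_eq_iSup_isCompact]
    refine iSup₂_le fun A hA => iSup_le fun hAc => ?_
    rcases A.eq_empty_or_nonempty with rfl | hne
    · simp
    obtain ⟨p, hpA, hp⟩ := hAc.exists_isLeast hne
    obtain ⟨q, hqA, hq⟩ := hAc.exists_isGreatest hne
    obtain ⟨x, hx, -, -, hxp, -⟩ := hA hpA
    obtain ⟨-, -, y, hy, -, hqy⟩ := hA hqA
    calc μ A ≤ intervalDist μ x y := measure_mono fun z hz =>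
          ⟨(min_le_left _ _).trans (hxp.trans (hp hz)),
            (hq hz).trans (hqy.trans (le_max_right _ _))⟩
      _ ≤ ⨆ y ∈ t, intervalDist μ x y := le_iSup₂ (f := fun y _ => intervalDist μ x y) y hy
      _ ≤ _ := le_iSup₂ (f := fun x _ => ⨆ y ∈ t, intervalDist μ x y) x hx
  obtain ⟨U, hHU, hUo, hU⟩ := H.exists_isOpen_lt_add (measure_ne_top μ H) hε
  refine ⟨connectedComponentIn U a, hUo.connectedComponentIn,
    isPreconnected_connectedComponentIn.ordConnected, ?_, fun _ => ⟨a, ha⟩, ?_⟩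
  · exact htH.trans (hconn.isPreconnected.subset_connectedComponentIn (htH ha) hHU)
  · exact (measure_mono (connectedComponentIn_subset U a)).trans
      (hU.le.trans (by gcongr))

/-- Group the masses by the index `i`, apply Cauchy–Schwarz to N_j = (N_j w_j^(-s/2)) w_j^(s/2), and
keep in the energy only the pairs with equal index. -/
theorem sum_sq_le_mul {α ι : Type*} [DecidableEq ι] (S : Finset α) (i : α → ι) (X : α → ℝ≥0∞)
    (M : α → α → ℝ≥0∞) {w : ι → ℝ≥0∞} (hw0 : ∀ j, w j ≠ 0) (hwt : ∀ j, w j ≠ ∞) (s : ℝ)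
    (h : ∀ x ∈ S, ∀ y ∈ S, i x = i y → w (i x) ^ (-s) ≤ M x y) :
    (∑ x ∈ S, X x) ^ 2 ≤
      (∑ x ∈ S, ∑ y ∈ S, X x * X y * M x y) * ∑ j ∈ S.image i, w j ^ s := by
  set N : ι → ℝ≥0∞ := fun j => ∑ x ∈ S with i x = j, X x with hN
  have hsum : ∑ x ∈ S, X x = ∑ j ∈ S.image i, N j :=
    (Finset.sum_fiberwise_of_maps_to (fun x hx => Finset.mem_image_of_mem i hx) X).symm
  have hE : ∑ j ∈ S.image i, N j ^ 2 * w j ^ (-s) ≤ ∑ x ∈ S, ∑ y ∈ S, X x * X y * M x y := by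
    rw [← Finset.sum_fiberwise_of_maps_to (fun x hx => Finset.mem_image_of_mem i hx)
      fun x => ∑ y ∈ S, X x * X y * M x y]
    refine Finset.sum_le_sum fun j _ => ?_
    rw [sq, hN, Finset.sum_mul_sum, Finset.sum_mul]
    refine Finset.sum_le_sum fun x hx => ?_
    rw [Finset.sum_mul]
    refine le_trans (Finset.sum_le_sum fun y hy => ?_)
      (Finset.sum_le_sum_of_subset (Finset.filter_subset (fun y => i y = j) S))
    obtain ⟨hxS, rfl⟩ := Finset.mem_filter.1 hx
    obtain ⟨hyS, hxy⟩ := Finset.mem_filter.1 hy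
    gcongr
    exact h x hxS y hyS hxy.symm
  have hsq (a : ℝ≥0∞) : a ^ (2 : ℝ) = a ^ 2 := ENNReal.rpow_ofNat a 2
  have hCS := ENNReal.inner_le_Lp_mul_Lq (S.image i) (fun j => N j * w j ^ (-s / 2))
    (fun j => w j ^ (s / 2)) Real.HolderConjugate.two_two
  have h1 (j : ι) : N j * w j ^ (-s / 2) * w j ^ (s / 2) = N j := by
    rw [mul_assoc, ← ENNReal.rpow_add _ _ (hw0 j) (hwt j)]
    ring_nf
    rw [ENNReal.rpow_zero, mul_one]
  have h2 (j : ι) : (N j * w j ^ (-s / 2)) ^ (2 : ℝ) = N j ^ 2 * w j ^ (-s) := by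
    rw [ENNReal.mul_rpow_of_nonneg _ _ zero_le_two, hsq, ← ENNReal.rpow_mul,
      div_mul_cancel₀ _ two_ne_zero]
  have h3 (j : ι) : (w j ^ (s / 2)) ^ (2 : ℝ) = w j ^ s := by
    rw [← ENNReal.rpow_mul, div_mul_cancel₀ _ two_ne_zero]
  simp only [h1, h2, h3] at hCS
  have h4 (a : ℝ≥0∞) : (a ^ (1 / 2 : ℝ)) ^ 2 = a := by
    rw [← hsq, ← ENNReal.rpow_mul]; norm_num
  calc (∑ x ∈ S, X x) ^ 2 ≤ ((∑ j ∈ S.image i, N j ^ 2 * w j ^ (-s)) ^ (1 / 2 : ℝ) *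
        (∑ j ∈ S.image i, w j ^ s) ^ (1 / 2 : ℝ)) ^ 2 := by rw [hsum]; gcongr
    _ = (∑ j ∈ S.image i, N j ^ 2 * w j ^ (-s)) * ∑ j ∈ S.image i, w j ^ s := by
        rw [mul_pow, h4, h4]
    _ ≤ _ := by gcongr

namespace Weights

variable {θ : List Bool → ℝ≥0} {m : ℝ≥0} {s : ℝ}

theorem one_le_mul_tsum_diamOf {μ : Measure ℝ} [IsFiniteMeasure μ] {v : Weights} (hs : 0 < s)
    (hs1 : s < 1) {C : Set ℝ} (hC : IsCompact C)
    (hθC : ∀ z, θ z ≠ 0 → (C ∩ cellIcc z).Nonempty) (hmass : ∀ x, mass v x ≤ μ (cellIcc x))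
    (hN0 : ∀ n, tiltedSum θ m s n v ≠ 0) (hNt : ∀ n, tiltedSum θ m s n v ≠ ∞) {k : ℕ}
    (hk : ∃ᶠ n in atTop, energy θ m s n v ≤ k * tiltedSum θ m s n v ^ 2) {t : ℕ → Set ℝ}
    (ht : C ⊆ ⋃ i, t i) :
    1 ≤ k * ∑' i, ⨆ _ : (t i).Nonempty, diamOf (intervalDist μ) (t i) ^ s := by
  classical
  have key {δ : ℝ≥0} (hδ : δ ≠ 0) :
      1 ≤ k * (∑' i, (⨆ _ : (t i).Nonempty, diamOf (intervalDist μ) (t i) ^ s) + δ) := by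
    -- The i-th set is enlarged by mass ε_i^(1/s): since s < 1, (d + ε_i^(1/s))^s ≤ d^s + ε_i, and
    -- the errors sum to less than δ.
    obtain ⟨ε, hε, hεδ⟩ := ENNReal.exists_pos_sum_of_countable (ENNReal.coe_ne_zero.2 hδ) ℕ
    have hη0 (i : ℕ) : (ε i : ℝ≥0∞) ^ (s⁻¹) ≠ 0 := by
      rw [Ne, ENNReal.rpow_eq_zero_iff_of_pos (by positivity)]
      exact ENNReal.coe_ne_zero.2 (hε i).ne'
    have hηt (i : ℕ) : (ε i : ℝ≥0∞) ^ (s⁻¹) ≠ ∞ :=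
      ENNReal.rpow_ne_top_of_nonneg (by positivity) ENNReal.coe_ne_top
    choose U hUo hUc htU hUne hμU using
      fun i => exists_isOpen_ordConnected (μ := μ) (t i) (hη0 i)
    set w : ℕ → ℝ≥0∞ := fun i => diamOf (intervalDist μ) (t i) + (ε i : ℝ≥0∞) ^ (s⁻¹) with hw
    have hdiam (i : ℕ) : diamOf (intervalDist μ) (t i) ≤ μ Set.univ :=
      iSup₂_le fun _ _ => iSup₂_le fun _ _ => measure_mono (Set.subset_univ _)
    obtain ⟨r, hr, hball⟩ := lebesgue_number_lemma_of_metric hC hUo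
      (ht.trans (Set.iUnion_mono htU))
    obtain ⟨n₀, hn₀⟩ := exists_pow_lt_of_lt_one hr (show (2⁻¹ : ℝ) < 1 by norm_num)
    -- Energy control at infinitely many levels suffices: one of them has cells shorter than the
    -- Lebesgue number of the open cover.
    obtain ⟨n, hkn, hn⟩ := (hk.and_eventually (eventually_ge_atTop n₀)).exists
    have hnr : (2⁻¹ : ℝ) ^ n < r :=
      (pow_le_pow_of_le_one (by norm_num) (by norm_num) hn).trans_lt hn₀
    set S : Finset (List Bool) := {x ∈ words n | tilted θ m s v x ≠ 0} with hS
    have hcell (x : List Bool) : ∃ i, x ∈ S → cellIcc x ⊆ U i := by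
      by_cases hx : x ∈ S
      · obtain ⟨hxn, hx0⟩ := Finset.mem_filter.1 hx
        have hθx : θ x ≠ 0 := by
          rintro h0
          simp [tilted, h0] at hx0
        obtain ⟨p, hpC, hpx⟩ := hθC x hθx
        obtain ⟨i, hi⟩ := hball p hpC
        refine ⟨i, fun _ y hy => hi ?_⟩
        have := Real.dist_le_of_mem_Icc hy hpx
        rw [add_sub_cancel_left, mem_words.1 hxn] at this
        exact this.trans_lt hnr
      · exact ⟨0, fun h => absurd h hx⟩
    choose i hi using hcell
    have hCS := sum_sq_le_mul S i (tilted θ m s v) (fun x y => mass v (sep x y) ^ (-s)) (w := w)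
      (fun j => by simp [hw, hη0]) (fun j => ENNReal.add_ne_top.2
        ⟨ne_top_of_le_ne_top (measure_ne_top μ _) (hdiam j), hηt j⟩) s
      fun x hx y hy hxy => by
        rw [ENNReal.rpow_neg, ENNReal.rpow_neg]
        gcongr
        have hlen : x.length = y.length :=
          (mem_words.1 (Finset.mem_filter.1 hx).1).trans
            (mem_words.1 (Finset.mem_filter.1 hy).1).symm
        calc mass v (sep x y) ≤ μ (cellIcc (sep x y)) := hmass _
          _ ≤ μ (U (i x)) := measure_mono (cellIcc_sep_subset hlen (hUc _) (hi x hx)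
              (hxy ▸ hi y hy))
          _ ≤ _ := hμU _
    have hN : tiltedSum θ m s n v = ∑ x ∈ S, tilted θ m s v x := by
      rw [tiltedSum, hS, Finset.sum_filter_ne_zero]
    have hE : ∑ x ∈ S, ∑ y ∈ S, tilted θ m s v x * tilted θ m s v y * mass v (sep x y) ^ (-s) ≤
        energy θ m s n v := by
      refine (Finset.sum_le_sum fun x _ => ?_).trans
        (Finset.sum_le_sum_of_subset (Finset.filter_subset _ _))
      exact Finset.sum_le_sum_of_subset (Finset.filter_subset _ _)
    have hW : ∑ j ∈ S.image i, w j ^ s ≤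
        ∑' i, (⨆ _ : (t i).Nonempty, diamOf (intervalDist μ) (t i) ^ s) + δ := by
      calc ∑ j ∈ S.image i, w j ^ s
          ≤ ∑ j ∈ S.image i, ((⨆ _ : (t j).Nonempty, diamOf (intervalDist μ) (t j) ^ s) + ε j) := by
            refine Finset.sum_le_sum fun j hj => ?_
            obtain ⟨x, hx, rfl⟩ := Finset.mem_image.1 hj
            have hne : (t (i x)).Nonempty :=
              hUne _ ⟨left x, hi x hx ⟨le_rfl, by simp⟩⟩
            rw [iSup_pos hne]
            refine (ENNReal.rpow_add_le_add_rpow _ _ hs.le hs1.le).trans ?_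
            rw [← ENNReal.rpow_mul, inv_mul_cancel₀ hs.ne', ENNReal.rpow_one]
        _ ≤ ∑' j, ((⨆ _ : (t j).Nonempty, diamOf (intervalDist μ) (t j) ^ s) + ε j) :=
            ENNReal.sum_le_tsum _
        _ ≤ _ := by
            rw [ENNReal.tsum_add]
            gcongr
    have hfinal : tiltedSum θ m s n v ^ 2 * 1 ≤ tiltedSum θ m s n v ^ 2 * (k *
        (∑' i, (⨆ _ : (t i).Nonempty, diamOf (intervalDist μ) (t i) ^ s) + δ)) := by
      rw [mul_one]
      calc tiltedSum θ m s n v ^ 2 ≤ energy θ m s n v * ∑ j ∈ S.image i, w j ^ s := by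
            rw [← hN] at hCS
            exact hCS.trans (by gcongr)
        _ ≤ k * tiltedSum θ m s n v ^ 2 * (∑' i, (⨆ _ : (t i).Nonempty,
            diamOf (intervalDist μ) (t i) ^ s) + δ) := by gcongr
        _ = _ := by ring
    exact (ENNReal.mul_le_mul_iff_right (pow_ne_zero 2 (hN0 n)) (ENNReal.pow_ne_top (hNt n))).1 hfinal
  set T := ∑' i, ⨆ _ : (t i).Nonempty, diamOf (intervalDist μ) (t i) ^ s with hT
  have htend : Tendsto (fun δ : ℝ≥0 => (k : ℝ≥0∞) * (T + δ)) (𝓝[≠] 0) (𝓝 (k * (T + (0 : ℝ≥0)))) := by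
    refine ENNReal.Tendsto.const_mul (Tendsto.const_add _ ?_) (.inr (ENNReal.natCast_ne_top k))
    exact (ENNReal.tendsto_coe.2 tendsto_id).mono_left nhdsWithin_le_nhds
  rw [ENNReal.coe_zero, add_zero] at htend
  exact ge_of_tendsto htend (by filter_upwards [self_mem_nhdsWithin] with δ hδ using key hδ)

/-- For p < s, sets of diameter at most r satisfy ∑ diam^s ≤ r^(s-p) ∑ diam^p. The lower bound 1/k
on the left forces the sums on the right to infinity as r → 0. -/
theorem le_dimHOf_of_mem_goodSet {μ : Measure ℝ} [IsFiniteMeasure μ] {v : Weights} (hs : 0 < s)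
    (hs1 : s < 1) {C K : Set ℝ} (hC : IsCompact C) (hCK : C ⊆ K)
    (hθC : ∀ z, θ z ≠ 0 → (C ∩ cellIcc z).Nonempty) (hmass : ∀ x, mass v x ≤ μ (cellIcc x))
    (hN0 : ∀ n, tiltedSum θ m s n v ≠ 0) (hNt : ∀ n, tiltedSum θ m s n v ≠ ∞)
    (hv : v ∈ goodSet θ m s) : ENNReal.ofReal s ≤ dimHOf (intervalDist μ) K := by
  obtain ⟨k, hk⟩ := hv
  refine ENNReal.le_of_forall_nnreal_lt fun p hp => ?_
  have hps : (p : ℝ) < s := by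
    rwa [ENNReal.lt_ofReal_iff_toReal_lt ENNReal.coe_ne_top, ENNReal.coe_toReal] at hp
  refine le_iSup₂_of_le p ?_ le_rfl
  refine ENNReal.eq_top_of_forall_nnreal_le fun a => ?_
  have hsp : 0 < s - p := sub_pos.2 hps
  have htend : Tendsto (fun r : ℝ≥0∞ => (k * a : ℝ≥0∞) * r ^ (s - p)) (𝓝[>] 0) (𝓝 0) := by
    have h1 : Tendsto (fun r : ℝ≥0∞ => (k * a : ℝ≥0∞) * r ^ (s - p)) (𝓝 0)
        (𝓝 ((k * a : ℝ≥0∞) * 0 ^ (s - p))) :=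
      ENNReal.Tendsto.const_mul (tendsto_id.ennrpow_const _)
        (.inr (ENNReal.mul_ne_top (ENNReal.natCast_ne_top k) ENNReal.coe_ne_top))
    rw [ENNReal.zero_rpow_of_pos hsp, mul_zero] at h1
    exact h1.mono_left nhdsWithin_le_nhds
  obtain ⟨r, hr1, hr0⟩ := ((htend.eventually_lt_const one_pos).and self_mem_nhdsWithin).exists
  refine le_iSup₂_of_le r hr0 (le_iInf fun t => le_iInf₂ fun ht hr => ?_)
  by_contra! hlt
  have h := one_le_mul_tsum_diamOf hs hs1 hC hθC hmass hN0 hNt hk (hCK.trans ht)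
  refine h.not_gt (lt_of_le_of_lt ?_ hr1)
  have hle (i : ℕ) : (⨆ _ : (t i).Nonempty, diamOf (intervalDist μ) (t i) ^ s) ≤
      r ^ (s - p) * ⨆ _ : (t i).Nonempty, diamOf (intervalDist μ) (t i) ^ (p : ℝ) := by
    refine iSup_le fun hne => ?_
    rw [iSup_pos hne]
    calc diamOf (intervalDist μ) (t i) ^ s
        = diamOf (intervalDist μ) (t i) ^ (s - p) * diamOf (intervalDist μ) (t i) ^ (p : ℝ) := by
          rw [← ENNReal.rpow_add_of_nonneg _ _ hsp.le p.coe_nonneg, sub_add_cancel]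
      _ ≤ _ := by gcongr; exact hr i
  calc _ ≤ (k : ℝ≥0∞) * ∑' i, r ^ (s - p) *
        ⨆ _ : (t i).Nonempty, diamOf (intervalDist μ) (t i) ^ (p : ℝ) := by
        gcongr with i; exact hle i
    _ = (k : ℝ≥0∞) * (r ^ (s - p) *
        ∑' i, ⨆ _ : (t i).Nonempty, diamOf (intervalDist μ) (t i) ^ (p : ℝ)) := by
        rw [ENNReal.tsum_mul_left]
    _ ≤ k * (r ^ (s - p) * a) := by gcongr
    _ = _ := by ring

end Weights

end Cascade

namespace Cascade

namespace Weights

/-! ### The almost sure lower bound -/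

variable {lam : Measure ℝ≥0} [IsProbabilityMeasure lam] {m : ℝ≥0} {s : ℝ}

/-- The hypothesis `hst` is φ(s) < t written as τκ < 1 with τ = 2^s / m and κ = 2^(-t). Quantifying
over all `V` that restrict to `v` avoids inverting `toDyadic`. -/
theorem ae_le_dimHOf_rho (hpos : ∀ᵐ a ∂lam, 0 < a) (hmean : ∫⁻ a, (a : ℝ≥0∞) ∂lam = 1)
    (hent : Integrable (fun a : ℝ≥0 => (a : ℝ) * Real.log a) lam)
    (hlt : ∫ a : ℝ≥0, (a : ℝ) * Real.log a ∂lam < Real.log 2) (hs : 0 < s) (hs1 : s < 1)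
    (hm0 : m ≠ 0) (hm : ∫⁻ a, (a : ℝ≥0∞) ^ s ∂lam = m)
    (hmom : ∫⁻ a, (a : ℝ≥0∞) ^ (-s) ∂lam < ∞) {K : Set ℝ} (hK : K ⊆ Set.Icc 0 1)
    (hKan : AnalyticSet K) {t : ℝ≥0} (ht0 : 0 < t) (ht : (t : ℝ≥0∞) < dimH K)
    (hst : (2 : ℝ≥0) ^ s / m * 2 ^ (-t : ℝ) < 1) :
    ∀ᵐ v ∂law lam, ∀ V : Dyadic → ℝ, (∀ x, V (toDyadic x) = v x) →
      ENNReal.ofReal s ≤ dimHOf (rho V) K := by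
  obtain ⟨C, hCK, hC, θ, hθ, hθ0, hθκ, hθC⟩ := exists_isCompact_isFlow hK hKan ht0 ht
  obtain ⟨B, hB⟩ := hθ.exists_sum_sep_le hst (c := 1) fun x => by rw [one_mul]; exact hθκ x
  have hlim := ae_limTotal_pos hpos hmean hent hlt
  have hY := lintegral_limTotal_rpow_neg_lt_top hpos hlim hs hmom
  have hgood := ae_mem_goodSet hpos hs hs1 hm0 hm hmean hlim hθ hθ0
    (ENNReal.mul_ne_top ENNReal.coe_ne_top hY.ne) (lintegral_energy_le hpos hs hm0 hm hB)
  filter_upwards [hgood, ae_apply lam hpos, ae_subtree lam (ae_tendsto_total lam hmean)]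
    with v hv hvpos hconv V hV
  have hpath (v : Weights) (hv : ∀ x, 0 < v x) (x : List Bool) : pathProd v x ≠ 0 := by
    induction x generalizing v with
    | nil => exact one_ne_zero
    | cons b x ih => exact mul_ne_zero (hv []).ne' (ih _ fun y => hv (b :: y))
  have hminv : (m : ℝ≥0∞)⁻¹ ≠ 0 := ENNReal.inv_ne_zero.2 ENNReal.coe_ne_top
  refine le_dimHOf_of_mem_goodSet (μ := cascadeMeasure V) hs hs1 hC hCK hθC
    (mass_le_cascadeMeasure hV hconv) (fun n h0 => ?_) (fun n => ?_) hv
  · have hsum := hθ.sum_words n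
    rw [tiltedSum, Finset.sum_eq_zero_iff] at h0
    refine hθ0 (hsum.symm.trans (Finset.sum_eq_zero fun x hx => ?_))
    have h := h0 x hx
    rw [tilted, mul_eq_zero, mul_eq_zero, ENNReal.rpow_eq_zero_iff_of_pos hs] at h
    rcases h with (h | h) | h
    · exact ENNReal.coe_eq_zero.1 h
    · exact absurd h (pow_ne_zero _ hminv)
    · exact absurd (ENNReal.coe_eq_zero.1 h) (hpath v hvpos x)
  · rw [tiltedSum]
    refine ENNReal.sum_ne_top.2 fun x _ => ?_
    exact ENNReal.mul_ne_top (ENNReal.mul_ne_top ENNReal.coe_ne_top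
      (ENNReal.pow_ne_top (ENNReal.inv_ne_top.2 (ENNReal.coe_ne_zero.2 hm0))))
      (ENNReal.rpow_ne_top_of_nonneg hs.le ENNReal.coe_ne_top)

end Weights

/-! ### Passage from the given random variables to the law on the binary tree. -/

section Transfer

variable {Ω : Type*} [MeasurableSpace Ω] {P : Measure Ω} {W : Ω → ℝ}

/-- Bernoulli's inequality W^s ≤ 1 + s(W - 1) gives both claims. The bound by 1 yields φ(s) ≥ s > 0.
-/
theorem integrable_rpow_of_integral_eq_one [IsProbabilityMeasure P] (hWm : AEMeasurable W P) (hWpos : ∀ᵐ ω ∂P, 0 < W ω)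
    (hWmean : ∫ ω, W ω ∂P = 1) {s : ℝ} (hs : 0 < s) (hs1 : s < 1) :
    Integrable (fun ω => W ω ^ s) P ∧ ∫ ω, W ω ^ s ∂P ≤ 1 := by
  have hWi : Integrable W P := by
    by_contra h
    rw [integral_undef h] at hWmean
    exact zero_ne_one hWmean
  have hsub : Integrable (fun ω => s * (W ω - 1)) P := (hWi.sub (integrable_const 1)).const_mul s
  have hi : Integrable (fun ω => 1 + s * (W ω - 1)) P := (integrable_const 1).add hsub
  have hle : ∀ᵐ ω ∂P, W ω ^ s ≤ 1 + s * (W ω - 1) := by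
    filter_upwards [hWpos] with ω hω
    have := rpow_one_add_le_one_add_mul_self (s := W ω - 1) (by linarith) hs.le hs1.le
    rwa [add_sub_cancel] at this
  have hi' : Integrable (fun ω => W ω ^ s) P := by
    refine hi.mono' (hWm.pow_const s).aestronglyMeasurable ?_
    filter_upwards [hWpos, hle] with ω hω h
    rwa [Real.norm_of_nonneg (by positivity)]
  refine ⟨hi', (integral_mono_ae hi' hi hle).trans (le_of_eq ?_)⟩
  rw [integral_add (integrable_const 1) hsub,
    integral_const_mul, integral_sub hWi (integrable_const 1), hWmean]
  simp

theorem integral_rpow_pos [IsProbabilityMeasure P] (hWm : AEMeasurable W P) (hWpos : ∀ᵐ ω ∂P, 0 < W ω)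
    (hWmean : ∫ ω, W ω ∂P = 1) {s : ℝ} (hs : 0 < s) (hs1 : s < 1) : 0 < ∫ ω, W ω ^ s ∂P := by
  have hi := (integrable_rpow_of_integral_eq_one hWm hWpos hWmean hs hs1).1
  have h0 : 0 ≤ᵐ[P] fun ω => W ω ^ s := by
    filter_upwards [hWpos] with ω hω using by positivity
  rw [integral_pos_iff_support_of_nonneg_ae h0 hi]
  have : Function.support (fun ω => W ω ^ s) =ᵐ[P] Set.univ := by
    rw [eventuallyEq_univ]
    filter_upwards [hWpos] with ω hω using (by positivity : W ω ^ s ≠ 0)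
  rw [measure_congr this]
  simp

theorem lintegral_map_toNNReal (hWm : AEMeasurable W P) {f : ℝ≥0 → ℝ≥0∞} {g : ℝ → ℝ}
    (hf : Measurable f) (hWpos : ∀ᵐ ω ∂P, 0 < W ω)
    (hfg : ∀ a : ℝ≥0, 0 < a → f a = ENNReal.ofReal (g a)) (hg : ∀ a, 0 < a → 0 ≤ g a)
    (hi : Integrable (fun ω => g (W ω)) P) :
    ∫⁻ a, f a ∂P.map (fun ω => (W ω).toNNReal) = ENNReal.ofReal (∫ ω, g (W ω) ∂P) := by
  rw [lintegral_map' hf.aemeasurable hWm.real_toNNReal, ofReal_integral_eq_lintegral_ofReal hi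
    (by filter_upwards [hWpos] with ω hω using hg _ hω)]
  refine lintegral_congr_ae ?_
  filter_upwards [hWpos] with ω hω
  rw [hfg _ (Real.toNNReal_pos.2 hω), Real.coe_toNNReal _ hω.le]

theorem ae_le_dimHOf_rho_of_phi_lt [IsProbabilityMeasure P] {V : Dyadic → Ω → ℝ} (hVindep : iIndepFun V P)
    (hVlaw : ∀ I, IdentDistrib (V I) W P P) (hWpos : ∀ᵐ ω ∂P, 0 < W ω)
    (hWmean : ∫ ω, W ω ∂P = 1) (hWlogInt : Integrable (fun ω => W ω * Real.logb 2 (W ω)) P)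
    (hWlog : ∫ ω, W ω * Real.logb 2 (W ω) ∂P < 1) {K : Set ℝ} (hK : K ⊆ Set.Icc 0 1)
    (hKan : AnalyticSet K) {s : ℝ} (hs : 0 < s) (hs1 : s < 1)
    (hφ : ((phi P W s : ℝ) : EReal) < ((dimH K : ℝ≥0∞) : EReal))
    (hmom : Integrable (fun ω => W ω ^ (-s)) P) :
    ∀ᵐ ω ∂P, ENNReal.ofReal s ≤ dimHOf (rho fun I => V I ω) K := by
  have hWm : AEMeasurable W P := (hVlaw ⟨0, 0⟩).aemeasurable_snd
  have hWi : Integrable W P := by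
    by_contra h
    rw [integral_undef h] at hWmean
    exact zero_ne_one hWmean
  set lam : Measure ℝ≥0 := P.map fun ω => (W ω).toNNReal with hlam
  have hprob : IsProbabilityMeasure lam := Measure.isProbabilityMeasure_map hWm.real_toNNReal
  obtain ⟨hsi, hs_le⟩ := integrable_rpow_of_integral_eq_one hWm hWpos hWmean hs hs1
  have hs_pos := integral_rpow_pos hWm hWpos hWmean hs hs1
  set E := ∫ ω, W ω ^ s ∂P with hE
  have hrpow (r : ℝ) (a : ℝ≥0) (ha : 0 < a) :
      (a : ℝ≥0∞) ^ r = ENNReal.ofReal ((a : ℝ) ^ r) := by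
    rw [← ENNReal.ofReal_rpow_of_pos (NNReal.coe_pos.2 ha), ENNReal.ofReal_coe_nnreal]
  have hpos : ∀ᵐ a ∂lam, 0 < a := by
    rw [hlam, ae_map_iff hWm.real_toNNReal measurableSet_Ioi]
    filter_upwards [hWpos] with ω hω using Real.toNNReal_pos.2 hω
  have hmean : ∫⁻ a, (a : ℝ≥0∞) ∂lam = 1 := by
    rw [lintegral_map_toNNReal (g := id) hWm (by fun_prop) hWpos
      (fun a _ => (ENNReal.ofReal_coe_nnreal).symm) (fun a ha => ha.le) hWi]
    simp [hWmean]
  have hm : ∫⁻ a, (a : ℝ≥0∞) ^ s ∂lam = (E.toNNReal : ℝ≥0∞) :=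
    lintegral_map_toNNReal (g := fun a => a ^ s) hWm (by fun_prop) hWpos (hrpow s)
      (fun a ha => by positivity) hsi
  have hmom' : ∫⁻ a, (a : ℝ≥0∞) ^ (-s) ∂lam < ∞ := by
    rw [lintegral_map_toNNReal (g := fun a => a ^ (-s)) hWm (by fun_prop) hWpos (hrpow (-s))
      (fun a ha => by positivity) hmom]
    exact ENNReal.ofReal_lt_top
  have hlog2 : 0 < Real.log 2 := Real.log_pos one_lt_two
  have hlogeq : (fun ω => ((W ω).toNNReal : ℝ) * Real.log (W ω).toNNReal) =ᵐ[P]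
      fun ω => W ω * Real.logb 2 (W ω) * Real.log 2 := by
    filter_upwards [hWpos] with ω hω
    rw [Real.coe_toNNReal _ hω.le, mul_assoc, Real.logb, div_mul_cancel₀ _ hlog2.ne']
  have hmeas : Measurable fun a : ℝ≥0 => (a : ℝ) * Real.log a := by fun_prop
  have hent : Integrable (fun a : ℝ≥0 => (a : ℝ) * Real.log a) lam := by
    rw [hlam, integrable_map_measure hmeas.aestronglyMeasurable hWm.real_toNNReal]
    exact (hWlogInt.mul_const _).congr hlogeq.symm
  have hlt : ∫ a : ℝ≥0, (a : ℝ) * Real.log a ∂lam < Real.log 2 := by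
    rw [hlam, integral_map hWm.real_toNNReal hmeas.aestronglyMeasurable, integral_congr_ae hlogeq,
      integral_mul_const]
    exact (mul_lt_mul_of_pos_right hWlog hlog2).trans_eq (one_mul _)
  have hφs : s ≤ phi P W s := by
    have : Real.logb 2 E ≤ 0 := Real.logb_nonpos one_lt_two hs_pos.le hs_le
    rw [phi]
    linarith
  have hφ' : ENNReal.ofReal (phi P W s) < dimH K := by
    rw [← EReal.coe_ennreal_lt_coe_ennreal_iff, EReal.coe_ennreal_ofReal,
      max_eq_left (hs.le.trans hφs)]
    exact hφ
  -- The Frostman exponent lies strictly between φ(s) and the Euclidean dimension.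
  obtain ⟨t, hφt, ht⟩ := ENNReal.lt_iff_exists_nnreal_btwn.1 hφ'
  have hφt' : phi P W s < t := by
    rw [← ENNReal.ofReal_coe_nnreal] at hφt
    exact (ENNReal.ofReal_lt_ofReal_iff_of_nonneg (hs.le.trans hφs)).1 hφt
  have ht0 : 0 < t := NNReal.coe_pos.1 (hs.trans_le (hφs.trans hφt'.le))
  have hst : (2 : ℝ≥0) ^ s / E.toNNReal * 2 ^ (-t : ℝ) < 1 := by
    rw [← NNReal.coe_lt_coe]
    push_cast
    rw [Real.coe_toNNReal _ hs_pos.le]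
    have h2E : (2 : ℝ) ^ Real.logb 2 E = E := Real.rpow_logb two_pos (by norm_num) hs_pos
    have hphi : (2 : ℝ) ^ s / E = 2 ^ phi P W s := by
      rw [phi, Real.rpow_sub two_pos, ← hE, h2E]
    rw [hphi, ← Real.rpow_add two_pos]
    exact Real.rpow_lt_one_of_one_lt_of_neg one_lt_two (by linarith)
  have hae := Weights.ae_le_dimHOf_rho hpos hmean hent hlt hs hs1
    (Real.toNNReal_pos.2 hs_pos).ne' hm hmom' hK hKan ht0 ht hst
  have hVm (x : List Bool) : AEMeasurable (fun ω => (V (toDyadic x) ω).toNNReal) P :=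
    (hVlaw _).aemeasurable_fst.real_toNNReal
  have hlaw : P.map (fun ω x => (V (toDyadic x) ω).toNNReal) = Weights.law lam := by
    have hind : iIndepFun (fun x ω => (V (toDyadic x) ω).toNNReal) P :=
      (hVindep.precomp toDyadic_injective).comp (fun _ => Real.toNNReal)
        fun _ => measurable_real_toNNReal
    rw [hind.map_fun_eq_infinitePi_map₀' hVm, Weights.law]
    congr 1
    funext x
    exact ((hVlaw (toDyadic x)).comp measurable_real_toNNReal).map_eq
  rw [← hlaw] at hae
  have hVpos : ∀ᵐ ω ∂P, ∀ x, 0 < V (toDyadic x) ω := by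
    rw [ae_all_iff]
    exact fun x => (hVlaw (toDyadic x)).symm.ae_snd measurableSet_Ioi hWpos
  filter_upwards [ae_of_ae_map (aemeasurable_pi_lambda _ hVm) hae, hVpos] with ω hω hpos'
  exact hω (fun I => V I ω) fun x => (Real.coe_toNNReal _ (hpos' x).le).symm

end Transfer

end Cascade

end

theorem mainTheorem3 {Ω : Type*} [MeasurableSpace Ω] (P : Measure Ω) [IsProbabilityMeasure P]
    (W : Ω → ℝ) (V : Cascade.Dyadic → Ω → ℝ)
    (hVindep : iIndepFun V P)
    (hVlaw : ∀ I, IdentDistrib (V I) W P P)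
    (hWpos : ∀ᵐ ω ∂P, 0 < W ω)
    (hWmean : ∫ ω, W ω ∂P = 1)
    (hWlogInt : Integrable (fun ω => W ω * Real.logb 2 (W ω)) P)
    (hWlog : ∫ ω, W ω * Real.logb 2 (W ω) ∂P < 1)
    (K : Set ℝ) (hK : K ⊆ Set.Icc 0 1) (hKan : AnalyticSet K) :
    ∀ᵐ ω ∂P,
      ENNReal.ofReal (sSup {s : ℝ | s ∈ Set.Ioo (0 : ℝ) 1 ∧
        ((Cascade.phi P W s : ℝ) : EReal) < ((dimH K : ℝ≥0∞) : EReal) ∧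
        Integrable (fun ω' => W ω' ^ (-s)) P})
      ≤ Cascade.dimHOf (Cascade.rho fun I => V I ω) K := by
  set S : Set ℝ := {s : ℝ | s ∈ Set.Ioo (0 : ℝ) 1 ∧
    ((Cascade.phi P W s : ℝ) : EReal) < ((dimH K : ℝ≥0∞) : EReal) ∧
    Integrable (fun ω' => W ω' ^ (-s)) P} with hS
  rcases S.eq_empty_or_nonempty with he | hne
  · simp [he]
  -- The exceptional null set depends on s, so the supremum is approached along a sequence.
  obtain ⟨u, -, hu, huS⟩ := exists_seq_tendsto_sSup hne ⟨1, fun s hs => hs.1.2.le⟩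
  have h (n : ℕ) : ∀ᵐ ω ∂P,
      ENNReal.ofReal (u n) ≤ Cascade.dimHOf (Cascade.rho fun I => V I ω) K :=
    Cascade.ae_le_dimHOf_rho_of_phi_lt hVindep hVlaw hWpos hWmean hWlogInt hWlog hK hKan
      (huS n).1.1 (huS n).1.2 (huS n).2.1 (huS n).2.2
  filter_upwards [ae_all_iff.2 h] with ω hω
  exact le_of_tendsto' ((ENNReal.continuous_ofReal.tendsto _).comp hu) hω
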